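/- **Notation.** For a finite set $\mathcal P\subset[0,1]^2$ of $r$ points with pairwise distinct x-coordinates and pairwise distinct y-coordinates, $\mathrm{perm}(\mathcal P)\in\mathfrak S_r$ denotes the permutation with $\mathrm{perm}(\mathcal P)(i)=j$ when the $i$-th point from the left is the $j$-th point from the bottom. For $\tau\in\mathfrak S_n$, $\pi\in\mathfrak S_r$, let $X_\pi(\tau)$ be the number of subsets $\{i_1<\dots<i_r\}\subseteq\{1,\dots,n\}$ such that, for all $j,k$, $\pi(j)<\pi(k)\Leftrightarrow\tau(i_j)<\tau(i_k)$. A cycle type of size $n$ is a sequence $t=(t_1,\dots,t_n)$ of nonnegative integers with $\sum_p p\,t_p=n$; a permutation of $\{1,\dots,n\}$ is $t$-cyclic if it has exactly $t_p$ cycles of length $p$ for every $p$. For $p_1\in[0,1]$ let $\hat Z_1,\dots,\hat Z_r$ be i.i.d. with law $p_1\mathrm{Leb}_\Delta+(1-p_1)\mathrm{Leb}_{[0,1]^2}$, where $\mathrm{Leb}_\Delta$ is the uniform probability measure on the diagonal of $[0,1]^2$, and set $$\psi_\pi^{p_1}(z)=\mathbb P\big(\mathrm{perm}(\hat Z_1,\dots,\hat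 Z_{r-1},z)=\pi\big)\quad(z\in[0,1]^2),\qquad \mu_\pi^{p_1}=\mathbb P\big(\mathrm{perm}(\hat Z_1,\dots,\hat Z_r)=\pi\big).$$ **Theorem.** Let $(t^{(n)})_n$ be a sequence of cycle types, $t^{(n)}$ of size $n$, such that $t_1^{(n)}=np_1+o(\sqrt n)$ and $2t_2^{(n)}=np_2+o(n)$ as $n\to\infty$, for some $p_1,p_2\in[0,1]$. For each $n$, let $\tau_n$ be a uniformly random $t^{(n)}$-cyclic permutation. Then for every integer $r\ge1$, we have the joint convergence in distribution $$\left(\frac{X_\pi(\tau_n)-\binom nr\mu_\pi^{p_1}}{n^{r-1/2}}\right)_{\pi\in\mathfrak S_r}\ \xrightarrow[n\to\infty]{}\ \mathcal N\big(0,\Sigma^{p_1,p_2}\big),$$ where $\Sigma^{p_1,p_2}$ is the positive semidefinite (possibly singular) matrix given, for $\pi,\rho\in\mathfrak S_r$ and $U,V,W$ i.i.d. uniform on $[0,1]$, by $$\begin{aligned}(r-1)!^2\,\Sigma^{p_1,p_2}_{\pi,\rho}={}&p_1\mathrm{Cov}\big(\psi_\pi^{p_1}(U,U),\psi_\rho^{p_1}(U,U)\big)+(1-p_1)\mathrm{Cov}\big(\psi_\pi^{p_1}(U,V),\psi_\rho^{p_1}(U,V)\big)\\&+p_2\mathrm{Cov}\big(\psi_\pi^{p_1}(U,V),\psi_\rho^{p_1}(V,U)\big)\\&+(1-p_1-p_2)\Big(\mathrm{Cov}\big(\psi_\pi^{p_1}(U,V),\psi_\rho^{p_1}(V,W)\big)+\mathrm{Cov}\big(\psi_\rho^{p_1}(U,V),\psi_\pi^{p_1}(V,W)\big)\Big).\end{aligned}$$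 -/

import Mathlib

open MeasureTheory ProbabilityTheory Filter Asymptotics
open scoped unitInterval Nat

namespace PermPattern

/-- The standardization of a finite sequence of pairwise distinct elements of a linear order:
the permutation which is ordered in the same way as the sequence
(see `standardize_lt_standardize_iff`). Ties are broken by the index. -/
def standardize {n : ℕ} {α : Type*} [LinearOrder α] (y : Fin n → α) : Equiv.Perm (Fin n) :=
  (Tuple.sort y)⁻¹

theorem standardize_lt_standardize_iff {n : ℕ} {α : Type*} [LinearOrder α] {y : Fin n → α}
    (hy : Function.Injective y) (i j : Fin n) :
    standardize y i < standardize y j ↔ y i < y j := by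
  have hm : StrictMono (y ∘ Tuple.sort y) :=
    (Tuple.monotone_sort y).strictMono_of_injective (hy.comp (Tuple.sort y).injective)
  have h := hm.lt_iff_lt (a := standardize y i) (b := standardize y j)
  simpa [standardize] using h.symm

/-- The permutation of a family of points of the unit square having pairwise distinct
x-coordinates and pairwise distinct y-coordinates: the points are listed from left to right and
the sequence of their heights is standardized. -/
noncomputable def permOfPoints {r : ℕ} (z : Fin r → I × I) : Equiv.Perm (Fin r) :=
  standardize fun i => (z (Tuple.sort (fun k => (z k).1) i)).2

/-- The pattern induced by the permutation `τ` on the set `s` of `r` positions. -/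
def pat {n r : ℕ} (s : {s : Finset (Fin n) // s.card = r}) (τ : Equiv.Perm (Fin n)) :
    Equiv.Perm (Fin r) :=
  standardize fun j => τ (s.1.orderEmbOfFin s.2 j)

/-- The number of occurrences of the pattern `π` in the permutation `τ`. -/
def patternCount {n r : ℕ} (π : Equiv.Perm (Fin r)) (τ : Equiv.Perm (Fin n)) : ℕ :=
  Fintype.card {s : {s : Finset (Fin n) // s.card = r} // pat s τ = π}

/-- Every set of permutations of `Fin n` is measurable. -/
instance measurableSpacePerm (n : ℕ) : MeasurableSpace (Equiv.Perm (Fin n)) := ⊤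

instance discreteMeasurableSpacePerm (n : ℕ) : DiscreteMeasurableSpace (Equiv.Perm (Fin n)) :=
  ⟨fun _ => trivial⟩

/-- The number of `p`-cycles (fixed points, for `p = 1`) of a permutation with cycle type `t`.
A cycle type of size `n` is encoded as the partition of `n` made of the cycle lengths. -/
def numCycles {n : ℕ} (t : n.Partition) (p : ℕ) : ℕ := t.parts.count p

/-- The conjugacy class of all permutations of `Fin n` with cycle type `t`
(fixed points being counted as cycles of length one). -/
def cyclicClass {n : ℕ} (t : n.Partition) : Set (Equiv.Perm (Fin n)) :=
  {g | g.partition.parts = t.parts}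

/-- The law `p • Leb_Δ + (1 - p) • Leb_{[0,1]²}` on the unit square, where `Leb_Δ` is the uniform
probability measure on the diagonal. -/
noncomputable def pointLaw (p : ℝ) : Measure (I × I) :=
  ENNReal.ofReal p • (volume : Measure I).map (fun u => (u, u)) +
    ENNReal.ofReal (1 - p) • (volume : Measure (I × I))

/-- `ψ_π^p(z)`, the probability that `r - 1` independent points with law `pointLaw p` together
with the point `z` form the permutation `π`. -/
noncomputable def psi {r : ℕ} (p : ℝ) (π : Equiv.Perm (Fin r)) (z : I × I) : ℝ :=
  (Measure.pi fun _ : Fin (r - 1) => pointLaw p).real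
    {Z | permOfPoints (fun i : Fin r => if h : i.val < r - 1 then Z ⟨i.val, h⟩ else z) = π}

/-- `μ_π^p`, the probability that `r` independent points with law `pointLaw p` form the
permutation `π`. -/
noncomputable def patternMean {r : ℕ} (p : ℝ) (π : Equiv.Perm (Fin r)) : ℝ :=
  (Measure.pi fun _ : Fin r => pointLaw p).real {Z | permOfPoints Z = π}

/-- The asymptotic covariance matrix. The coordinates `ω.1`, `ω.2.1`, `ω.2.2` of the unit cube are
three independent uniform variables `U`, `V`, `W`. -/
noncomputable def limitCov (r : ℕ) (p₁ p₂ : ℝ) :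
    Matrix (Equiv.Perm (Fin r)) (Equiv.Perm (Fin r)) ℝ :=
  Matrix.of fun π ρ =>
    (p₁ * cov[fun ω : I × I × I => psi p₁ π (ω.1, ω.1),
          fun ω => psi p₁ ρ (ω.1, ω.1); volume]
      + (1 - p₁) * cov[fun ω : I × I × I => psi p₁ π (ω.1, ω.2.1),
          fun ω => psi p₁ ρ (ω.1, ω.2.1); volume]
      + p₂ * cov[fun ω : I × I × I => psi p₁ π (ω.1, ω.2.1),
          fun ω => psi p₁ ρ (ω.2.1, ω.1); volume]
      + (1 - p₁ - p₂) *
        (cov[fun ω : I × I × I => psi p₁ π (ω.1, ω.2.1),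
            fun ω => psi p₁ ρ (ω.2.1, ω.2.2); volume]
          + cov[fun ω : I × I × I => psi p₁ ρ (ω.1, ω.2.1),
            fun ω => psi p₁ π (ω.2.1, ω.2.2); volume])) / ((r - 1)! : ℝ) ^ 2

end PermPattern

/-! Fix a permutation `ρ` of the given cycle type and independent uniform variables `u i`.
Conjugating `ρ` by the ranks of the `u i` relabels the elements of its cycles at random, and the
points `(u i, u (ρ i))` have the conjugated permutation as their pattern (`permOfPoints_pts`). Since
the uniform law on a conjugacy class is invariant under conjugation, it suffices to estimate
characteristic functions for this geometric model, uniformly over `ρ` in the class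
(`norm_integral_uniformOn_sub_le`).

A linear combination of pattern counts is, up to the factor `r!`, a sum over injective `r`-tuples of
indices of a bounded function `g` of the corresponding points; non-injective tuples are negligible.
Two points are dependent only if their indices are equal or adjacent along a cycle, so this is a
U-statistic over a sparse dependency graph. A Hoeffding decomposition splits it into a mean, a
linear part and a degenerate remainder. The remainder has second moment `O(n ^ (2r - 2))`
(`integral_sq_sum_remAt_le`) and disappears after division by `n ^ (r - 1/2)`. The mean and the
projections are exact integrals against `pointLaw` at the true proportion of fixed points
(`pointLaw_eq_sum_pairLaw`); replacing that proportion by `p₁` costs `√n` times their difference,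
which is where the `o(√n)` hypothesis enters (`abs_sum_sub_le`).

What is left is a sum of the centred values of one bounded function over the `n` points, each
depending on at most three of them, itself included. The Stein–Tikhomirov method
(`norm_deriv_charFun_add_le`, `norm_integral_cexp_sub_le`) compares its characteristic function with
a Gaussian one at rate `n ^ (-1/2)`. Its variance depends only on the numbers of points in cycles of
length one, two and at least three (`sum_sum_nbhd_integral_centred`), and divided by `n` it tends to
the quadratic form of `limitCov` (`dotProduct_limitCov_mulVec`). Convergence of characteristic
functions at every `θ` gives the joint limit, and positivity of the variances gives positive
semidefiniteness. -/

namespace PermPattern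

/-! ### Combinatorics of patterns: from point configurations to pattern counts. -/

section Standardization

variable {n r : ℕ} {α β : Type*} [LinearOrder α] [LinearOrder β]

/-- The stable sort sees only the comparisons `≤`, ties included, so no injectivity is needed and
the two sequences may live in different orders. This is what lets real heights be replaced by ranks.
-/
theorem sort_congr {y : Fin n → α} {y' : Fin n → β} (h : ∀ i j, y i ≤ y j ↔ y' i ≤ y' j) :
    Tuple.sort y = Tuple.sort y' := by
  obtain ⟨h1, h2⟩ := Tuple.eq_sort_iff.1 (rfl : Tuple.sort y = Tuple.sort y)
  refine Tuple.eq_sort_iff.2 ⟨fun i j hij => (h _ _).1 (h1 hij), fun i j hij he => h2 i j hij ?_⟩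
  exact le_antisymm ((h _ _).2 he.le) ((h _ _).2 he.ge)

theorem standardize_congr {y : Fin n → α} {y' : Fin n → β} (h : ∀ i j, y i ≤ y j ↔ y' i ≤ y' j) :
    standardize y = standardize y' := by
  rw [standardize, standardize, sort_congr h]

theorem standardize_le_standardize_iff {y : Fin n → α} (hy : Function.Injective y) (i j : Fin n) :
    standardize y i ≤ standardize y j ↔ y i ≤ y j := by
  simpa only [not_lt] using (standardize_lt_standardize_iff hy j i).not

theorem sort_eq_of_strictMono {y : Fin n → α} {s : Equiv.Perm (Fin n)} (h : StrictMono (y ∘ s)) :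
    Tuple.sort y = s :=
  (Tuple.eq_sort_iff.2 ⟨h.monotone, fun _ _ hij he => absurd he (h hij).ne⟩).symm

theorem strictMono_comp_sort {y : Fin n → α} (hy : Function.Injective y) :
    StrictMono (y ∘ Tuple.sort y) :=
  (Tuple.monotone_sort y).strictMono_of_injective (hy.comp (Tuple.sort y).injective)

theorem sort_comp_perm {y : Fin n → α} (hy : Function.Injective y) (s : Equiv.Perm (Fin n)) :
    Tuple.sort (y ∘ s) = s⁻¹ * Tuple.sort y := by
  apply sort_eq_of_strictMono
  convert strictMono_comp_sort hy using 1
  ext i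
  simp

/-- Sorting from left to right forgets the labelling as soon as the abscissas are distinct; ties
among the heights do no harm, because they are broken only after this sorting. -/
theorem permOfPoints_comp_perm {z : Fin r → I × I} (hz : Function.Injective fun k => (z k).1)
    (s : Equiv.Perm (Fin r)) : permOfPoints (z ∘ s) = permOfPoints z := by
  have h := sort_comp_perm hz s
  unfold permOfPoints
  congr 1
  ext i
  have : Tuple.sort (fun k => ((z ∘ s) k).1) i = s⁻¹ (Tuple.sort (fun k => (z k).1) i) := by
    change Tuple.sort ((fun k => (z k).1) ∘ s) i = _
    rw [h]; rfl
  rw [this]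
  simp

/-- The `i`-th point `(u i, u (ρ i))` of the random geometric construction. -/
def pts (ρ : Equiv.Perm (Fin n)) (u : Fin n → I) (i : Fin n) : I × I := (u i, u (ρ i))

/-- The heart of the geometric model: if `R` gives the ranks of `u`, then the rank of `u (ρ i)` is
the image under `R * ρ * R⁻¹` of the rank of `u i`. The points are therefore, up to rank, points of
the graph of the conjugated permutation. -/
theorem permOfPoints_pts {u : Fin n → I} (hu : Function.Injective u) (ρ : Equiv.Perm (Fin n))
    (k : Fin r ↪ Fin n) (h : (Finset.univ.map (k.trans (standardize u).toEmbedding)).card = r) :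
    permOfPoints (fun a => pts ρ u (k a)) =
      pat ⟨Finset.univ.map (k.trans (standardize u).toEmbedding), h⟩
        (standardize u * ρ * (standardize u)⁻¹) := by
  set R := standardize u with hR
  set l : Fin r → Fin n := fun a => R (k a) with hl
  have hlinj : Function.Injective l := R.injective.comp k.injective
  have hs : Tuple.sort (fun a => u (k a)) = Tuple.sort l :=
    sort_congr fun i j => (standardize_le_standardize_iff hu _ _).symm
  have horb : l ∘ Tuple.sort l =
      (Finset.univ.map (k.trans R.toEmbedding)).orderEmbOfFin h :=
    Finset.orderEmbOfFin_unique h (fun x => by simp [hl]) (strictMono_comp_sort hlinj)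
  unfold permOfPoints pat
  change standardize (fun i => u (ρ (k (Tuple.sort (fun a => u (k a)) i)))) = _
  rw [hs]
  have : ∀ j, (Finset.univ.map (k.trans R.toEmbedding)).orderEmbOfFin h j
      = R (k (Tuple.sort l j)) := fun j => (congrFun horb j).symm
  have hτ : ∀ j, (R * ρ * R⁻¹) ((Finset.univ.map (k.trans R.toEmbedding)).orderEmbOfFin h j)
      = R (ρ (k (Tuple.sort l j))) := fun j => by
    rw [this, Equiv.Perm.mul_apply, Equiv.Perm.mul_apply]
    congr 2
    exact R.symm_apply_apply _
  refine standardize_congr fun i j => ?_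
  rw [hτ, hτ]
  exact (standardize_le_standardize_iff hu _ _).symm

/-- An injective map from `Fin r` is the same as an `r`-element set with an ordering of it. -/
theorem sum_embedding_eq (F : {s : Finset (Fin n) // s.card = r} → ℝ) :
    ∑ l : Fin r ↪ Fin n, F ⟨Finset.univ.map l, by simp⟩ = (r ! : ℝ) * ∑ s, F s := by
  have hc : (r ! : ℝ) = ∑ _s : Equiv.Perm (Fin r), (1 : ℝ) := by
    simp [Fintype.card_perm]
  rw [hc, Finset.sum_mul_sum, ← Finset.sum_product', Finset.univ_product_univ]
  symm
  refine Fintype.sum_bijective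
    (fun p : Equiv.Perm (Fin r) × {s : Finset (Fin n) // s.card = r} =>
      p.1.toEmbedding.trans (p.2.1.orderEmbOfFin p.2.2).toEmbedding) ?_ _ _ ?_
  · constructor
    · rintro ⟨s, S⟩ ⟨s', S'⟩ h
      have hfun : ∀ i, S.1.orderEmbOfFin S.2 (s i) = S'.1.orderEmbOfFin S'.2 (s' i) :=
        fun i => DFunLike.congr_fun h i
      have hS : S = S' := by
        apply Subtype.ext
        have h1 := Finset.range_orderEmbOfFin S.1 S.2
        have h2 := Finset.range_orderEmbOfFin S'.1 S'.2
        apply Finset.coe_injective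
        rw [← h1, ← h2, ← s.surjective.range_comp (S.1.orderEmbOfFin S.2),
          ← s'.surjective.range_comp (S'.1.orderEmbOfFin S'.2)]
        congr 1
        funext i
        exact hfun i
      subst hS
      have : s = s' := Equiv.ext fun i => (S.1.orderEmbOfFin S.2).injective (hfun i)
      rw [this]
    · intro l
      refine ⟨((Tuple.sort l)⁻¹, ⟨Finset.univ.map l, by simp⟩), ?_⟩
      have := Finset.orderEmbOfFin_unique (s := Finset.univ.map l) (k := r) (by simp)
        (f := l ∘ Tuple.sort l) (fun x => by simp) (strictMono_comp_sort l.injective)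
      refine DFunLike.ext _ _ fun i => ?_
      have h2 := congrFun this ((Tuple.sort l).symm i)
      rw [Function.comp_apply, Equiv.apply_symm_apply] at h2
      exact h2.symm
  · rintro ⟨s, S⟩
    simp only [one_mul]
    congr 1
    apply Subtype.ext
    apply Finset.coe_injective
    simp only [Finset.coe_map, Finset.coe_univ, Set.image_univ]
    rw [← Finset.range_orderEmbOfFin S.1 S.2, ← s.surjective.range_comp]
    rfl

theorem sum_pat (G : Equiv.Perm (Fin r) → ℝ) (τ : Equiv.Perm (Fin n)) :
    ∑ s : {s : Finset (Fin n) // s.card = r}, G (pat s τ) =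
      ∑ π, G π * (patternCount π τ : ℝ) := by
  classical
  rw [← Finset.sum_fiberwise Finset.univ (fun s => pat s τ)]
  refine Finset.sum_congr rfl fun π _ => ?_
  rw [Finset.sum_congr rfl (g := fun _ => G π) fun s hs => by rw [(Finset.mem_filter.1 hs).2]]
  rw [Finset.sum_const, nsmul_eq_mul, mul_comm, patternCount, Fintype.card_subtype]

theorem sum_injective_permOfPoints {u : Fin n → I} (hu : Function.Injective u)
    (ρ : Equiv.Perm (Fin n)) (G : Equiv.Perm (Fin r) → ℝ) :
    ∑ k : Fin r ↪ Fin n, G (permOfPoints fun a => pts ρ u (k a)) =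
      (r ! : ℝ) * ∑ π, G π * (patternCount π (standardize u * ρ * (standardize u)⁻¹) : ℝ) := by
  rw [← sum_pat, ← sum_embedding_eq]
  refine Fintype.sum_equiv ((Equiv.refl (Fin r)).embeddingCongr (standardize u)) _ _ fun k => ?_
  rw [permOfPoints_pts hu ρ k (by simp)]
  rfl

end Standardization

/-! ### Measurability of sorting and of the pattern of a point configuration. -/

section Measurability

variable {r : ℕ}

theorem measurableSet_sort_eq (s : Equiv.Perm (Fin r)) :
    MeasurableSet {y : Fin r → I | Tuple.sort y = s} := by
  have : {y : Fin r → I | Tuple.sort y = s} =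
      (⋂ i, ⋂ j, ⋂ _ : i ≤ j, {y | y (s i) ≤ y (s j)}) ∩
        ⋂ i, ⋂ j, ⋂ _ : i < j, {y | y (s i) = y (s j) → s i < s j} := by
    ext y
    simp only [Set.mem_inter_iff, Set.mem_iInter, Set.mem_ofPred_eq]
    rw [eq_comm, Tuple.eq_sort_iff]
    rfl
  rw [this]
  refine MeasurableSet.inter ?_ ?_
  · refine .iInter fun i => .iInter fun j => .iInter fun _ => ?_
    exact measurableSet_le (measurable_pi_apply _) (measurable_pi_apply _)
  · refine .iInter fun i => .iInter fun j => .iInter fun _ => ?_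
    have h := measurableSet_eq_fun (measurable_pi_apply (X := fun _ : Fin r => I) (s i))
      (measurable_pi_apply (s j))
    by_cases hs : s i < s j
    · simp [hs]
    · have he : {y : Fin r → I | y (s i) = y (s j) → s i < s j} =
          {y | y (s i) = y (s j)}ᶜ := by ext y; simp [hs]
      rw [he]
      exact h.compl

theorem measurable_permOfPoints : Measurable (permOfPoints : (Fin r → I × I) → _) := by
  refine measurable_to_countable' fun π => ?_
  have : (permOfPoints : (Fin r → I × I) → _) ⁻¹' {π} = ⋃ s : Equiv.Perm (Fin r),
      {z | Tuple.sort (fun k => (z k).1) = s} ∩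
        {z | Tuple.sort (fun i => (z (s i)).2) = π⁻¹} := by
    ext z
    simp [permOfPoints, standardize, inv_eq_iff_eq_inv]
  rw [this]
  refine .iUnion fun s => .inter ?_ ?_
  · exact (measurableSet_sort_eq s).preimage (f := fun (z : Fin r → I × I) k => (z k).1)
      (by fun_prop)
  · exact (measurableSet_sort_eq π⁻¹).preimage (f := fun (z : Fin r → I × I) k => (z (s k)).2)
      (by fun_prop)

end Measurability

/-! ### Fixed points and points of 2-cycles read off from the cycle type. -/

section CycleCounts

variable {n : ℕ}

theorem card_fixedPoints_of_mem_cyclicClass {t : n.Partition} {ρ : Equiv.Perm (Fin n)}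
    (h : ρ ∈ cyclicClass t) :
    (Finset.univ.filter fun i => ρ i = i).card = numCycles t 1 := by
  have hρ : ρ.partition.parts = t.parts := h
  rw [numCycles, ← hρ, Equiv.Perm.parts_partition, Multiset.count_add,
    Multiset.count_replicate_self,
    Multiset.count_eq_zero_of_notMem fun h1 => by
      have := Equiv.Perm.two_le_of_mem_cycleType h1; omega, zero_add,
    ← Finset.card_compl]
  congr 1
  ext i
  simp

/-- These points are the disjoint union of the supports of the cycle factors of length two, each of
which is the transposition of `i` and `ρ i`. -/
theorem card_twoCyclePoints_of_mem_cyclicClass {t : n.Partition} {ρ : Equiv.Perm (Fin n)}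
    (h : ρ ∈ cyclicClass t) :
    (Finset.univ.filter fun i => ρ i ≠ i ∧ ρ (ρ i) = i).card = 2 * numCycles t 2 := by
  have hρ : ρ.partition.parts = t.parts := h
  have h1 : numCycles t 2 = (ρ.cycleFactorsFinset.filter fun c => c.support.card = 2).card := by
    rw [numCycles, ← hρ, Equiv.Perm.parts_partition, Multiset.count_add,
      Multiset.count_replicate, if_neg (by norm_num), add_zero, Equiv.Perm.cycleType_def,
      Multiset.count_map]
    rw [← Finset.card_val, Finset.filter_val]
    simp [eq_comm]
  have h2 : (Finset.univ.filter fun i => ρ i ≠ i ∧ ρ (ρ i) = i) =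
      (ρ.cycleFactorsFinset.filter fun c => c.support.card = 2).biUnion
        Equiv.Perm.support := by
    ext i
    simp only [Finset.mem_filter, Finset.mem_univ, true_and, Finset.mem_biUnion]
    constructor
    · rintro ⟨hi, hii⟩
      refine ⟨Equiv.swap i (ρ i), ⟨Equiv.Perm.mem_cycleFactorsFinset_iff.2
        ⟨Equiv.Perm.isCycle_swap (Ne.symm hi), fun a ha => ?_⟩,
        Equiv.Perm.card_support_swap (Ne.symm hi)⟩, ?_⟩
      · rw [Equiv.Perm.support_swap (Ne.symm hi), Finset.mem_insert, Finset.mem_singleton] at ha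
        rcases ha with rfl | rfl
        · simp
        · simp [hii]
      · simp [Equiv.Perm.support_swap (Ne.symm hi)]
    · rintro ⟨c, ⟨hc, hc2⟩, hic⟩
      obtain ⟨x, y, hxy, rfl⟩ := Equiv.Perm.card_support_eq_two.1 hc2
      have hag := (Equiv.Perm.mem_cycleFactorsFinset_iff.1 hc).2
      rw [Equiv.Perm.support_swap hxy] at hic hag
      have hx := hag x (by simp)
      have hy := hag y (by simp)
      simp only [Equiv.swap_apply_left, Equiv.swap_apply_right] at hx hy
      simp only [Finset.mem_insert, Finset.mem_singleton] at hic
      rcases hic with rfl | rfl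
      · exact ⟨by rw [← hx]; exact hxy.symm, by rw [← hx, ← hy]⟩
      · exact ⟨by rw [← hy]; exact hxy, by rw [← hy, ← hx]⟩
  rw [h2, Finset.card_biUnion, Finset.sum_congr rfl (g := fun _ => 2)
    fun c hc => (Finset.mem_filter.1 hc).2, Finset.sum_const, h1, smul_eq_mul, mul_comm]
  intro c hc d hd hcd
  exact Equiv.Perm.disjoint_iff_disjoint_support.1
    (ρ.cycleFactorsFinset_pairwise_disjoint (Finset.mem_filter.1 hc).1
      (Finset.mem_filter.1 hd).1 hcd)

theorem conj_mem_cyclicClass_iff {t : n.Partition} (ρ η : Equiv.Perm (Fin n)) :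
    η * ρ * η⁻¹ ∈ cyclicClass t ↔ ρ ∈ cyclicClass t := by
  have : (η * ρ * η⁻¹).partition = ρ.partition :=
    Equiv.Perm.partition_eq_of_isConj.1 (isConj_iff.2 ⟨η⁻¹, by group⟩)
  simp [cyclicClass, this]

end CycleCounts

/-! ### Product measures: independence, freezing a coordinate, mixtures. -/

section ProductMeasures

variable {ι E : Type*} [Fintype ι] [MeasurableSpace E]

theorem indepFun_of_dependsOn {β γ : Type*} [MeasurableSpace β] [MeasurableSpace γ] [Nonempty E]
    (ν : ι → Measure E) [∀ i, IsProbabilityMeasure (ν i)] {X : (ι → E) → β} {Y : (ι → E) → γ}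
    (hX : Measurable X) (hY : Measurable Y) {A B : Finset ι} (hA : DependsOn X A)
    (hB : DependsOn Y B) (hAB : Disjoint A B) : IndepFun X Y (Measure.pi ν) := by
  classical
  -- Extends a partial configuration by an arbitrary value, so that a function depending only on `A`
  -- factors through the coordinates in `A`.
  let e (A : Finset ι) (v : A → E) (i : ι) : E :=
    if h : i ∈ A then v ⟨i, h⟩ else Classical.arbitrary E
  have he (A : Finset ι) : Measurable (e A) := by
    refine measurable_pi_lambda _ fun i => ?_
    by_cases h : i ∈ A
    · simpa [e, h] using measurable_pi_apply _
    · simp [e, h]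
  have hi : iIndepFun (fun (i : ι) (ω : ι → E) => ω i) (Measure.pi ν) :=
    iIndepFun_pi (X := fun _ => id) fun _ => aemeasurable_id
  have h := (hi.indepFun_finset A B hAB fun i => measurable_pi_apply i).comp
    (hX.comp (he A)) (hY.comp (he B))
  have hXe : (X ∘ e A) ∘ (fun a (i : A) => a i) = X := by
    ext1 u
    exact hA fun i hi => by simp [e, Finset.mem_coe.1 hi]
  have hYe : (Y ∘ e B) ∘ (fun a (i : B) => a i) = Y := by
    ext1 u
    exact hB fun i hi => by simp [e, Finset.mem_coe.1 hi]
  rwa [hXe, hYe] at h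

theorem integral_indepFun {Ω β γ : Type*} [MeasurableSpace Ω] [MeasurableSpace β]
    [MeasurableSpace γ] {μ : Measure Ω} [IsProbabilityMeasure μ] {X : Ω → β} {Y : Ω → γ}
    (hX : Measurable X) (hY : Measurable Y) (h : IndepFun X Y μ) {F : β × γ → ℝ}
    (hF : Measurable F) {C : ℝ} (hC : ∀ p, |F p| ≤ C) :
    ∫ ω, F (X ω, Y ω) ∂μ = ∫ ω, ∫ ω', F (X ω', Y ω) ∂μ ∂μ := by
  have h1 := (indepFun_iff_map_prod_eq_prod_map_map hX.aemeasurable hY.aemeasurable).1 h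
  have := Measure.isProbabilityMeasure_map (μ := μ) hX.aemeasurable
  have := Measure.isProbabilityMeasure_map (μ := μ) hY.aemeasurable
  have h2 : ∫ ω, F (X ω, Y ω) ∂μ = ∫ p, F p ∂(μ.map fun ω => (X ω, Y ω)) :=
    (integral_map (hX.prodMk hY).aemeasurable hF.aestronglyMeasurable).symm
  have hint : Integrable F ((μ.map X).prod (μ.map Y)) :=
    Integrable.of_bound hF.aestronglyMeasurable C (ae_of_all _ hC)
  rw [h2, h1, integral_prod_symm _ hint, integral_map hY.aemeasurable]
  · refine integral_congr_ae (ae_of_all _ fun ω => ?_)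
    exact integral_map hX.aemeasurable
      (hF.comp measurable_prodMk_right).aestronglyMeasurable
  · exact (hF.stronglyMeasurable.integral_prod_left' (μ := μ.map X)).aestronglyMeasurable

/-- A product of mixtures is a mixture of products: each factor independently chooses its component,
and the measure of a box expands multilinearly. -/
theorem pi_eq_sum_smul_pi [DecidableEq ι] {J : Type*} [Fintype J] (ν : J → Measure E)
    [∀ j, IsProbabilityMeasure (ν j)] (c : J → ENNReal) (μ : Measure E) [IsFiniteMeasure μ]
    (hμ : μ = ∑ j, c j • ν j) :
    Measure.pi (fun _ : ι => μ) =
      ∑ k : ι → J, (∏ a, c (k a)) • Measure.pi fun a => ν (k a) := by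
  refine Measure.pi_eq fun s _ => ?_
  have h1 : ∀ i : ι, μ (s i) = ∑ j, c j * ν j (s i) := fun i => by
    rw [hμ, Measure.finsetSum_apply]; simp
  rw [Measure.finsetSum_apply]
  simp only [h1, Measure.smul_apply, Measure.pi_pi, smul_eq_mul, ← Finset.prod_mul_distrib]
  rw [Finset.prod_univ_sum, Fintype.piFinset_univ]

theorem pi_map_update [DecidableEq ι] (ν : ι → Measure E) [∀ i, IsProbabilityMeasure (ν i)]
    (a : ι) (z : E) :
    (Measure.pi ν).map (fun y => Function.update y a z) =
      Measure.pi (Function.update ν a (Measure.dirac z)) := by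
  classical
  have : ∀ i, IsProbabilityMeasure (Function.update ν a (Measure.dirac z) i) := fun i => by
    rcases eq_or_ne i a with rfl | h
    · simp only [Function.update_self]; infer_instance
    · simp only [Function.update_of_ne h]; infer_instance
  symm
  refine Measure.pi_eq fun s hs => ?_
  rw [Measure.map_apply (by fun_prop) (.univ_pi hs)]
  have h1 : (fun y : ι → E => Function.update y a z) ⁻¹' (Set.univ.pi s) =
      if z ∈ s a then Set.univ.pi (Function.update s a Set.univ) else ∅ := by
    split_ifs with h
    · ext y
      simp only [Set.mem_preimage, Set.mem_univ_pi]
      refine forall_congr' fun i => ?_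
      rcases eq_or_ne i a with rfl | hi
      · simp [h]
      · simp [hi]
    · ext y
      simp only [Set.mem_preimage, Set.mem_univ_pi, Set.mem_empty_iff_false, iff_false]
      exact fun hy => h (by simpa using hy a)
  rw [h1, ← Finset.mul_prod_erase _ _ (Finset.mem_univ a)]
  simp only [Function.update_self, Measure.dirac_apply' _ (hs a)]
  split_ifs with h
  · rw [Measure.pi_pi, ← Finset.mul_prod_erase _ _ (Finset.mem_univ a)]
    simp only [Function.update_self, measure_univ, Set.indicator_of_mem h, Pi.one_apply, one_mul]
    refine Finset.prod_congr rfl fun i hi => ?_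
    simp [(Finset.mem_erase.1 hi).1]
  · simp [h]

omit [Fintype ι] in
theorem measurable_update_pair [DecidableEq ι] (a : ι) :
    Measurable fun p : (ι → E) × E => Function.update p.1 a p.2 := by
  refine measurable_pi_lambda _ fun i => ?_
  rcases eq_or_ne i a with rfl | h
  · simpa using measurable_snd
  · simpa [h, Function.comp_def] using (measurable_pi_apply i).comp measurable_fst

theorem prod_map_update [DecidableEq ι] (ν : ι → Measure E) [∀ i, IsProbabilityMeasure (ν i)]
    (a : ι) :
    ((Measure.pi ν).prod (ν a)).map (fun p => Function.update p.1 a p.2) = Measure.pi ν := by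
  symm
  refine Measure.pi_eq fun s hs => ?_
  have hm := measurable_update_pair (E := E) a
  rw [Measure.map_apply hm (.univ_pi hs)]
  have h1 : (fun p : (ι → E) × E => Function.update p.1 a p.2) ⁻¹' (Set.univ.pi s) =
      (Set.univ.pi (Function.update s a Set.univ)) ×ˢ (s a) := by
    ext ⟨y, z⟩
    simp only [Set.mem_preimage, Set.mem_univ_pi, Set.mem_prod]
    constructor
    · intro h
      refine ⟨fun i => ?_, by simpa using h a⟩
      rcases eq_or_ne i a with rfl | hi
      · simp
      · simpa [hi] using h i
    · rintro ⟨h, ha⟩ i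
      rcases eq_or_ne i a with rfl | hi
      · simpa using ha
      · simpa [hi] using h i
  rw [h1, Measure.prod_prod, Measure.pi_pi, ← Finset.mul_prod_erase _ _ (Finset.mem_univ a),
    ← Finset.mul_prod_erase _ (fun i => ν i (s i)) (Finset.mem_univ a)]
  simp only [Function.update_self, measure_univ, one_mul]
  rw [mul_comm]
  congr 1
  refine Finset.prod_congr rfl fun i hi => ?_
  simp [(Finset.mem_erase.1 hi).1]

theorem integral_integral_update [DecidableEq ι] (ν : ι → Measure E)
    [∀ i, IsProbabilityMeasure (ν i)] (a : ι) {g : (ι → E) → ℝ} (hg : Measurable g) {C : ℝ}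
    (hC : ∀ y, |g y| ≤ C) :
    ∫ z, ∫ y, g (Function.update y a z) ∂Measure.pi ν ∂ν a = ∫ y, g y ∂Measure.pi ν := by
  have hm := measurable_update_pair (E := E) a
  conv_rhs => rw [← prod_map_update ν a]
  rw [integral_map hm.aemeasurable hg.aestronglyMeasurable, integral_prod_symm]
  exact Integrable.of_bound (hg.comp hm).aestronglyMeasurable C (ae_of_all _ fun _ => hC _)

/-- Only one of the two coordinates has to be atomless. This matters when the other one is frozen,
with a Dirac law. -/
theorem ae_apply_ne_apply (ν : ι → Measure E) [∀ i, IsProbabilityMeasure (ν i)] [Nonempty E]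
    {f : E → I} (hf : Measurable f) {i j : ι} (hij : i ≠ j) (h0 : ∀ x, ν i (f ⁻¹' {x}) = 0) :
    ∀ᵐ y ∂Measure.pi ν, f (y i) ≠ f (y j) := by
  have hmi : Measurable fun y : ι → E => f (y i) := by fun_prop
  have hmj : Measurable fun y : ι → E => f (y j) := by fun_prop
  have hind : IndepFun (fun y : ι → E => f (y i)) (fun y => f (y j)) (Measure.pi ν) :=
    indepFun_of_dependsOn ν hmi hmj (A := {i}) (B := {j})
      (fun x y h => by simp [h i]) (fun x y h => by simp [h j]) (by simpa using hij)
  have h1 := (indepFun_iff_map_prod_eq_prod_map_map hmi.aemeasurable hmj.aemeasurable).1 hind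
  have hD : MeasurableSet {p : I × I | p.1 = p.2} := measurableSet_diagonal
  have h2 : (Measure.pi ν).map (fun y => (f (y i), f (y j))) {p : I × I | p.1 = p.2} = 0 := by
    have := Measure.isProbabilityMeasure_map (μ := Measure.pi ν) hmi.aemeasurable
    have := Measure.isProbabilityMeasure_map (μ := Measure.pi ν) hmj.aemeasurable
    rw [h1, Measure.prod_apply_symm hD, lintegral_eq_zero_iff (measurable_measure_prodMk_right hD)]
    refine ae_of_all _ fun x => ?_
    have : (fun y : I => (y, x)) ⁻¹' {p : I × I | p.1 = p.2} = {x} := by ext y; simp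
    beta_reduce
    rw [this, Measure.map_apply hmi (measurableSet_singleton x)]
    have h3 : (fun y : ι → E => f (y i)) ⁻¹' {x} = (fun y => y i) ⁻¹' (f ⁻¹' {x}) := rfl
    rw [h3, (measurePreserving_eval ν i).measure_preimage
      (hf (measurableSet_singleton x)).nullMeasurableSet, h0]
    rfl
  rw [Measure.map_apply (hmi.prodMk hmj) hD] at h2
  exact measure_eq_zero_iff_ae_notMem.1 h2

end ProductMeasures

/-! ### Laws of the points `(u i, u (ρ i))` and their dependency structure. -/

section PairLaws

variable {n r : ℕ}

theorem measurable_pts (ρ : Equiv.Perm (Fin n)) (i : Fin n) : Measurable fun u => pts ρ u i := by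
  unfold pts; fun_prop

/-- The uniform law on the diagonal of the unit square. -/
noncomputable def diagLaw : Measure (I × I) := (volume : Measure I).map fun u => (u, u)

instance : IsProbabilityMeasure diagLaw :=
  Measure.isProbabilityMeasure_map (by fun_prop)

/-- The law of the `i`-th point `pts ρ u i` for uniform `u`. -/
noncomputable def pairLaw (ρ : Equiv.Perm (Fin n)) (i : Fin n) : Measure (I × I) :=
  if ρ i = i then diagLaw else volume

instance (ρ : Equiv.Perm (Fin n)) (i : Fin n) : IsProbabilityMeasure (pairLaw ρ i) := by
  unfold pairLaw; split_ifs <;> infer_instance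

theorem isProbabilityMeasure_pointLaw {p : ℝ} (hp : p ∈ Set.Icc (0 : ℝ) 1) :
    IsProbabilityMeasure (pointLaw p) := by
  have : IsProbabilityMeasure ((volume : Measure I).map fun u => (u, u)) :=
    Measure.isProbabilityMeasure_map (by fun_prop)
  constructor
  simp only [pointLaw, Measure.add_apply, Measure.smul_apply, measure_univ, smul_eq_mul, mul_one]
  rw [← ENNReal.ofReal_add hp.1 (by linarith [hp.2])]
  simp

theorem map_pair_apply {i j : Fin n} (hij : i ≠ j) :
    (volume : Measure (Fin n → I)).map (fun u => (u i, u j)) = volume := by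
  have hind : IndepFun (fun u : Fin n → I => u i) (fun u => u j) (Measure.pi fun _ => volume) :=
    indepFun_of_dependsOn _ (measurable_pi_apply i) (measurable_pi_apply j) (A := {i}) (B := {j})
      (fun x y h => by simp [h i]) (fun x y h => by simp [h j]) (by simpa using hij)
  have h1 := (indepFun_iff_map_prod_eq_prod_map_map (measurable_pi_apply i).aemeasurable
    (measurable_pi_apply j).aemeasurable).1 hind
  rw [(measurePreserving_eval (fun _ : Fin n => (volume : Measure I)) i).map_eq,
    (measurePreserving_eval (fun _ : Fin n => (volume : Measure I)) j).map_eq] at h1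
  exact h1

theorem map_triple_apply {i j l : Fin n} (hij : i ≠ j) (hil : i ≠ l) (hjl : j ≠ l) :
    (volume : Measure (Fin n → I)).map (fun u => (u i, u j, u l)) = volume := by
  have hind : IndepFun (fun u : Fin n → I => u i) (fun u => (u j, u l))
      (Measure.pi fun _ => volume) :=
    indepFun_of_dependsOn _ (measurable_pi_apply i)
      ((measurable_pi_apply j).prodMk (measurable_pi_apply l)) (A := {i}) (B := {j, l})
      (fun x y h => by simp [h i]) (fun x y h => by simp [h j, h l]) (by simp [hij, hil])
  have h1 := (indepFun_iff_map_prod_eq_prod_map_map (measurable_pi_apply i).aemeasurable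
    ((measurable_pi_apply j).prodMk (measurable_pi_apply l)).aemeasurable).1 hind
  have h2 : (Measure.pi fun _ : Fin n => (volume : Measure I)).map (fun u => (u j, u l)) = volume :=
    map_pair_apply hjl
  rw [(measurePreserving_eval (fun _ : Fin n => (volume : Measure I)) i).map_eq, h2] at h1
  exact h1

theorem map_pts (ρ : Equiv.Perm (Fin n)) (i : Fin n) :
    (volume : Measure (Fin n → I)).map (fun u => pts ρ u i) = pairLaw ρ i := by
  unfold pairLaw pts
  split_ifs with h
  · rw [h, diagLaw, ← (measurePreserving_eval (fun _ : Fin n => (volume : Measure I)) i).map_eq,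
      Measure.map_map (by fun_prop) (by fun_prop)]
    rfl
  · exact map_pair_apply (Ne.symm h)

/-- Two indices whose points `pts ρ u i` and `pts ρ u j` share a coordinate of `u`. -/
def Near (ρ : Equiv.Perm (Fin n)) (i j : Fin n) : Prop := j = i ∨ j = ρ i ∨ i = ρ j

instance (ρ : Equiv.Perm (Fin n)) (i j : Fin n) : Decidable (Near ρ i j) := by
  unfold Near; infer_instance

theorem Near.symm {ρ : Equiv.Perm (Fin n)} {i j : Fin n} (h : Near ρ i j) : Near ρ j i := by
  unfold Near at *; tauto

theorem Near.refl (ρ : Equiv.Perm (Fin n)) (i : Fin n) : Near ρ i i := Or.inl rfl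

theorem disjoint_of_not_near {ρ : Equiv.Perm (Fin n)} {i j : Fin n} (h : ¬ Near ρ i j) :
    Disjoint ({i, ρ i} : Finset (Fin n)) {j, ρ j} := by
  unfold Near at h
  push Not at h
  obtain ⟨h1, h2, h3⟩ := h
  simp [h1, h2, Ne.symm h3]

theorem dependsOn_pts (ρ : Equiv.Perm (Fin n)) (i : Fin n) :
    DependsOn (fun u => pts ρ u i) (({i, ρ i} : Finset (Fin n)) : Set (Fin n)) :=
  fun x y h => by simp [pts, h i (by simp), h (ρ i) (by simp)]

/-- Indices that are pairwise not `Near` use disjoint sets of coordinates of `u`, so their points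
are independent; the slots are added one at a time. -/
theorem map_pts_tuple (ρ : Equiv.Perm (Fin n)) {k : Fin r → Fin n}
    (hk : ∀ a b, a ≠ b → ¬ Near ρ (k a) (k b)) :
    (volume : Measure (Fin n → I)).map (fun u a => pts ρ u (k a)) =
      Measure.pi fun a => pairLaw ρ (k a) := by
  have key (s : Fin r → Set (I × I)) (hs : ∀ a, MeasurableSet (s a)) (T : Finset (Fin r)) :
      (volume : Measure (Fin n → I)) {u | ∀ a ∈ T, pts ρ u (k a) ∈ s a} =
        ∏ a ∈ T, pairLaw ρ (k a) (s a) := by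
    induction T using Finset.induction_on with
    | empty => simp
    | insert a T ha ih =>
      have hY : MeasurableSet {u : Fin n → I | ∀ b ∈ T, pts ρ u (k b) ∈ s b} := by
        have : {u : Fin n → I | ∀ b ∈ T, pts ρ u (k b) ∈ s b} =
            ⋂ b ∈ T, (fun u => pts ρ u (k b)) ⁻¹' s b := by ext; simp
        rw [this]
        exact T.measurableSet_biInter fun b _ => measurable_pts ρ (k b) (hs b)
      -- The constraints on the slots already treated are viewed as one `Prop`-valued random
      -- variable, whose fibre over `True` is the event of interest.
      have hind : IndepFun (fun u : Fin n → I => pts ρ u (k a))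
          (fun u : Fin n → I => ∀ b ∈ T, pts ρ u (k b) ∈ s b) (Measure.pi fun _ => volume) := by
        refine indepFun_of_dependsOn _ (measurable_pts ρ (k a)) (measurableSet_setOfPred.1 hY)
          (dependsOn_pts ρ (k a))
          (B := T.biUnion fun b => {k b, ρ (k b)}) (fun x y h => ?_) ?_
        · refine propext (forall₂_congr fun b hb => ?_)
          have he : pts ρ x (k b) = pts ρ y (k b) :=
            dependsOn_pts ρ (k b) fun i hi => h i (Finset.mem_biUnion.2 ⟨b, hb, hi⟩)
          rw [he]
        · rw [Finset.disjoint_biUnion_right]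
          exact fun b hb => disjoint_of_not_near (hk a b fun h => ha (h ▸ hb))
      have h1 := hind.measure_inter_preimage_eq_mul (s a) {True} (hs a) trivial
      have h2 : {u : Fin n → I | ∀ b ∈ insert a T, pts ρ u (k b) ∈ s b} =
          (fun u => pts ρ u (k a)) ⁻¹' s a ∩
            (fun u : Fin n → I => ∀ b ∈ T, pts ρ u (k b) ∈ s b) ⁻¹' {True} := by
        ext u; simp
      have h3 : (fun u : Fin n → I => ∀ b ∈ T, pts ρ u (k b) ∈ s b) ⁻¹' {True} =
          {u | ∀ b ∈ T, pts ρ u (k b) ∈ s b} := by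
        ext u; simp
      rw [h2, Finset.prod_insert ha, ← ih, volume_pi, h1, h3, ← map_pts,
        Measure.map_apply (measurable_pts ρ (k a)) (hs a), volume_pi]
  symm
  refine Measure.pi_eq fun s hs => ?_
  rw [Measure.map_apply (measurable_pi_lambda _ fun a => measurable_pts ρ (k a)) (.univ_pi hs),
    ← key s hs]
  congr 1
  ext u
  simp

/-- The law of a point with uniformly chosen index is exactly a `pointLaw`, with the true proportion
of fixed points as parameter. Sums over all index tuples thereby become integrals without any error
term. -/
theorem pointLaw_eq_sum_pairLaw (hn : n ≠ 0) (ρ : Equiv.Perm (Fin n)) :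
    pointLaw (((Finset.univ.filter fun i => ρ i = i).card : ℝ) / n) =
      ∑ i, (n : ENNReal)⁻¹ • pairLaw ρ i := by
  have hn' : (0 : ℝ) < n := by positivity
  have h1 : ∀ i, pairLaw ρ i = if ρ i = i then diagLaw else volume := fun i => rfl
  set t := (Finset.univ.filter fun i => ρ i = i).card with ht
  have h2 : (Finset.univ.filter fun i => ¬ ρ i = i).card = n - t := by
    rw [ht, Finset.filter_not, Finset.card_sdiff_of_subset (Finset.filter_subset _ _)]; simp
  have htn : t ≤ n := by simpa using Finset.card_filter_le Finset.univ fun i => ρ i = i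
  rw [← Finset.smul_sum]
  simp only [h1]
  rw [Finset.sum_ite, Finset.sum_const, Finset.sum_const, h2, ← ht, smul_add, pointLaw]
  have e1 : ENNReal.ofReal ((t : ℝ) / n) = (n : ENNReal)⁻¹ * t := by
    rw [ENNReal.ofReal_div_of_pos hn', ENNReal.ofReal_natCast, ENNReal.ofReal_natCast,
      ENNReal.div_eq_inv_mul]
  have e2 : ENNReal.ofReal (1 - (t : ℝ) / n) = (n : ENNReal)⁻¹ * ((n - t : ℕ) : ENNReal) := by
    have : 1 - (t : ℝ) / n = ((n - t : ℕ) : ℝ) / n := by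
      rw [Nat.cast_sub htn]; field_simp
    rw [this, ENNReal.ofReal_div_of_pos hn', ENNReal.ofReal_natCast, ENNReal.ofReal_natCast,
      ENNReal.div_eq_inv_mul]
  rw [e1, e2, ← Nat.cast_smul_eq_nsmul ENNReal, ← Nat.cast_smul_eq_nsmul ENNReal, smul_smul,
    smul_smul]
  rfl

theorem ae_injective_uniform :
    ∀ᵐ u ∂(volume : Measure (Fin n → I)), Function.Injective u := by
  have h : ∀ᵐ u ∂(volume : Measure (Fin n → I)), ∀ i j, i ≠ j → u i ≠ u j := by
    rw [ae_all_iff]; intro i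
    rw [ae_all_iff]; intro j
    by_cases hij : i = j
    · simp [hij]
    · simp only [ne_eq, hij, not_false_eq_true, forall_const]
      exact ae_apply_ne_apply (fun _ => volume) measurable_id hij fun x => by simp
  filter_upwards [h] with u hu i j hij
  by_contra hne
  exact hu i j hne hij

theorem pointLaw_fst_preimage_singleton (p : ℝ) (x : I) :
    pointLaw p (Prod.fst ⁻¹' {x}) = 0 := by
  have hm : MeasurableSet (Prod.fst ⁻¹' {x} : Set (I × I)) :=
    measurable_fst (measurableSet_singleton x)
  have h1 : (volume : Measure I).map (fun u => (u, u)) (Prod.fst ⁻¹' {x}) = 0 := by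
    rw [Measure.map_apply (by fun_prop) hm]
    have : (fun u : I => (u, u)) ⁻¹' (Prod.fst ⁻¹' {x}) = {x} := by ext; simp
    rw [this]; simp
  have h2 : (volume : Measure (I × I)) (Prod.fst ⁻¹' {x}) = 0 := by
    have : (Prod.fst ⁻¹' {x} : Set (I × I)) = {x} ×ˢ Set.univ := by ext; simp
    rw [this, Measure.volume_eq_prod, Measure.prod_prod]; simp
  simp [pointLaw, h1, h2]

theorem ae_injective_update_fst {p : ℝ} (hp : p ∈ Set.Icc (0 : ℝ) 1) (a : Fin r) (z : I × I) :
    ∀ᵐ y ∂Measure.pi (fun _ : Fin r => pointLaw p),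
      Function.Injective fun k => (Function.update y a z k).1 := by
  have := isProbabilityMeasure_pointLaw hp
  set ν : Fin r → Measure (I × I) := Function.update (fun _ => pointLaw p) a (Measure.dirac z)
    with hν
  have : ∀ i, IsProbabilityMeasure (ν i) := fun i => by
    rcases eq_or_ne i a with rfl | h
    · simp only [hν, Function.update_self]; infer_instance
    · simp only [hν, Function.update_of_ne h]; infer_instance
  have h0 : ∀ i, i ≠ a → ∀ x : I, ν i (Prod.fst ⁻¹' {x}) = 0 := fun i hi x => by
    rw [hν, Function.update_of_ne hi, pointLaw_fst_preimage_singleton]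
  have h : ∀ᵐ y ∂Measure.pi ν, ∀ i j, i ≠ j → (y i).1 ≠ (y j).1 := by
    rw [ae_all_iff]; intro i
    rw [ae_all_iff]; intro j
    by_cases hij : i = j
    · simp [hij]
    · simp only [ne_eq, hij, not_false_eq_true, forall_const]
      by_cases hi : i = a
      · filter_upwards [ae_apply_ne_apply ν measurable_fst (Ne.symm hij)
          (h0 j (by rintro rfl; exact hij hi))] with y hy
        exact fun h => hy h.symm
      · exact ae_apply_ne_apply ν measurable_fst hij (h0 i hi)
  rw [hν, ← pi_map_update] at h
  have h' := ae_of_ae_map (by fun_prop) h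
  filter_upwards [h'] with y hy i j hij
  by_contra hne
  exact hy i j hne hij

end PairLaws

/-! ### Hoeffding decomposition and the second moment of the degenerate part. -/

section Hoeffding

variable {n r : ℕ}

/-- The mean of `g` under independent points with the laws of `pts ρ u (k a)`. -/
noncomputable def meanAt (ρ : Equiv.Perm (Fin n)) (g : (Fin r → I × I) → ℝ) (k : Fin r → Fin n) :
    ℝ :=
  ∫ y, g y ∂Measure.pi fun a => pairLaw ρ (k a)

/-- The mean of `g` when the `a`-th point is frozen. -/
noncomputable def projAt (ρ : Equiv.Perm (Fin n)) (g : (Fin r → I × I) → ℝ) (k : Fin r → Fin n)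
    (a : Fin r) (z : I × I) : ℝ :=
  ∫ y, g (Function.update y a z) ∂Measure.pi fun a => pairLaw ρ (k a)

/-- The degenerate part of `g`: what remains after removing the mean and the first order
projections. -/
noncomputable def remAt (ρ : Equiv.Perm (Fin n)) (g : (Fin r → I × I) → ℝ) (k : Fin r → Fin n)
    (z : Fin r → I × I) : ℝ :=
  g z - meanAt ρ g k - ∑ a, (projAt ρ g k a (z a) - meanAt ρ g k)

variable {ρ : Equiv.Perm (Fin n)} {g : (Fin r → I × I) → ℝ} {C : ℝ}

theorem abs_integral_le {Ω : Type*} [MeasurableSpace Ω] {μ : Measure Ω} [IsProbabilityMeasure μ]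
    {f : Ω → ℝ} {C : ℝ} (hC : ∀ x, |f x| ≤ C) : |∫ x, f x ∂μ| ≤ C := by
  have := norm_integral_le_of_norm_le_const (μ := μ) (f := f) (C := C) (ae_of_all _ hC)
  simpa using this

theorem integrable_of_abs_le {Ω : Type*} [MeasurableSpace Ω] {μ : Measure Ω} [IsFiniteMeasure μ]
    {f : Ω → ℝ} (hf : Measurable f) {C : ℝ} (hC : ∀ x, |f x| ≤ C) : Integrable f μ :=
  Integrable.of_bound hf.aestronglyMeasurable C (ae_of_all _ hC)

theorem abs_meanAt_le (hC : ∀ y, |g y| ≤ C) (k : Fin r → Fin n) : |meanAt ρ g k| ≤ C :=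
  abs_integral_le hC

theorem abs_projAt_le (hC : ∀ y, |g y| ≤ C) (k : Fin r → Fin n) (a : Fin r) (z : I × I) :
    |projAt ρ g k a z| ≤ C :=
  abs_integral_le fun _ => hC _

theorem measurable_integral_update {ι E : Type*} [Fintype ι] [DecidableEq ι] [MeasurableSpace E]
    {g : (ι → E) → ℝ} (hg : Measurable g) (μ : Measure (ι → E)) [SFinite μ] (a : ι) :
    Measurable fun z => ∫ y, g (Function.update y a z) ∂μ :=
  ((hg.comp (measurable_update_pair a)).stronglyMeasurable.integral_prod_left' (μ := μ)).measurable

theorem measurable_projAt (hg : Measurable g) (k : Fin r → Fin n) (a : Fin r) :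
    Measurable (projAt ρ g k a) :=
  measurable_integral_update hg _ a

theorem measurable_remAt (hg : Measurable g) (k : Fin r → Fin n) : Measurable (remAt ρ g k) := by
  refine (hg.sub_const _).sub (Finset.measurable_sum _ fun a _ => ?_)
  exact ((measurable_projAt hg k a).comp (measurable_pi_apply a)).sub_const _

theorem abs_remAt_le (hC : ∀ y, |g y| ≤ C) (k : Fin r → Fin n) (z : Fin r → I × I) :
    |remAt ρ g k z| ≤ 2 * (r + 1) * C := by
  have h1 : |∑ a, (projAt ρ g k a (z a) - meanAt ρ g k)| ≤ ∑ _a : Fin r, 2 * C := by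
    refine (Finset.abs_sum_le_sum_abs _ _).trans (Finset.sum_le_sum fun a _ => ?_)
    have h2 := abs_projAt_le (ρ := ρ) hC k a (z a)
    have h3 := abs_meanAt_le (ρ := ρ) hC k
    have := abs_sub (projAt ρ g k a (z a)) (meanAt ρ g k)
    linarith
  rw [Finset.sum_const, Finset.card_univ, Fintype.card_fin, nsmul_eq_mul] at h1
  have h2 := abs_meanAt_le (ρ := ρ) hC k
  have h3 := hC z
  have h4 := abs_sub (g z - meanAt ρ g k) (∑ a, (projAt ρ g k a (z a) - meanAt ρ g k))
  have h5 := abs_sub (g z) (meanAt ρ g k)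
  unfold remAt
  linarith

theorem integral_projAt (hg : Measurable g) (hC : ∀ y, |g y| ≤ C) (k : Fin r → Fin n)
    (a : Fin r) : ∫ z, projAt ρ g k a z ∂pairLaw ρ (k a) = meanAt ρ g k :=
  integral_integral_update (fun a => pairLaw ρ (k a)) a hg hC

/-- Complete degeneracy to first order: with slot `a` frozen at `z`, the function `g` averages to
its projection at `z`, which the `a`-th term removes together with the mean, while the projections
on the other slots average to zero. -/
theorem integral_remAt_update (hg : Measurable g) (hC : ∀ y, |g y| ≤ C) (k : Fin r → Fin n)
    (a : Fin r) (z : I × I) :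
    ∫ y, remAt ρ g k (Function.update y a z) ∂Measure.pi (fun a => pairLaw ρ (k a)) = 0 := by
  set μ := Measure.pi fun a => pairLaw ρ (k a) with hμ
  set m := meanAt ρ g k with hm
  have hu : Measurable fun y : Fin r → I × I => Function.update y a z := by fun_prop
  have hgi : Integrable (fun y => g (Function.update y a z)) μ :=
    integrable_of_abs_le (hg.comp hu) fun y => hC _
  have hpi (b : Fin r) : Integrable (fun y => projAt ρ g k b (Function.update y a z b)) μ :=
    integrable_of_abs_le ((measurable_projAt hg k b).comp ((measurable_pi_apply b).comp hu))
      fun y => abs_projAt_le hC k b _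
  have hb (b : Fin r) : ∫ y, (projAt ρ g k b (Function.update y a z b) - m) ∂μ =
      if b = a then projAt ρ g k a z - m else 0 := by
    rw [integral_sub (hpi b) (integrable_const _)]
    split_ifs with h
    · subst h; simp
    · simp only [Function.update_of_ne h]
      have h1 : ∫ y, projAt ρ g k b (y b) ∂μ = m := by
        rw [hm, ← integral_projAt hg hC k b,
          ← (measurePreserving_eval (fun a => pairLaw ρ (k a)) b).map_eq]
        exact (integral_map (measurable_pi_apply b).aemeasurable
          (measurable_projAt hg k b).aestronglyMeasurable).symm
      rw [h1]; simp
  have hpi' (b : Fin r) : Integrable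
      (fun y => projAt ρ g k b (Function.update y a z b) - m) μ := (hpi b).sub (integrable_const _)
  have hgi' : Integrable (fun y => g (Function.update y a z) - m) μ :=
    hgi.sub (integrable_const _)
  unfold remAt
  rw [← hm, integral_sub hgi' (integrable_finsetSum _ fun b _ => hpi' b),
    integral_finsetSum _ fun b _ => hpi' b, integral_sub hgi (integrable_const _)]
  simp only [hb]
  simp [projAt, hμ]

/-- Only the slot `a` of `k` may touch the tuple `l`. Given the `a`-th point and the points of `l`,
the other points of `k` still have their product law, so the conditional mean of the first factor
vanishes by degeneracy. -/
theorem integral_remAt_mul_remAt (hg : Measurable g) (hC : ∀ y, |g y| ≤ C) (k l : Fin r → Fin n)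
    (a : Fin r) (h1 : ∀ b c, b ≠ c → ¬ Near ρ (k b) (k c))
    (h2 : ∀ b c, b ≠ a → ¬ Near ρ (k b) (l c)) :
    ∫ u : Fin n → I, remAt ρ g k (fun b => pts ρ u (k b)) * remAt ρ g l (fun b => pts ρ u (l b))
      = 0 := by
  have hmk : ∀ k : Fin r → Fin n, Measurable fun (u : Fin n → I) b => pts ρ u (k b) := fun k =>
    measurable_pi_lambda _ fun b => measurable_pts ρ (k b)
  -- Overwriting slot `a` by `0` makes `X` independent of the `a`-th point; `Y` carries that point
  -- and `F` puts it back.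
  let X (u : Fin n → I) : Fin r → I × I := Function.update (fun b => pts ρ u (k b)) a 0
  let Y (u : Fin n → I) : (I × I) × (Fin r → I × I) := (pts ρ u (k a), fun b => pts ρ u (l b))
  let F (p : (Fin r → I × I) × ((I × I) × (Fin r → I × I))) : ℝ :=
    remAt ρ g k (Function.update p.1 a p.2.1) * remAt ρ g l p.2.2
  have hX : Measurable X := by
    have : Measurable fun y : Fin r → I × I => Function.update y a 0 := by fun_prop
    exact this.comp (hmk k)
  have hY : Measurable Y := (measurable_pts ρ (k a)).prodMk (hmk l)
  have hF : Measurable F := by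
    refine Measurable.mul ((measurable_remAt hg k).comp ?_) ((measurable_remAt hg l).comp ?_)
    · exact (measurable_update_pair a).comp
        (measurable_fst.prodMk (measurable_fst.comp measurable_snd))
    · exact measurable_snd.comp measurable_snd
  let S (i : Fin n) : Finset (Fin n) := {i, ρ i}
  have hXd : DependsOn X ((Finset.univ.erase a).biUnion fun b => S (k b) : Finset (Fin n)) := by
    intro x y h
    ext1 b
    rcases eq_or_ne b a with rfl | hb
    · simp [X]
    · simp only [X, Function.update_of_ne hb]
      exact dependsOn_pts ρ (k b) fun i hi =>
        h i (Finset.mem_biUnion.2 ⟨b, Finset.mem_erase.2 ⟨hb, Finset.mem_univ b⟩, hi⟩)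
  have hYd : DependsOn Y (S (k a) ∪ Finset.univ.biUnion fun b => S (l b) : Finset (Fin n)) := by
    intro x y h
    refine Prod.ext ?_ (funext fun b => ?_)
    · exact dependsOn_pts ρ (k a) fun i hi => h i (Finset.mem_union_left _ hi)
    · exact dependsOn_pts ρ (l b) fun i hi => h i (Finset.mem_union_right _
        (Finset.mem_biUnion.2 ⟨b, Finset.mem_univ b, hi⟩))
  have hdis : Disjoint ((Finset.univ.erase a).biUnion fun b => S (k b))
      (S (k a) ∪ Finset.univ.biUnion fun b => S (l b)) := by
    rw [Finset.disjoint_biUnion_left]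
    intro b hb
    have hba : b ≠ a := (Finset.mem_erase.1 hb).1
    rw [Finset.disjoint_union_right, Finset.disjoint_biUnion_right]
    exact ⟨disjoint_of_not_near (h1 b a hba), fun c _ => disjoint_of_not_near (h2 b c hba)⟩
  have hind : IndepFun X Y (volume : Measure (Fin n → I)) :=
    indepFun_of_dependsOn _ hX hY hXd hYd hdis
  have hb : ∀ p, |F p| ≤ (2 * (r + 1) * C) * (2 * (r + 1) * C) := fun p => by
    rw [abs_mul]
    exact mul_le_mul (abs_remAt_le hC _ _) (abs_remAt_le hC _ _) (abs_nonneg _)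
      ((abs_nonneg _).trans (abs_remAt_le (ρ := ρ) hC k (fun _ => 0)))
  have h := integral_indepFun hX hY hind hF hb
  have hl : ∀ u, F (X u, Y u) =
      remAt ρ g k (fun b => pts ρ u (k b)) * remAt ρ g l (fun b => pts ρ u (l b)) := fun u => by
    have : Function.update (X u) a (pts ρ u (k a)) = fun b => pts ρ u (k b) := by
      simp [X]
    simp only [F, Y, this]
  simp only [hl] at h
  rw [h]
  have h0 : ∀ u, ∫ u', F (X u', Y u) = 0 := fun u => by
    simp only [F]
    rw [integral_mul_const]
    have : ∫ u' : Fin n → I, remAt ρ g k (Function.update (X u') a (Y u).1) = 0 := by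
      simp only [X, Function.update_idem]
      rw [← integral_remAt_update (ρ := ρ) hg hC k a (Y u).1, ← map_pts_tuple ρ h1]
      refine (integral_map (hmk k).aemeasurable (f := fun y => remAt ρ g k (Function.update y a _))
        ((measurable_remAt hg k).comp ?_).aestronglyMeasurable).symm
      fun_prop
    rw [this, zero_mul]
  simp [h0]

/-- The points at distance at most one from `i` along the cycle, as images of `i`. -/
def stepPerm (ρ : Equiv.Perm (Fin n)) : Fin 3 → Equiv.Perm (Fin n) := ![1, ρ, ρ⁻¹]

theorem near_iff_exists_stepPerm {i j : Fin n} : Near ρ i j ↔ ∃ c, j = stepPerm ρ c i := by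
  simp only [Near, stepPerm, Fin.exists_fin_succ]
  simp [Equiv.eq_symm_apply, eq_comm]

/-- The entries at `p` and `q` are each determined, up to three choices, by entries at other slots,
so two degrees of freedom are lost. The case `p' = q'` is allowed. -/
theorem card_near_pairs_le {K : Type*} [Fintype K] [DecidableEq K] {p q p' q' : K} (hpq : p ≠ q)
    (hp : p' ≠ p) (hp2 : p' ≠ q) (hq : q' ≠ p) (hq2 : q' ≠ q) :
    (Finset.univ.filter fun κ : K → Fin n => Near ρ (κ p') (κ p) ∧ Near ρ (κ q') (κ q)).card ≤
      9 * n ^ (Fintype.card K - 2) := by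
  have hc : Fintype.card {x : K // x ≠ p ∧ x ≠ q} = Fintype.card K - 2 := by
    rw [Fintype.card_subtype, ← Finset.card_univ, ← Finset.card_pair hpq,
      ← Finset.card_sdiff_of_subset (Finset.subset_univ _)]
    congr 1
    ext x; simp
  let S (c : Fin 3 × Fin 3) : Finset (K → Fin n) :=
    Finset.univ.filter fun κ => κ p = stepPerm ρ c.1 (κ p') ∧ κ q = stepPerm ρ c.2 (κ q')
  have hS (c : Fin 3 × Fin 3) : (S c).card ≤ n ^ (Fintype.card K - 2) := by
    have : n ^ (Fintype.card K - 2) = Fintype.card ({x : K // x ≠ p ∧ x ≠ q} → Fin n) := by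
      rw [Fintype.card_fun, hc, Fintype.card_fin]
    rw [this, ← Finset.card_univ]
    refine Finset.card_le_card_of_injOn (fun κ x => κ x) (fun _ _ => Finset.mem_univ _) ?_
    intro κ hκ κ' hκ' h
    have h1 := (Finset.mem_filter.1 hκ).2
    have h2 := (Finset.mem_filter.1 hκ').2
    have h3 : ∀ x, x ≠ p → x ≠ q → κ x = κ' x := fun x hx hx' => congrFun h ⟨x, hx, hx'⟩
    ext1 x
    by_cases hxp : x = p
    · rw [hxp, h1.1, h2.1, h3 p' hp hp2]
    · by_cases hxq : x = q
      · rw [hxq, h1.2, h2.2, h3 q' hq hq2]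
      · exact h3 x hxp hxq
  have hsub : (Finset.univ.filter fun κ : K → Fin n =>
      Near ρ (κ p') (κ p) ∧ Near ρ (κ q') (κ q)) ⊆ Finset.univ.biUnion S := by
    intro κ hκ
    obtain ⟨h1, h2⟩ := (Finset.mem_filter.1 hκ).2
    obtain ⟨c, hc⟩ := near_iff_exists_stepPerm.1 h1
    obtain ⟨d, hd⟩ := near_iff_exists_stepPerm.1 h2
    exact Finset.mem_biUnion.2 ⟨(c, d), Finset.mem_univ _, Finset.mem_filter.2
      ⟨Finset.mem_univ _, hc, hd⟩⟩
  refine (Finset.card_le_card hsub).trans (Finset.card_biUnion_le.trans ?_)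
  refine (Finset.sum_le_sum fun c _ => hS c).trans ?_
  simp

/-- The hypotheses say that each half contains at least two slots in contact with another slot. In a
graph with that many non-isolated vertices one can remove two vertices each attached to one that
remains: start from an edge `b`–`x` and take a third non-isolated vertex `q` with neighbour `z`. If
`z` is `b`, remove `x` and `q`; otherwise remove `b` and `q`. -/
theorem exists_two_near {κ : Fin r ⊕ Fin r → Fin n} (hr : 0 < r)
    (hl : ¬ ∃ a, ∀ b, b ≠ a → ∀ q, q ≠ Sum.inl b → ¬ Near ρ (κ (Sum.inl b)) (κ q))
    (hr' : ¬ ∃ a, ∀ b, b ≠ a → ∀ q, q ≠ Sum.inr b → ¬ Near ρ (κ (Sum.inr b)) (κ q)) :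
    ∃ p q p' q' : Fin r ⊕ Fin r, p ≠ q ∧ p' ≠ p ∧ p' ≠ q ∧ q' ≠ p ∧ q' ≠ q ∧
      Near ρ (κ p') (κ p) ∧ Near ρ (κ q') (κ q) := by
  push Not at hl hr'
  obtain ⟨b, -, x, hx, hbx⟩ := hl ⟨0, hr⟩
  obtain ⟨b', hb', x', hx', hbx'⟩ := hl b
  obtain ⟨c, -, y, hy, hcy⟩ := hr' ⟨0, hr⟩
  -- The edge may join `b` to the right slot `c`; then the second left slot `b'` serves as third
  -- vertex, and otherwise `c` itself does.
  obtain ⟨q, z, hqb, hqx, hzq, hqz⟩ : ∃ q z, q ≠ Sum.inl b ∧ q ≠ x ∧ z ≠ q ∧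
      Near ρ (κ q) (κ z) := by
    by_cases h : Sum.inr c = x
    · exact ⟨Sum.inl b', x', by simpa using hb', by rw [← h]; simp, hx', hbx'⟩
    · exact ⟨Sum.inr c, y, by simp, h, hy, hcy⟩
  by_cases h : z = Sum.inl b
  · subst h
    exact ⟨x, q, Sum.inl b, Sum.inl b, Ne.symm hqx, Ne.symm hx, Ne.symm hqb, Ne.symm hx,
      Ne.symm hqb, hbx, hqz.symm⟩
  · exact ⟨Sum.inl b, q, x, z, Ne.symm hqb, hx, Ne.symm hqx, h, hzq, hbx.symm, hqz.symm⟩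

/-- Expanding the square gives a sum over pairs of tuples, that is, over maps from `Fin r ⊕ Fin r`.
A pair contributes only if both tuples have two slots in contact, which costs two degrees of
freedom. Tuples with repeated indices need no separate treatment, since equal indices are `Near`.
The constant counts the `(2r) ^ 4` choices of `(p, q, p', q')`, the nine pairs of steps, and the
square of the uniform bound on `remAt`. -/
theorem integral_sq_sum_remAt_le (hg : Measurable g) (hC : ∀ y, |g y| ≤ C) (hr : 0 < r) :
    ∫ u : Fin n → I, (∑ k : Fin r → Fin n, remAt ρ g k fun b => pts ρ u (k b)) ^ 2 ≤
      (2 * r) ^ 4 * 9 * (2 * (r + 1) * C) ^ 2 * (n : ℝ) ^ (2 * r - 2) := by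
  set D := (2 * (r + 1) * C) ^ 2 with hD
  let H (k : Fin r → Fin n) (u : Fin n → I) : ℝ := remAt ρ g k fun b => pts ρ u (k b)
  have hmH (k) : Measurable (H k) := (measurable_remAt hg k).comp
    (measurable_pi_lambda _ fun b => measurable_pts ρ (k b))
  have hb (k l u) : |H k u * H l u| ≤ D := by
    rw [abs_mul, hD, sq]
    exact mul_le_mul (abs_remAt_le hC _ _) (abs_remAt_le hC _ _) (abs_nonneg _)
      ((abs_nonneg _).trans (abs_remAt_le (ρ := ρ) hC k (fun _ => 0)))
  let P (κ : Fin r ⊕ Fin r → Fin n) (s : (Fin r ⊕ Fin r) × (Fin r ⊕ Fin r) × (Fin r ⊕ Fin r) ×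
      (Fin r ⊕ Fin r)) : Prop :=
    s.1 ≠ s.2.1 ∧ s.2.2.1 ≠ s.1 ∧ s.2.2.1 ≠ s.2.1 ∧ s.2.2.2 ≠ s.1 ∧ s.2.2.2 ≠ s.2.1 ∧
      Near ρ (κ s.2.2.1) (κ s.1) ∧ Near ρ (κ s.2.2.2) (κ s.2.1)
  classical
  have hterm (κ : Fin r ⊕ Fin r → Fin n) :
      ∫ u, H (κ ∘ Sum.inl) u * H (κ ∘ Sum.inr) u ≤ ∑ s, if P κ s then D else 0 := by
    have hnn : ∀ s, 0 ≤ (if P κ s then D else 0) := fun s => by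
      split_ifs
      · exact sq_nonneg _
      · exact le_rfl
    -- If all slots of one half but at most one are isolated, degeneracy kills the term; otherwise
    -- `exists_two_near` supplies a nonzero summand on the right.
    by_cases hl : ∃ a, ∀ b, b ≠ a → ∀ q, q ≠ Sum.inl b → ¬ Near ρ (κ (Sum.inl b)) (κ q)
    · obtain ⟨a, ha⟩ := hl
      refine le_of_eq_of_le ?_ (Finset.sum_nonneg fun s _ => hnn s)
      refine integral_remAt_mul_remAt hg hC _ _ a (fun b c hbc => ?_) fun b c hba =>
        ha b hba _ (by simp)
      by_cases hba : b = a
      · exact fun h => ha c (by rintro rfl; exact hbc hba) (Sum.inl b) (by simpa using hbc) h.symm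
      · exact ha b hba _ (by simpa using hbc.symm)
    · by_cases hr' : ∃ a, ∀ b, b ≠ a → ∀ q, q ≠ Sum.inr b → ¬ Near ρ (κ (Sum.inr b)) (κ q)
      · obtain ⟨a, ha⟩ := hr'
        refine le_of_eq_of_le ?_ (Finset.sum_nonneg fun s _ => hnn s)
        simp only [mul_comm (H (κ ∘ Sum.inl) _)]
        refine integral_remAt_mul_remAt hg hC _ _ a (fun b c hbc => ?_) fun b c hba =>
          ha b hba _ (by simp)
        by_cases hba : b = a
        · exact fun h =>
            ha c (by rintro rfl; exact hbc hba) (Sum.inr b) (by simpa using hbc) h.symm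
        · exact ha b hba _ (by simpa using hbc.symm)
      · obtain ⟨p, q, p', q', h⟩ := exists_two_near hr hl hr'
        have h1 : ∫ u, H (κ ∘ Sum.inl) u * H (κ ∘ Sum.inr) u ≤ D :=
          (le_abs_self _).trans (abs_integral_le (hb _ _))
        refine h1.trans ?_
        have h2 : P κ (p, q, p', q') := h
        have := Finset.single_le_sum (f := fun s => if P κ s then D else 0)
          (fun s _ => hnn s) (Finset.mem_univ (p, q, p', q'))
        simpa [h2] using this
  have hsq : ∀ u, (∑ k, H k u) ^ 2 = ∑ κ : Fin r ⊕ Fin r → Fin n,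
      H (κ ∘ Sum.inl) u * H (κ ∘ Sum.inr) u := fun u => by
    rw [sq, Finset.sum_mul_sum, ← Finset.sum_product', Finset.univ_product_univ]
    exact (Fintype.sum_equiv (Equiv.sumArrowEquivProdArrow _ _ _) _ _ fun κ => rfl).symm
  calc ∫ u : Fin n → I, (∑ k, H k u) ^ 2
      = ∑ κ : Fin r ⊕ Fin r → Fin n, ∫ u, H (κ ∘ Sum.inl) u * H (κ ∘ Sum.inr) u := by
        simp only [hsq]
        exact integral_finsetSum _ fun κ _ =>
          integrable_of_abs_le ((hmH _).mul (hmH _)) (hb _ _)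
    _ ≤ ∑ κ : Fin r ⊕ Fin r → Fin n, ∑ s, if P κ s then D else 0 :=
        Finset.sum_le_sum fun κ _ => hterm κ
    _ = ∑ s, ∑ κ : Fin r ⊕ Fin r → Fin n, if P κ s then D else 0 := Finset.sum_comm
    _ ≤ ∑ _s : (Fin r ⊕ Fin r) × (Fin r ⊕ Fin r) × (Fin r ⊕ Fin r) × (Fin r ⊕ Fin r),
          9 * (n : ℝ) ^ (2 * r - 2) * D := by
        refine Finset.sum_le_sum fun s _ => ?_
        rw [← Finset.sum_filter, Finset.sum_const, nsmul_eq_mul]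
        refine mul_le_mul_of_nonneg_right ?_ (sq_nonneg _)
        by_cases h : s.1 ≠ s.2.1 ∧ s.2.2.1 ≠ s.1 ∧ s.2.2.1 ≠ s.2.1 ∧ s.2.2.2 ≠ s.1 ∧
            s.2.2.2 ≠ s.2.1
        · have h2 := card_near_pairs_le (ρ := ρ) h.1 h.2.1 h.2.2.1 h.2.2.2.1 h.2.2.2.2
          have h3 : Fintype.card (Fin r ⊕ Fin r) - 2 = 2 * r - 2 := by simp [two_mul]
          rw [h3] at h2
          have h4 : (((Finset.univ.filter fun κ : Fin r ⊕ Fin r → Fin n =>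
              Near ρ (κ s.2.2.1) (κ s.1) ∧ Near ρ (κ s.2.2.2) (κ s.2.1)).card : ℕ) : ℝ) ≤
              9 * (n : ℝ) ^ (2 * r - 2) := by exact_mod_cast h2
          refine le_trans ?_ h4
          exact_mod_cast Finset.card_le_card fun κ hκ => by
            have := (Finset.mem_filter.1 hκ).2
            exact Finset.mem_filter.2 ⟨Finset.mem_univ _, this.2.2.2.2.2⟩
        · have h2 : (Finset.univ.filter fun κ => P κ s) = ∅ :=
            Finset.filter_eq_empty_iff.2 fun κ _ hP =>
              h ⟨hP.1, hP.2.1, hP.2.2.1, hP.2.2.2.1, hP.2.2.2.2.1⟩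
          rw [h2]
          simp only [Finset.card_empty, Nat.cast_zero]
          positivity
    _ = _ := by
        rw [Finset.sum_const, nsmul_eq_mul]
        simp only [Finset.card_univ, Fintype.card_prod, Fintype.card_sum, Fintype.card_fin]
        push_cast
        ring

end Hoeffding

/-! ### Summation of the decomposition and passage to the limiting parameter. -/

section FirstOrder

variable {n r : ℕ}

theorem abs_prod_sub_prod_le {ι : Type*} (s : Finset ι) {x y : ι → ℝ}
    (hx : ∀ i, |x i| ≤ 1) (hy : ∀ i, |y i| ≤ 1) :
    |∏ i ∈ s, x i - ∏ i ∈ s, y i| ≤ ∑ i ∈ s, |x i - y i| := by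
  classical
  induction s using Finset.induction_on with
  | empty => simp
  | insert a s ha ih =>
    rw [Finset.prod_insert ha, Finset.prod_insert ha, Finset.sum_insert ha]
    have h1 : x a * ∏ i ∈ s, x i - y a * ∏ i ∈ s, y i =
        (x a - y a) * ∏ i ∈ s, x i + y a * (∏ i ∈ s, x i - ∏ i ∈ s, y i) := by ring
    have h2 : |∏ i ∈ s, x i| ≤ 1 := by
      rw [Finset.abs_prod]
      exact Finset.prod_le_one (fun i _ => abs_nonneg _) fun i _ => hx i
    rw [h1]
    refine (abs_add_le _ _).trans (add_le_add ?_ ?_)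
    · rw [abs_mul]
      exact mul_le_of_le_one_right (abs_nonneg _) h2
    · rw [abs_mul]
      exact (mul_le_of_le_one_left (abs_nonneg _) (hy a)).trans ih

theorem integral_pi_eq_sum {ι J E : Type*} [Fintype ι] [DecidableEq ι] [Fintype J]
    [MeasurableSpace E] (ν : J → Measure E) [∀ j, IsProbabilityMeasure (ν j)] (c : J → ENNReal)
    (hc : ∀ j, c j ≠ ⊤) (μ : Measure E) [IsFiniteMeasure μ] (hμ : μ = ∑ j, c j • ν j)
    {G : (ι → E) → ℝ} (hG : Measurable G) {C : ℝ} (hC : ∀ y, |G y| ≤ C) :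
    ∫ y, G y ∂Measure.pi (fun _ : ι => μ) =
      ∑ k : ι → J, (∏ a, (c (k a)).toReal) * ∫ y, G y ∂Measure.pi fun a => ν (k a) := by
  rw [pi_eq_sum_smul_pi ν c μ hμ, integral_finsetSum_measure]
  · refine Finset.sum_congr rfl fun k _ => ?_
    rw [integral_smul_measure, ENNReal.toReal_prod, smul_eq_mul]
  · intro k _
    refine Integrable.smul_measure (integrable_of_abs_le hG hC) ?_
    exact ENNReal.prod_ne_top fun a _ => hc _

theorem pointLaw_eq_sum_bool (p : ℝ) :
    pointLaw p = ∑ b : Bool, ENNReal.ofReal (bif b then p else 1 - p) •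
      (bif b then diagLaw else (volume : Measure (I × I))) := by
  simp [pointLaw, diagLaw]

/-- Expand the product of mixtures over the `2 ^ r` choices of diagonal or square; each weight is a
product of `r` factors in `[0, 1]`, hence `r`-Lipschitz in the parameter. -/
theorem abs_integral_pi_pointLaw_sub_le {p q : ℝ} (hp : p ∈ Set.Icc (0 : ℝ) 1)
    (hq : q ∈ Set.Icc (0 : ℝ) 1) {G : (Fin r → I × I) → ℝ} (hG : Measurable G) {C : ℝ}
    (hC : ∀ y, |G y| ≤ C) :
    |∫ y, G y ∂Measure.pi (fun _ : Fin r => pointLaw p) -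
      ∫ y, G y ∂Measure.pi (fun _ : Fin r => pointLaw q)| ≤ 2 ^ r * (r * C) * |p - q| := by
  have := isProbabilityMeasure_pointLaw hp
  have := isProbabilityMeasure_pointLaw hq
  have hb : ∀ b : Bool, IsProbabilityMeasure (bif b then diagLaw else (volume : Measure (I × I))) :=
    fun b => by cases b <;> (simp only [cond_true, cond_false]; infer_instance)
  have hC0 : 0 ≤ C := (abs_nonneg _).trans (hC fun _ => 0)
  have hr (x : ℝ) (hx : x ∈ Set.Icc (0 : ℝ) 1) (b : Bool) :
      (ENNReal.ofReal (bif b then x else 1 - x)).toReal = bif b then x else 1 - x :=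
    ENNReal.toReal_ofReal (by cases b <;> simp [hx.1, hx.2])
  rw [integral_pi_eq_sum _ _ (fun _ => ENNReal.ofReal_ne_top) _ (pointLaw_eq_sum_bool p) hG hC,
    integral_pi_eq_sum _ _ (fun _ => ENNReal.ofReal_ne_top) _ (pointLaw_eq_sum_bool q) hG hC,
    ← Finset.sum_sub_distrib]
  simp only [hr p hp, hr q hq, ← sub_mul]
  have h1 (k : Fin r → Bool) : |∏ a, (bif k a then p else 1 - p) -
      ∏ a, (bif k a then q else 1 - q)| ≤ r * |p - q| := by
    refine (abs_prod_sub_prod_le _ (fun i => ?_) fun i => ?_).trans ?_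
    · cases k i <;> simp only [cond_true, cond_false] <;> rw [abs_le] <;>
        constructor <;> linarith [hp.1, hp.2]
    · cases k i <;> simp only [cond_true, cond_false] <;> rw [abs_le] <;>
        constructor <;> linarith [hq.1, hq.2]
    · have h2 (i : Fin r) :
          |(bif k i then p else 1 - p) - (bif k i then q else 1 - q)| = |p - q| := by
        cases k i
        · simp only [cond_false]
          rw [show (1 - p) - (1 - q) = -(p - q) by ring, abs_neg]
        · rfl
      simp [h2]
  refine (Finset.abs_sum_le_sum_abs _ _).trans ?_
  refine (Finset.sum_le_sum (g := fun _ => r * |p - q| * C) fun k _ => ?_).trans ?_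
  · rw [abs_mul]
    exact mul_le_mul (h1 k) (abs_integral_le hC) (abs_nonneg _) (by positivity)
  · rw [Finset.sum_const, Finset.card_univ, nsmul_eq_mul]
    simp only [Fintype.card_fun, Fintype.card_bool, Fintype.card_fin, Nat.cast_pow, Nat.cast_ofNat]
    exact le_of_eq (by ring)

/-- The proportion of fixed points. -/
noncomputable def fixFrac (ρ : Equiv.Perm (Fin n)) : ℝ :=
  ((Finset.univ.filter fun i => ρ i = i).card : ℝ) / n

theorem fixFrac_mem (ρ : Equiv.Perm (Fin n)) : fixFrac ρ ∈ Set.Icc (0 : ℝ) 1 := by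
  refine ⟨by unfold fixFrac; positivity, div_le_one_of_le₀ ?_ (by positivity)⟩
  have : (Finset.univ.filter fun i => ρ i = i).card ≤ n := by
    simpa using Finset.card_filter_le Finset.univ fun i => ρ i = i
  exact_mod_cast this

theorem sum_integral_pi_pairLaw (hn : n ≠ 0) (ρ : Equiv.Perm (Fin n))
    {G : (Fin r → I × I) → ℝ} (hG : Measurable G) {C : ℝ} (hC : ∀ y, |G y| ≤ C) :
    ∑ k : Fin r → Fin n, ∫ y, G y ∂Measure.pi (fun a => pairLaw ρ (k a)) =
      (n : ℝ) ^ r * ∫ y, G y ∂Measure.pi (fun _ : Fin r => pointLaw (fixFrac ρ)) := by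
  have := isProbabilityMeasure_pointLaw (fixFrac_mem ρ)
  have hn' : (n : ℝ) ≠ 0 := by exact_mod_cast hn
  have hsum : pointLaw (fixFrac ρ) = ∑ i, (n : ENNReal)⁻¹ • pairLaw ρ i :=
    pointLaw_eq_sum_pairLaw hn ρ
  rw [integral_pi_eq_sum _ _ (fun _ => ENNReal.inv_ne_top.2 (by exact_mod_cast hn)) _ hsum hG hC]
  simp only [ENNReal.toReal_inv, ENNReal.toReal_natCast, Finset.prod_const, Finset.card_univ,
    Fintype.card_fin]
  rw [← Finset.mul_sum, ← mul_assoc, ← mul_pow, mul_inv_cancel₀ hn', one_pow, one_mul]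

/-- As `L i k` ignores `k a`, this entry can play the role of a free index: the involution
exchanging `i` with `k a` matches the two double sums. -/
theorem sum_apply_coord (a : Fin r) (L : Fin n → (Fin r → Fin n) → ℝ)
    (hL : ∀ i k j, L i (Function.update k a j) = L i k) :
    n * ∑ k : Fin r → Fin n, L (k a) k = ∑ i, ∑ k : Fin r → Fin n, L i k := by
  have h1 : (n : ℝ) * ∑ k : Fin r → Fin n, L (k a) k =
      ∑ _i : Fin n, ∑ k : Fin r → Fin n, L (k a) k := by simp
  rw [h1, ← Finset.sum_product', ← Finset.sum_product', Finset.univ_product_univ]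
  refine Finset.sum_bij' (fun p _ => (p.2 a, Function.update p.2 a p.1))
    (fun p _ => (p.2 a, Function.update p.2 a p.1)) (fun _ _ => Finset.mem_univ _)
    (fun _ _ => Finset.mem_univ _) ?_ ?_ ?_
  · rintro ⟨i, k⟩ -; simp
  · rintro ⟨i, k⟩ -; simp
  · rintro ⟨i, k⟩ -; simp [hL]

/-- The law of the frozen slot is replaced by a Dirac mass, so the index assigned to that slot is
irrelevant. -/
theorem projAt_update {ρ : Equiv.Perm (Fin n)} {g : (Fin r → I × I) → ℝ} (hg : Measurable g)
    (k : Fin r → Fin n) (a : Fin r) (j : Fin n) (z : I × I) :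
    projAt ρ g (Function.update k a j) a z = projAt ρ g k a z := by
  have hu : Measurable fun y : Fin r → I × I => Function.update y a z := by fun_prop
  have h (k : Fin r → Fin n) : projAt ρ g k a z =
      ∫ y, g y ∂Measure.pi
        (Function.update (fun a => pairLaw ρ (k a)) a (Measure.dirac z)) := by
    rw [← pi_map_update, integral_map hu.aemeasurable hg.aestronglyMeasurable]
    rfl
  rw [h, h]
  congr 2
  ext1 b
  rcases eq_or_ne b a with rfl | hb
  · simp
  · simp [hb]

/-- The mean of `g` under independent points with law `pointLaw p`, the `a`-th one frozen. -/
noncomputable def proj (p : ℝ) (g : (Fin r → I × I) → ℝ) (a : Fin r) (z : I × I) : ℝ :=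
  ∫ y, g (Function.update y a z) ∂Measure.pi fun _ => pointLaw p

theorem measurable_proj {p : ℝ} (hp : p ∈ Set.Icc (0 : ℝ) 1) {g : (Fin r → I × I) → ℝ}
    (hg : Measurable g) (a : Fin r) : Measurable (proj p g a) := by
  have := isProbabilityMeasure_pointLaw hp
  exact measurable_integral_update hg _ a

theorem abs_proj_le {p : ℝ} (hp : p ∈ Set.Icc (0 : ℝ) 1) {g : (Fin r → I × I) → ℝ} {C : ℝ}
    (hC : ∀ y, |g y| ≤ C) (a : Fin r) (z : I × I) : |proj p g a z| ≤ C := by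
  have := isProbabilityMeasure_pointLaw hp
  exact abs_integral_le fun _ => hC _

/-- At the parameter `fixFrac ρ` the identity is exact: summed over `k`, the means give `n ^ r`
times one integral, and the projections on slot `a` give a sum over single points with weight `n ^
(r - 1)`. -/
theorem sum_eq_sum_remAt_add (hn : n ≠ 0) (ρ : Equiv.Perm (Fin n)) {g : (Fin r → I × I) → ℝ}
    (hg : Measurable g) {C : ℝ} (hC : ∀ y, |g y| ≤ C) (u : Fin n → I) :
    ∑ k : Fin r → Fin n, g (fun b => pts ρ u (k b)) =
      ∑ k : Fin r → Fin n, remAt ρ g k (fun b => pts ρ u (k b)) +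
        (n : ℝ) ^ r * ∫ y, g y ∂Measure.pi (fun _ : Fin r => pointLaw (fixFrac ρ)) +
        (n : ℝ) ^ r / n * ∑ a, ∑ i, (proj (fixFrac ρ) g a (pts ρ u i) -
          ∫ z, proj (fixFrac ρ) g a z ∂pairLaw ρ i) := by
  have hn' : (n : ℝ) ≠ 0 := by exact_mod_cast hn
  have hpm := isProbabilityMeasure_pointLaw (fixFrac_mem ρ)
  have hsum (a : Fin r) (z : I × I) : ∑ k : Fin r → Fin n, projAt ρ g k a z =
      (n : ℝ) ^ r * proj (fixFrac ρ) g a z :=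
    sum_integral_pi_pairLaw hn ρ
      (hg.comp (by fun_prop : Measurable fun y : Fin r → I × I => Function.update y a z))
      fun y => hC _
  have key (a : Fin r) : ∑ k : Fin r → Fin n,
      (projAt ρ g k a (pts ρ u (k a)) - meanAt ρ g k) =
      (n : ℝ) ^ r / n * ∑ i, (proj (fixFrac ρ) g a (pts ρ u i) -
          ∫ z, proj (fixFrac ρ) g a z ∂pairLaw ρ i) := by
    have h1 := sum_apply_coord a
      (fun i k => projAt ρ g k a (pts ρ u i) - ∫ z, projAt ρ g k a z ∂pairLaw ρ i)
      (fun i k j => by simp only [projAt_update hg])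
    simp only [integral_projAt hg hC] at h1
    rw [div_mul_eq_mul_div, eq_div_iff hn', mul_comm, h1, Finset.mul_sum]
    refine Finset.sum_congr rfl fun i _ => ?_
    rw [Finset.sum_sub_distrib, hsum, mul_sub, ← integral_const_mul]
    simp only [← hsum]
    rw [integral_finsetSum _ fun k _ =>
      integrable_of_abs_le (measurable_projAt hg k a) (abs_projAt_le hC k a)]
  have hmean : ∑ k : Fin r → Fin n, meanAt ρ g k = (n : ℝ) ^ r *
      ∫ y, g y ∂Measure.pi (fun _ : Fin r => pointLaw (fixFrac ρ)) :=
    sum_integral_pi_pairLaw hn ρ hg hC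
  rw [Finset.mul_sum]
  simp only [← key]
  rw [Finset.sum_comm, ← hmean, ← Finset.sum_add_distrib, ← Finset.sum_add_distrib]
  refine Finset.sum_congr rfl fun k _ => ?_
  unfold remAt
  ring

/-- Both the mean and the projections are Lipschitz in the parameter. The mean changes by one
Lipschitz error, and each of the `r * n` centred projections, of relative weight `1 / n`, by at most
two; hence the factor `1 + 2 * r`. -/
theorem abs_sum_sub_le (hn : n ≠ 0) (ρ : Equiv.Perm (Fin n)) {p : ℝ}
    (hp : p ∈ Set.Icc (0 : ℝ) 1) {g : (Fin r → I × I) → ℝ}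
    (hg : Measurable g) {C : ℝ} (hC : ∀ y, |g y| ≤ C) (u : Fin n → I) :
    |∑ k : Fin r → Fin n, g (fun b => pts ρ u (k b)) -
      ∑ k : Fin r → Fin n, remAt ρ g k (fun b => pts ρ u (k b)) -
      (n : ℝ) ^ r * ∫ y, g y ∂Measure.pi (fun _ : Fin r => pointLaw p) -
      (n : ℝ) ^ r / n * ∑ a, ∑ i, (proj p g a (pts ρ u i) - ∫ z, proj p g a z ∂pairLaw ρ i)| ≤
      (n : ℝ) ^ r * ((1 + 2 * r) * (2 ^ r * (r * C)) * |fixFrac ρ - p|) := by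
  have hn' : (n : ℝ) ≠ 0 := by exact_mod_cast hn
  have hq := fixFrac_mem ρ
  set q := fixFrac ρ with hqdef
  set K := 2 ^ r * (r * C) * |q - p| with hK
  have h0 : |∫ y, g y ∂Measure.pi (fun _ : Fin r => pointLaw q) -
      ∫ y, g y ∂Measure.pi (fun _ : Fin r => pointLaw p)| ≤ K :=
    abs_integral_pi_pointLaw_sub_le hq hp hg hC
  have h1 (a : Fin r) (z : I × I) : |proj q g a z - proj p g a z| ≤ K :=
    abs_integral_pi_pointLaw_sub_le hq hp
      (hg.comp (by fun_prop : Measurable fun y : Fin r → I × I => Function.update y a z))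
      fun y => hC _
  have h2 (a : Fin r) (i : Fin n) : |∫ z, proj q g a z ∂pairLaw ρ i -
      ∫ z, proj p g a z ∂pairLaw ρ i| ≤ K := by
    rw [← integral_sub (integrable_of_abs_le (measurable_proj hq hg a) (abs_proj_le hq hC a))
      (integrable_of_abs_le (measurable_proj hp hg a) (abs_proj_le hp hC a))]
    exact abs_integral_le (h1 a)
  rw [sum_eq_sum_remAt_add hn ρ hg hC u, ← hqdef]
  have h3 : |∑ a, ∑ i, (proj q g a (pts ρ u i) - ∫ z, proj q g a z ∂pairLaw ρ i) -
      ∑ a, ∑ i, (proj p g a (pts ρ u i) - ∫ z, proj p g a z ∂pairLaw ρ i)| ≤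
      ∑ _a : Fin r, ∑ _i : Fin n, 2 * K := by
    rw [← Finset.sum_sub_distrib]
    refine (Finset.abs_sum_le_sum_abs _ _).trans (Finset.sum_le_sum fun a _ => ?_)
    rw [← Finset.sum_sub_distrib]
    refine (Finset.abs_sum_le_sum_abs _ _).trans (Finset.sum_le_sum fun i _ => ?_)
    rw [sub_sub_sub_comm]
    refine (abs_sub _ _).trans ?_
    linarith [h1 a (pts ρ u i), h2 a i]
  simp only [Finset.sum_const, Finset.card_univ, Fintype.card_fin, nsmul_eq_mul] at h3
  set A := ∑ a, ∑ i, (proj q g a (pts ρ u i) - ∫ z, proj q g a z ∂pairLaw ρ i)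
  set B := ∑ a, ∑ i, (proj p g a (pts ρ u i) - ∫ z, proj p g a z ∂pairLaw ρ i)
  set M := ∫ y, g y ∂Measure.pi (fun _ : Fin r => pointLaw q)
  set N := ∫ y, g y ∂Measure.pi (fun _ : Fin r => pointLaw p)
  set R := ∑ k : Fin r → Fin n, remAt ρ g k (fun b => pts ρ u (k b))
  have h4 : R + (n : ℝ) ^ r * M + (n : ℝ) ^ r / n * A - R - (n : ℝ) ^ r * N -
      (n : ℝ) ^ r / n * B = (n : ℝ) ^ r * ((M - N) + (A - B) / n) := by
    field_simp
    ring
  rw [h4, abs_mul, abs_of_nonneg (by positivity : (0 : ℝ) ≤ (n : ℝ) ^ r)]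
  refine mul_le_mul_of_nonneg_left ?_ (by positivity)
  refine (abs_add_le _ _).trans ?_
  have h5 : |(A - B) / n| ≤ 2 * r * K := by
    rw [abs_div, Nat.abs_cast, div_le_iff₀ (by positivity)]
    linarith
  have h6 : (1 + 2 * r) * (2 ^ r * (r * C)) * |q - p| = K + 2 * r * K := by rw [hK]; ring
  rw [h6]
  exact add_le_add h0 h5

end FirstOrder

/-! ### Stein–Tikhomirov method for sums of locally dependent bounded variables. -/

section SteinTikhomirov

theorem norm_cexp_mul_I_sub_one_sub_le (x : ℝ) :
    ‖Complex.exp (x * Complex.I) - 1 - x * Complex.I‖ ≤ 3 * x ^ 2 := by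
  have hn : ‖(x : ℂ) * Complex.I‖ = |x| := by simp
  by_cases h : |x| ≤ 1
  · have := Complex.norm_exp_sub_one_sub_id_le (x := x * Complex.I) (by rwa [hn])
    rw [hn, sq_abs] at this
    nlinarith [sq_nonneg x]
  · push Not at h
    have h1 := norm_sub_le (Complex.exp (x * Complex.I) - 1) (x * Complex.I)
    have h2 := norm_sub_le (Complex.exp (x * Complex.I)) 1
    rw [Complex.norm_exp_ofReal_mul_I, norm_one] at h2
    rw [hn] at h1
    nlinarith [sq_abs x]

variable {Ω ι : Type*} [MeasurableSpace Ω] {μ : Measure Ω} [IsProbabilityMeasure μ]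
  [Fintype ι] [DecidableEq ι] {X : ι → Ω → ℝ} {b : ℝ} {N : ι → Finset ι}

theorem integral_sq_sum_eq (hX : ∀ i, Measurable (X i)) (hb : ∀ i ω, |X i ω| ≤ b)
    (h0 : ∀ i, ∫ ω, X i ω ∂μ = 0)
    (hind : ∀ i, IndepFun (X i) (fun ω => ∑ j ∈ (N i)ᶜ, X j ω) μ) :
    ∫ ω, (∑ i, X i ω) ^ 2 ∂μ = ∫ ω, ∑ i, X i ω * ∑ j ∈ N i, X j ω ∂μ := by
  have hi (s : Finset ι) : Integrable (fun ω => ∑ j ∈ s, X j ω) μ :=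
    integrable_finsetSum _ fun j _ => integrable_of_abs_le (hX j) (hb j)
  have him (i : ι) (s : Finset ι) : Integrable (fun ω => X i ω * ∑ j ∈ s, X j ω) μ :=
    (hi s).bdd_mul (hX i).aestronglyMeasurable (ae_of_all _ (hb i))
  have h1 (i : ι) : ∫ ω, X i ω * ∑ j ∈ (N i)ᶜ, X j ω ∂μ = 0 := by
    rw [(hind i).integral_fun_mul_eq_mul_integral (hX i).aestronglyMeasurable
      (Finset.measurable_sum _ fun j _ => hX j).aestronglyMeasurable, h0, zero_mul]
  have h2 : ∀ ω, (∑ i, X i ω) ^ 2 =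
      ∑ i, X i ω * ∑ j ∈ N i, X j ω + ∑ i, X i ω * ∑ j ∈ (N i)ᶜ, X j ω := fun ω => by
    rw [← Finset.sum_add_distrib, sq, Finset.sum_mul]
    refine Finset.sum_congr rfl fun i _ => ?_
    rw [← mul_add, Finset.sum_add_sum_compl]
  simp only [h2]
  rw [integral_add (integrable_finsetSum _ fun i _ => him i _)
    (integrable_finsetSum _ fun i _ => him i _),
    integral_finsetSum Finset.univ (f := fun i ω => X i ω * ∑ j ∈ (N i)ᶜ, X j ω)
      fun i _ => him i _]
  simp [h1]

/-- With `φ` the characteristic function of the sum `S`, this is the approximate equation `φ' = -t v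
φ`. In `φ'`, which is the sum of the means of `i X_j exp(itS)`, subtract from `S` the neighbourhood
sum `Y_j`. The resulting product has mean zero by independence, and the first-order correction is
`-t` times the mean of `(∑ X_j Y_j) exp(itS)`. Replacing `∑ X_j Y_j` by `v` costs `δ`; the last
error term is the quadratic Taylor remainder. -/
theorem norm_deriv_charFun_add_le {D : ℝ} (hX : ∀ i, Measurable (X i))
    (hb : ∀ i ω, |X i ω| ≤ b) (hb0 : 0 ≤ b) (h0 : ∀ i, ∫ ω, X i ω ∂μ = 0)
    (hN : ∀ i, ((N i).card : ℝ) ≤ D)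
    (hind : ∀ i, IndepFun (X i) (fun ω => ∑ j ∈ (N i)ᶜ, X j ω) μ) {v δ : ℝ}
    (hδ : ∫ ω, |∑ i, X i ω * ∑ j ∈ N i, X j ω - v| ∂μ ≤ δ) {t : ℝ} (ht : t ∈ Set.Icc (0 : ℝ) 1) :
    ‖∫ ω, ((∑ i, X i ω : ℝ) * Complex.I) * Complex.exp ((t * ∑ i, X i ω : ℝ) * Complex.I) ∂μ +
      t * v * ∫ ω, Complex.exp ((t * ∑ i, X i ω : ℝ) * Complex.I) ∂μ‖ ≤
      δ + 3 * Fintype.card ι * D ^ 2 * b ^ 3 := by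
  set e : ℝ → ℂ := fun x => Complex.exp (x * Complex.I) with he
  have hem : Measurable e := by fun_prop
  have hen (x : ℝ) : ‖e x‖ = 1 := Complex.norm_exp_ofReal_mul_I x
  let S (ω : Ω) : ℝ := ∑ i, X i ω
  let Y (i : ι) (ω : Ω) : ℝ := ∑ j ∈ N i, X j ω
  let T (i : ι) (ω : Ω) : ℝ := ∑ j ∈ (N i)ᶜ, X j ω
  let Q (ω : Ω) : ℝ := ∑ i, X i ω * Y i ω
  have hSm : Measurable S := Finset.measurable_sum _ fun i _ => hX i
  have hYm (i) : Measurable (Y i) := Finset.measurable_sum _ fun i _ => hX i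
  have hTm (i) : Measurable (T i) := Finset.measurable_sum _ fun i _ => hX i
  have hQm : Measurable Q := Finset.measurable_sum _ fun i _ => (hX i).mul (hYm i)
  have hST (i ω) : T i ω = S ω - Y i ω :=
    eq_sub_of_add_eq' (Finset.sum_add_sum_compl (N i) fun j => X j ω)
  have hYb (i ω) : |Y i ω| ≤ D * b := by
    refine (Finset.abs_sum_le_sum_abs _ _).trans ((Finset.sum_le_sum fun j _ => hb j ω).trans ?_)
    rw [Finset.sum_const, nsmul_eq_mul]
    exact mul_le_mul_of_nonneg_right (hN i) hb0
  have hQb (ω) : |Q ω| ≤ ∑ _i : ι, b * (D * b) := by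
    refine (Finset.abs_sum_le_sum_abs _ _).trans (Finset.sum_le_sum fun i _ => ?_)
    rw [abs_mul]
    exact mul_le_mul (hb i ω) (hYb i ω) (abs_nonneg _) hb0
  -- The Taylor remainder of `e` between `t * S` and `t * T i`, weighted by the `i`-th variable.
  let r (i : ι) (ω : Ω) : ℂ := (X i ω * Complex.I) *
    (e (t * S ω) - e (t * T i ω) - (t * Y i ω * Complex.I) * e (t * S ω))
  have hrm (i) : Measurable (r i) := by fun_prop
  have hrb (i ω) : ‖r i ω‖ ≤ b * (3 * (D * b) ^ 2) := by
    have h1 : e (t * S ω) - e (t * T i ω) - (t * Y i ω * Complex.I) * e (t * S ω) =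
        -(e (t * S ω)) * (Complex.exp ((-(t * Y i ω) : ℝ) * Complex.I) - 1 -
          (-(t * Y i ω) : ℝ) * Complex.I) := by
      have : e (t * T i ω) = e (t * S ω) * Complex.exp ((-(t * Y i ω) : ℝ) * Complex.I) := by
        simp only [he]
        rw [← Complex.exp_add, hST]
        congr 1
        push_cast
        ring
      rw [this]
      push_cast
      ring
    simp only [r]
    rw [h1, norm_mul, norm_mul, norm_mul, norm_neg, hen, one_mul, Complex.norm_I, mul_one,
      Complex.norm_real, Real.norm_eq_abs]
    refine mul_le_mul (hb i ω) ((norm_cexp_mul_I_sub_one_sub_le _).trans ?_) (norm_nonneg _) hb0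
    have h2 : |t * Y i ω| ≤ D * b := by
      rw [abs_mul, abs_of_nonneg ht.1]
      exact (mul_le_of_le_one_left (abs_nonneg _) ht.2).trans (hYb i ω)
    rw [neg_sq, ← sq_abs]
    gcongr
  have hie : Integrable (fun ω => e (t * S ω)) μ :=
    Integrable.of_bound (by fun_prop : Measurable _).aestronglyMeasurable 1
      (ae_of_all _ fun ω => (hen _).le)
  have hir (i) : Integrable (r i) μ :=
    Integrable.of_bound (hrm i).aestronglyMeasurable _ (ae_of_all _ (hrb i))
  have hz (i) : ∫ ω, (X i ω * Complex.I) * e (t * T i ω) ∂μ = 0 := by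
    have h1 : IndepFun (fun ω => (X i ω : ℂ) * Complex.I) (fun ω => e (t * T i ω)) μ :=
      (hind i).comp (by fun_prop : Measurable fun x : ℝ => (x : ℂ) * Complex.I)
        (by fun_prop : Measurable fun x => e (t * x))
    rw [h1.integral_fun_mul_eq_mul_integral (by fun_prop) (by fun_prop), integral_mul_const,
      integral_complex_ofReal, h0]
    simp
  have hiz (i) : Integrable (fun ω => ((X i ω : ℂ) * Complex.I) * e (t * T i ω)) μ :=
    Integrable.of_bound (by fun_prop : Measurable _).aestronglyMeasurable b
      (ae_of_all _ fun ω => by simpa [hen] using hb i ω)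
  have hiQ : Integrable (fun ω => ((Q ω - v : ℝ) : ℂ) * e (t * S ω)) μ :=
    Integrable.of_bound (by fun_prop : Measurable _).aestronglyMeasurable
      ((∑ _i : ι, b * (D * b)) + |v|) (ae_of_all _ fun ω => by
        rw [norm_mul, hen, mul_one, Complex.norm_real, Real.norm_eq_abs]
        exact (abs_sub _ _).trans (add_le_add (hQb ω) le_rfl))
  have hdec : ∀ ω, ((S ω : ℝ) * Complex.I) * e (t * S ω) + t * v * e (t * S ω) =
      ∑ i, r i ω + ∑ i, (X i ω * Complex.I) * e (t * T i ω) -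
        t * (((Q ω - v : ℝ) : ℂ) * e (t * S ω)) := fun ω => by
    have h1 : ∀ i, r i ω + (X i ω * Complex.I) * e (t * T i ω) =
        (X i ω : ℂ) * (Complex.I * e (t * S ω)) +
          ((X i ω : ℂ) * Y i ω) * (t * e (t * S ω)) := fun i => by
      simp only [r]
      linear_combination (-((X i ω : ℂ) * Y i ω * t * e (t * S ω))) * Complex.I_sq
    rw [← Finset.sum_add_distrib, Finset.sum_congr rfl fun i _ => h1 i, Finset.sum_add_distrib,
      ← Finset.sum_mul, ← Finset.sum_mul]
    simp only [S, Q]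
    push_cast
    ring
  have hiS : Integrable (fun ω => ((S ω : ℝ) * Complex.I) * e (t * S ω)) μ :=
    Integrable.of_bound (by fun_prop : Measurable _).aestronglyMeasurable (∑ _i : ι, b)
      (ae_of_all _ fun ω => by
        rw [norm_mul, hen, norm_mul, Complex.norm_I, Complex.norm_real, mul_one, mul_one]
        exact (Finset.abs_sum_le_sum_abs _ _).trans (Finset.sum_le_sum fun i _ => hb i ω))
  change ‖∫ ω, ((S ω : ℝ) * Complex.I) * e (t * S ω) ∂μ + t * v * ∫ ω, e (t * S ω) ∂μ‖ ≤ _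
  rw [← integral_const_mul, ← integral_add hiS (hie.const_mul _)]
  simp only [hdec]
  have hiA : Integrable (fun ω => ∑ i, r i ω + ∑ i, ((X i ω : ℂ) * Complex.I) * e (t * T i ω)) μ :=
    (integrable_finsetSum _ fun i _ => hir i).add (integrable_finsetSum _ fun i _ => hiz i)
  rw [integral_sub hiA (hiQ.const_mul _), integral_add (integrable_finsetSum _ fun i _ => hir i)
      (integrable_finsetSum _ fun i _ => hiz i),
    integral_finsetSum _ fun i _ => hir i, integral_finsetSum _ fun i _ => hiz i,
    integral_const_mul]
  simp only [hz, Finset.sum_const_zero, add_zero]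
  have hA : ‖∑ i, ∫ ω, r i ω ∂μ‖ ≤ 3 * Fintype.card ι * D ^ 2 * b ^ 3 := by
    refine (norm_sum_le _ _).trans ((Finset.sum_le_sum
      (g := fun _ => b * (3 * (D * b) ^ 2)) fun i _ => ?_).trans ?_)
    · simpa using norm_integral_le_of_norm_le_const (μ := μ) (ae_of_all _ (hrb i))
    · rw [Finset.sum_const, Finset.card_univ, nsmul_eq_mul]
      exact le_of_eq (by ring)
  have hB : ‖(t : ℂ) * ∫ ω, ((Q ω - v : ℝ) : ℂ) * e (t * S ω) ∂μ‖ ≤ δ := by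
    rw [norm_mul, Complex.norm_real, Real.norm_eq_abs, abs_of_nonneg ht.1]
    refine (mul_le_of_le_one_left (norm_nonneg _) ht.2).trans ?_
    refine (norm_integral_le_integral_norm _).trans (le_of_eq_of_le ?_ hδ)
    refine integral_congr_ae (ae_of_all _ fun ω => ?_)
    beta_reduce
    rw [norm_mul, hen, mul_one, Complex.norm_real, Real.norm_eq_abs]
  refine (norm_sub_le _ _).trans ?_
  linarith

/-- Integrate the approximate differential equation over `[0, 1]`. The integrating factor is at most
`exp (v / 2)` there, and dividing by its value at `1` cancels this loss exactly. -/
theorem norm_integral_cexp_sub_le {D : ℝ} (hX : ∀ i, Measurable (X i))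
    (hb : ∀ i ω, |X i ω| ≤ b) (hb0 : 0 ≤ b) (h0 : ∀ i, ∫ ω, X i ω ∂μ = 0)
    (hN : ∀ i, ((N i).card : ℝ) ≤ D)
    (hind : ∀ i, IndepFun (X i) (fun ω => ∑ j ∈ (N i)ᶜ, X j ω) μ) {v δ : ℝ} (hv : 0 ≤ v)
    (hδ : ∫ ω, |∑ i, X i ω * ∑ j ∈ N i, X j ω - v| ∂μ ≤ δ) :
    ‖∫ ω, Complex.exp ((∑ i, X i ω : ℝ) * Complex.I) ∂μ - Complex.exp (-(v / 2 : ℝ))‖ ≤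
      δ + 3 * Fintype.card ι * D ^ 2 * b ^ 3 := by
  set ε := δ + 3 * Fintype.card ι * D ^ 2 * b ^ 3
  let S (ω : Ω) : ℝ := ∑ i, X i ω
  have hSm : Measurable S := Finset.measurable_sum _ fun i _ => hX i
  have hSb (ω) : |S ω| ≤ ∑ _i : ι, b :=
    (Finset.abs_sum_le_sum_abs _ _).trans (Finset.sum_le_sum fun i _ => hb i ω)
  let Φ (t : ℝ) : ℂ := ∫ ω, Complex.exp ((t * S ω : ℝ) * Complex.I) ∂μ
  let Φ' (t : ℝ) : ℂ := ∫ ω, ((S ω : ℝ) * Complex.I) * Complex.exp ((t * S ω : ℝ) * Complex.I) ∂μ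
  have hΦ (t : ℝ) : HasDerivAt Φ (Φ' t) t := by
    refine (hasDerivAt_integral_of_dominated_loc_of_deriv_le (μ := μ)
      (F := fun t ω => Complex.exp ((t * S ω : ℝ) * Complex.I))
      (F' := fun t ω => ((S ω : ℝ) * Complex.I) * Complex.exp ((t * S ω : ℝ) * Complex.I))
      (bound := fun _ => ∑ _i : ι, b) (s := Set.univ) Filter.univ_mem ?_ ?_ ?_ ?_ ?_ ?_).2
    · exact .of_forall fun t => (by fun_prop : Measurable _).aestronglyMeasurable
    · exact Integrable.of_bound (by fun_prop : Measurable _).aestronglyMeasurable 1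
        (ae_of_all _ fun ω => (Complex.norm_exp_ofReal_mul_I _).le)
    · exact (by fun_prop : Measurable _).aestronglyMeasurable
    · refine ae_of_all _ fun ω t _ => ?_
      rw [norm_mul, Complex.norm_exp_ofReal_mul_I, norm_mul, Complex.norm_I, Complex.norm_real,
        mul_one, mul_one]
      exact hSb ω
    · exact integrable_const _
    · refine ae_of_all _ fun ω t _ => ?_
      have h1 : HasDerivAt (fun t : ℝ => ((t * S ω : ℝ) : ℂ) * Complex.I)
          ((S ω : ℂ) * Complex.I) t := by
        have := ((hasDerivAt_id t).mul_const (S ω)).ofReal_comp.mul_const Complex.I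
        simpa using this
      have := h1.cexp
      rwa [mul_comm] at this
  -- Integrating factor of `φ' = -t v φ`.
  let G (t : ℝ) : ℂ := Complex.exp ((v * t ^ 2 / 2 : ℝ))
  have hG (t : ℝ) : HasDerivAt G (G t * (v * t)) t := by
    have h1 : HasDerivAt (fun t : ℝ => v * t ^ 2 / 2) (v * t) t := by
      have := ((hasDerivAt_pow 2 t).const_mul v).div_const 2
      refine this.congr_deriv ?_
      simp; ring
    have := h1.ofReal_comp.cexp
    rwa [Complex.ofReal_mul] at this
  have key := norm_image_sub_le_of_norm_deriv_le_segment_01' (f := fun t => Φ t * G t)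
    (f' := fun t => Φ' t * G t + Φ t * (G t * (v * t))) (C := ε * Real.exp (v / 2))
    (fun t _ => ((hΦ t).mul (hG t)).hasDerivWithinAt) (fun t ht => by
      have h1 : Φ' t * G t + Φ t * (G t * (v * t)) = (Φ' t + t * v * Φ t) * G t := by ring
      rw [h1, norm_mul]
      have h2 := norm_deriv_charFun_add_le hX hb hb0 h0 hN hind hδ ⟨ht.1, ht.2.le⟩
      refine mul_le_mul h2 ?_ (norm_nonneg _) ((norm_nonneg _).trans h2)
      simp only [G]
      rw [← Complex.ofReal_exp, Complex.norm_real, Real.norm_eq_abs, abs_of_pos (Real.exp_pos _)]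
      refine Real.exp_le_exp.2 ?_
      have : t ^ 2 ≤ 1 := by nlinarith [ht.1, ht.2]
      nlinarith)
  have h1 : Φ 0 * G 0 = 1 := by simp [Φ, G]
  have hG1 : G 1 = Complex.exp (v / 2 : ℝ) := by simp [G]
  have hΦ1 : Φ 1 = ∫ ω, Complex.exp ((∑ i, X i ω : ℝ) * Complex.I) ∂μ := by simp only [Φ, S, one_mul]
  rw [← hΦ1]
  have h2 : Φ 1 - Complex.exp (-(v / 2 : ℝ)) = (Φ 1 * G 1 - Φ 0 * G 0) * Complex.exp (-(v / 2 : ℝ)) := by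
    rw [h1, hG1, sub_mul, mul_assoc, ← Complex.exp_add]
    simp
  rw [h2, norm_mul]
  have h3 : ‖Complex.exp (-(v / 2 : ℝ))‖ = Real.exp (-(v / 2)) := by
    rw [← Complex.ofReal_neg, ← Complex.ofReal_exp, Complex.norm_real, Real.norm_eq_abs,
      abs_of_pos (Real.exp_pos _)]
  rw [h3]
  refine (mul_le_mul_of_nonneg_right key (Real.exp_pos _).le).trans ?_
  rw [mul_assoc, ← Real.exp_add]
  simp

end SteinTikhomirov

/-! ### Quantitative central limit theorem for sums of one function over the points. -/

section LinearStatistic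

theorem integral_abs_le_sqrt {Ω : Type*} [MeasurableSpace Ω] {μ : Measure Ω}
    [IsProbabilityMeasure μ] {f : Ω → ℝ} (hf : Measurable f) {C : ℝ} (hC : ∀ x, |f x| ≤ C) {K : ℝ}
    (hK : ∫ x, f x ^ 2 ∂μ ≤ K) : ∫ x, |f x| ∂μ ≤ √K := by
  refine Real.le_sqrt_of_sq_le (le_trans ?_ hK)
  set m := ∫ x, |f x| ∂μ with hm
  have hi1 : Integrable (fun x => |f x|) μ := (integrable_of_abs_le hf hC).abs
  have hi2 : Integrable (fun x => f x ^ 2) μ :=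
    integrable_of_abs_le (C := C ^ 2) (hf.pow_const 2) fun x => by
      rw [abs_pow]
      gcongr
      exact hC x
  have h : 0 ≤ ∫ x, (f x ^ 2 - 2 * m * |f x| + m ^ 2) ∂μ := integral_nonneg fun x => by
    have : f x ^ 2 - 2 * m * |f x| + m ^ 2 = (|f x| - m) ^ 2 := by rw [← sq_abs (f x)]; ring
    simp only [this]
    positivity
  have hi3 : Integrable (fun x => f x ^ 2 - 2 * m * |f x|) μ := hi2.sub (hi1.const_mul _)
  rw [integral_add hi3 (integrable_const _), integral_sub hi2 (hi1.const_mul _),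
    integral_const_mul, ← hm] at h
  simp at h
  nlinarith

variable {n : ℕ} (ρ : Equiv.Perm (Fin n)) {f : I × I → ℝ} {C : ℝ}

/-- The centred value of `f` at the `i`-th point. -/
noncomputable def centred (f : I × I → ℝ) (i : Fin n) (u : Fin n → I) : ℝ :=
  f (pts ρ u i) - ∫ z, f z ∂pairLaw ρ i

/-- The indices whose points share a coordinate with the `i`-th one. -/
def nbhd (i : Fin n) : Finset (Fin n) := Finset.univ.filter (Near ρ i)

/-- The coordinates used by the points in `nbhd ρ i`. -/
def nbhdCoords (i : Fin n) : Finset (Fin n) := (nbhd ρ i).biUnion fun j => {j, ρ j}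

variable {ρ}

theorem nbhd_eq_image (i : Fin n) :
    nbhd ρ i = Finset.univ.image fun c => stepPerm ρ c i := by
  ext j
  simp [nbhd, near_iff_exists_stepPerm, eq_comm]

theorem card_nbhd_le (i : Fin n) : (nbhd ρ i).card ≤ 3 := by
  rw [nbhd_eq_image]
  exact Finset.card_image_le.trans (by simp)

theorem measurable_centred (hf : Measurable f) (i : Fin n) : Measurable (centred ρ f i) :=
  (hf.comp (measurable_pts ρ i)).sub_const _

theorem abs_centred_le (hC : ∀ z, |f z| ≤ C) (i : Fin n) (u : Fin n → I) :
    |centred ρ f i u| ≤ 2 * C := by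
  have h1 : |∫ z, f z ∂pairLaw ρ i| ≤ C := abs_integral_le hC
  have := abs_sub (f (pts ρ u i)) (∫ z, f z ∂pairLaw ρ i)
  unfold centred
  linarith [hC (pts ρ u i)]

theorem integral_comp_pts (hf : Measurable f) (i : Fin n) :
    ∫ u : Fin n → I, f (pts ρ u i) = ∫ z, f z ∂pairLaw ρ i := by
  rw [← map_pts, integral_map (measurable_pts ρ i).aemeasurable hf.aestronglyMeasurable]

theorem integral_centred (hf : Measurable f) (hC : ∀ z, |f z| ≤ C) (i : Fin n) :
    ∫ u : Fin n → I, centred ρ f i u = 0 := by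
  have hi : Integrable (fun u : Fin n → I => f (pts ρ u i)) :=
    integrable_of_abs_le (hf.comp (measurable_pts ρ i)) fun u => hC _
  unfold centred
  rw [integral_sub hi (integrable_const _), integral_comp_pts hf]
  simp

theorem dependsOn_centred (i : Fin n) :
    DependsOn (centred ρ f i) (({i, ρ i} : Finset (Fin n)) : Set (Fin n)) := fun x y h => by
  have : pts ρ x i = pts ρ y i := dependsOn_pts ρ i h
  simp [centred, this]

theorem indepFun_centred_sum (hf : Measurable f) (i : Fin n) :
    IndepFun (centred ρ f i) (fun u => ∑ j ∈ (nbhd ρ i)ᶜ, centred ρ f j u)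
      (volume : Measure (Fin n → I)) := by
  refine indepFun_of_dependsOn _ (measurable_centred hf i)
    (Finset.measurable_sum _ fun j _ => measurable_centred hf j) (dependsOn_centred i)
    (B := ((nbhd ρ i)ᶜ).biUnion fun j => {j, ρ j}) (fun x y h => ?_) ?_
  · exact Finset.sum_congr rfl fun j hj => dependsOn_centred j fun l hl =>
      h l (Finset.mem_biUnion.2 ⟨j, hj, hl⟩)
  · rw [Finset.disjoint_biUnion_right]
    exact fun j hj => disjoint_of_not_near (by simpa [nbhd] using hj)

/-- The product of the `i`-th centred value with the sum of its neighbours. -/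
noncomputable def localProd (ρ : Equiv.Perm (Fin n)) (f : I × I → ℝ) (i : Fin n) (u : Fin n → I) :
    ℝ :=
  centred ρ f i u * ∑ j ∈ nbhd ρ i, centred ρ f j u

theorem measurable_localProd (hf : Measurable f) (i : Fin n) : Measurable (localProd ρ f i) :=
  (measurable_centred hf i).mul (Finset.measurable_sum _ fun j _ => measurable_centred hf j)

theorem abs_localProd_le (hC : ∀ z, |f z| ≤ C) (i : Fin n) (u : Fin n → I) :
    |localProd ρ f i u| ≤ 12 * C ^ 2 := by
  have hC0 : 0 ≤ C := (abs_nonneg _).trans (hC 0)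
  have h1 : |∑ j ∈ nbhd ρ i, centred ρ f j u| ≤ 6 * C := by
    refine (Finset.abs_sum_le_sum_abs _ _).trans
      ((Finset.sum_le_sum fun j _ => abs_centred_le hC j u).trans ?_)
    rw [Finset.sum_const, nsmul_eq_mul]
    have : ((nbhd ρ i).card : ℝ) ≤ 3 := by exact_mod_cast card_nbhd_le i
    nlinarith
  rw [localProd, abs_mul]
  refine (mul_le_mul (abs_centred_le hC i u) h1 (abs_nonneg _) (by positivity)).trans
    (le_of_eq (by ring))

theorem dependsOn_localProd (i : Fin n) : DependsOn (localProd ρ f i) (nbhdCoords ρ i) := by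
  intro x y h
  have h1 : ∀ j ∈ nbhd ρ i, centred ρ f j x = centred ρ f j y := fun j hj =>
    dependsOn_centred j fun l hl => h l (Finset.mem_biUnion.2 ⟨j, hj, hl⟩)
  rw [localProd, localProd, Finset.sum_congr rfl h1,
    h1 i (Finset.mem_filter.2 ⟨Finset.mem_univ _, Near.refl ρ i⟩)]

/-- If the neighbourhoods share a coordinate, then `j` is reached from `i` by three `Near` steps,
each with three possibilities. -/
theorem card_not_disjoint_nbhdCoords_le :
    (Finset.univ.filter fun p : Fin n × Fin n =>
      ¬ Disjoint (nbhdCoords ρ p.1) (nbhdCoords ρ p.2)).card ≤ 27 * n := by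
  have hsub : (Finset.univ.filter fun p : Fin n × Fin n =>
      ¬ Disjoint (nbhdCoords ρ p.1) (nbhdCoords ρ p.2)) ⊆
      (Finset.univ : Finset ((Fin 3 × Fin 3 × Fin 3) × Fin n)).image fun q =>
        (q.2, stepPerm ρ q.1.1 (stepPerm ρ q.1.2.1 (stepPerm ρ q.1.2.2 q.2))) := by
    rintro ⟨i, j⟩ h
    have h1 := (Finset.mem_filter.1 h).2
    simp only [nbhdCoords, Finset.disjoint_biUnion_left, Finset.disjoint_biUnion_right] at h1
    push Not at h1
    obtain ⟨j', hj', i', hi', h2⟩ := h1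
    have h3 : Near ρ i' j' := by
      by_contra hn
      exact h2 (disjoint_of_not_near hn)
    simp only [nbhd, Finset.mem_filter, Finset.mem_univ, true_and] at hi' hj'
    obtain ⟨a, ha⟩ := near_iff_exists_stepPerm.1 hi'
    obtain ⟨b, hb⟩ := near_iff_exists_stepPerm.1 h3
    obtain ⟨c, hc⟩ := near_iff_exists_stepPerm.1 hj'.symm
    exact Finset.mem_image.2 ⟨((c, b, a), i), Finset.mem_univ _, by rw [hc, hb, ha]⟩
  refine (Finset.card_le_card hsub).trans (Finset.card_image_le.trans ?_)
  simp

/-- Concentration of the local products: all but `27 * n` pairs are independent, and each centred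
local product is bounded by `24 * C ^ 2`. -/
theorem integral_sq_sum_localProd_sub_le (hf : Measurable f) (hC : ∀ z, |f z| ≤ C) :
    ∫ u : Fin n → I, (∑ i, (localProd ρ f i u - ∫ u', localProd ρ f i u')) ^ 2 ≤
      27 * n * (24 * C ^ 2) ^ 2 := by
  let W (i : Fin n) (u : Fin n → I) : ℝ := localProd ρ f i u - ∫ u', localProd ρ f i u'
  have hWm (i) : Measurable (W i) := (measurable_localProd hf i).sub_const _
  have hWb (i u) : |W i u| ≤ 24 * C ^ 2 := by
    have h1 : |∫ u', localProd ρ f i u'| ≤ 12 * C ^ 2 := abs_integral_le (abs_localProd_le hC i)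
    have := abs_sub (localProd ρ f i u) (∫ u', localProd ρ f i u')
    have := abs_localProd_le (ρ := ρ) hC i u
    simp only [W]
    linarith
  have hW0 (i) : ∫ u, W i u = 0 := by
    simp only [W]
    rw [integral_sub (integrable_of_abs_le (measurable_localProd hf i) (abs_localProd_le hC i))
      (integrable_const _)]
    simp
  have hWd (i) : DependsOn (W i) (nbhdCoords ρ i) := fun x y h => by
    simp only [W, dependsOn_localProd i h]
  have hWW (i j u) : |W i u * W j u| ≤ (24 * C ^ 2) ^ 2 := by
    rw [abs_mul, sq]
    exact mul_le_mul (hWb i u) (hWb j u) (abs_nonneg _) (by positivity)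
  have hterm (p : Fin n × Fin n) : ∫ u, W p.1 u * W p.2 u ≤
      if Disjoint (nbhdCoords ρ p.1) (nbhdCoords ρ p.2) then 0 else (24 * C ^ 2) ^ 2 := by
    split_ifs with h
    swap
    · exact (le_abs_self _).trans (abs_integral_le (hWW _ _))
    · have hind : IndepFun (W p.1) (W p.2) (volume : Measure (Fin n → I)) :=
        indepFun_of_dependsOn _ (hWm _) (hWm _) (hWd _) (hWd _) h
      rw [hind.integral_fun_mul_eq_mul_integral (hWm _).aestronglyMeasurable
        (hWm _).aestronglyMeasurable, hW0, zero_mul]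
  have hsq : ∀ u, (∑ i, W i u) ^ 2 = ∑ p : Fin n × Fin n, W p.1 u * W p.2 u := fun u => by
    rw [sq, Finset.sum_mul_sum, ← Finset.sum_product', Finset.univ_product_univ]
  change ∫ u, (∑ i, W i u) ^ 2 ≤ _
  simp only [hsq]
  have hi (p : Fin n × Fin n) : Integrable (fun u => W p.1 u * W p.2 u) :=
    integrable_of_abs_le ((hWm _).mul (hWm _)) (hWW _ _)
  rw [integral_finsetSum _ fun p _ => hi p]
  refine (Finset.sum_le_sum fun p _ => hterm p).trans ?_
  simp only [← ite_not (p := Disjoint _ _)]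
  rw [← Finset.sum_filter, Finset.sum_const, nsmul_eq_mul]
  refine mul_le_mul_of_nonneg_right ?_ (by positivity)
  exact_mod_cast card_not_disjoint_nbhdCoords_le (ρ := ρ)

/-- Apply the Stein–Tikhomirov bound to variables bounded by `2 * C / √n` with neighbourhoods of at
most three elements: the Taylor term is `3 * n * 9 * (2C) ^ 3 / n ^ (3/2)`, and `δ` is the standard
deviation bound of `integral_sq_sum_localProd_sub_le` divided by `n`. -/
theorem norm_integral_cexp_centred_sub_le (hn : n ≠ 0) (hf : Measurable f)
    (hC : ∀ z, |f z| ≤ C) :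
    ‖(∫ u : Fin n → I, Complex.exp (((√n)⁻¹ * ∑ i, centred ρ f i u : ℝ) * Complex.I)) -
      Complex.exp (-(((n : ℝ)⁻¹ * ∑ i, ∑ j ∈ nbhd ρ i,
        ∫ u : Fin n → I, centred ρ f i u * centred ρ f j u) / 2 : ℝ))‖ ≤
      (24 * √27 * C ^ 2 + 216 * C ^ 3) * (√n)⁻¹ := by
  have hC0 : 0 ≤ C := (abs_nonneg _).trans (hC 0)
  have hn0 : (0 : ℝ) < n := by positivity
  set s := (√n)⁻¹ with hs
  have hs0 : 0 < s := by positivity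
  have hs2 : s ^ 2 = (n : ℝ)⁻¹ := by rw [hs, inv_pow, Real.sq_sqrt hn0.le]
  have hns : n * s ^ 2 = 1 := by rw [hs2]; field_simp
  let X (i : Fin n) (u : Fin n → I) : ℝ := s * centred ρ f i u
  have hX (i) : Measurable (X i) := (measurable_centred hf i).const_mul s
  have hb (i u) : |X i u| ≤ s * (2 * C) := by
    rw [abs_mul, abs_of_pos hs0]
    exact mul_le_mul_of_nonneg_left (abs_centred_le hC i u) hs0.le
  have h0 (i) : ∫ u, X i u = 0 := by
    simp only [X]
    rw [integral_const_mul, integral_centred hf hC, mul_zero]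
  have hN (i) : ((nbhd ρ i).card : ℝ) ≤ 3 := by exact_mod_cast card_nbhd_le i
  have hind (i) : IndepFun (X i) (fun u => ∑ j ∈ (nbhd ρ i)ᶜ, X j u)
      (volume : Measure (Fin n → I)) := by
    simp only [X, ← Finset.mul_sum]
    exact (indepFun_centred_sum hf i).comp (measurable_const_mul s) (measurable_const_mul s)
  have hQ (u) : ∑ i, X i u * ∑ j ∈ nbhd ρ i, X j u = s ^ 2 * ∑ i, localProd ρ f i u := by
    rw [Finset.mul_sum]
    refine Finset.sum_congr rfl fun i _ => ?_
    simp only [X, localProd, ← Finset.mul_sum]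
    ring
  have hcc (i j : Fin n) (u : Fin n → I) : |centred ρ f i u * centred ρ f j u| ≤
      (2 * C) * (2 * C) := by
    rw [abs_mul]
    exact mul_le_mul (abs_centred_le hC i u) (abs_centred_le hC j u) (abs_nonneg _)
      (by positivity)
  have hint (i) : ∫ u, localProd ρ f i u =
      ∑ j ∈ nbhd ρ i, ∫ u : Fin n → I, centred ρ f i u * centred ρ f j u := by
    simp only [localProd, Finset.mul_sum]
    exact integral_finsetSum _ fun j _ => integrable_of_abs_le
      ((measurable_centred hf i).mul (measurable_centred hf j)) (hcc i j)
  set v := (n : ℝ)⁻¹ * ∑ i, ∑ j ∈ nbhd ρ i,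
    ∫ u : Fin n → I, centred ρ f i u * centred ρ f j u with hv
  have hvQ : v = ∫ u, ∑ i, X i u * ∑ j ∈ nbhd ρ i, X j u := by
    simp only [hQ]
    rw [integral_const_mul, integral_finsetSum _ fun i _ =>
      integrable_of_abs_le (measurable_localProd hf i) (abs_localProd_le hC i)]
    simp only [hint]
    rw [hv, hs2]
  have hv0 : 0 ≤ v := by
    rw [hvQ, ← integral_sq_sum_eq hX hb h0 hind]
    exact integral_nonneg fun u => sq_nonneg _
  have hδ : ∫ u, |∑ i, X i u * ∑ j ∈ nbhd ρ i, X j u - v| ≤ 24 * √27 * C ^ 2 * s := by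
    have h1 : ∀ u, ∑ i, X i u * ∑ j ∈ nbhd ρ i, X j u - v =
        s ^ 2 * ∑ i, (localProd ρ f i u - ∫ u', localProd ρ f i u') := fun u => by
      simp only [hQ, Finset.sum_sub_distrib, hint]
      rw [mul_sub, hv, hs2]
    simp only [h1, abs_mul, abs_of_pos (pow_pos hs0 2)]
    rw [integral_const_mul]
    have h2 := integral_abs_le_sqrt (μ := (volume : Measure (Fin n → I)))
      (f := fun u => ∑ i, (localProd ρ f i u - ∫ u', localProd ρ f i u'))
      (Finset.measurable_sum _ fun i _ => (measurable_localProd hf i).sub_const _)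
      (C := ∑ _i : Fin n, 24 * C ^ 2) (fun u => by
        refine (Finset.abs_sum_le_sum_abs _ _).trans (Finset.sum_le_sum fun i _ => ?_)
        have h1 : |∫ u', localProd ρ f i u'| ≤ 12 * C ^ 2 :=
          abs_integral_le (abs_localProd_le hC i)
        have := abs_sub (localProd ρ f i u) (∫ u', localProd ρ f i u')
        have := abs_localProd_le (ρ := ρ) hC i u
        linarith) (integral_sq_sum_localProd_sub_le hf hC)
    refine (mul_le_mul_of_nonneg_left h2 (by positivity)).trans (le_of_eq ?_)
    rw [Real.sqrt_mul (by positivity), Real.sqrt_sq (by positivity), Real.sqrt_mul (by norm_num)]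
    have : s ^ 2 * √n = s := by
      rw [hs]; field_simp
    linear_combination (24 * √27 * C ^ 2) * this
  have key := norm_integral_cexp_sub_le hX hb (by positivity) h0 hN hind hv0 hδ
  simp only [X, ← Finset.mul_sum] at key
  refine key.trans (le_of_eq ?_)
  rw [Fintype.card_fin]
  linear_combination (216 * C ^ 3 * s) * hns

end LinearStatistic

/-! ### The variance of the linear part in terms of cycle counts. -/

section LimitVariance

theorem covariance_comp_measurePreserving {Ω E : Type*} [MeasurableSpace Ω] [MeasurableSpace E]
    {μ : Measure Ω} {κ : Measure E} {Z : Ω → E} (hZ : MeasurePreserving Z μ κ) {X Y : E → ℝ}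
    (hX : Measurable X) (hY : Measurable Y) :
    cov[fun ω => X (Z ω), fun ω => Y (Z ω); μ] = cov[X, Y; κ] := by
  rw [← hZ.map_eq, covariance_map_fun hX.aestronglyMeasurable hY.aestronglyMeasurable
    hZ.measurable.aemeasurable]

/-- The covariance of two functions of three independent uniform variables. -/
noncomputable def cubeCov (X Y : I × I × I → ℝ) : ℝ := cov[X, Y; volume]

theorem measurePreserving_cube_fst :
    MeasurePreserving (fun ω : I × I × I => ω.1) volume volume :=
  measurePreserving_fst

theorem measurePreserving_cube_pair :
    MeasurePreserving (fun ω : I × I × I => (ω.1, ω.2.1)) volume volume :=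
  (MeasurePreserving.id _).prod measurePreserving_fst

variable {n : ℕ} {ρ : Equiv.Perm (Fin n)} {f : I × I → ℝ} {C : ℝ}

theorem integral_centred_mul (hf : Measurable f) (i j : Fin n) :
    ∫ u : Fin n → I, centred ρ f i u * centred ρ f j u =
      cov[fun u : Fin n → I => f (pts ρ u i), fun u => f (pts ρ u j); volume] := by
  rw [covariance, integral_comp_pts hf, integral_comp_pts hf]
  rfl

theorem cov_pts_fixed (hf : Measurable f) {i : Fin n} (h : ρ i = i) :
    cov[fun u : Fin n → I => f (pts ρ u i), fun u => f (pts ρ u i); volume] =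
      cubeCov (fun ω => f (ω.1, ω.1)) (fun ω => f (ω.1, ω.1)) := by
  have hm : Measurable fun x : I => f (x, x) := by fun_prop
  have h1 := covariance_comp_measurePreserving
    (measurePreserving_eval (fun _ : Fin n => (volume : Measure I)) i) hm hm
  have h2 := covariance_comp_measurePreserving measurePreserving_cube_fst hm hm
  simp only [pts, h]
  exact h1.trans h2.symm

theorem cov_pts_self (hf : Measurable f) {i : Fin n} (h : ρ i ≠ i) :
    cov[fun u : Fin n → I => f (pts ρ u i), fun u => f (pts ρ u i); volume] =
      cubeCov (fun ω => f (ω.1, ω.2.1)) (fun ω => f (ω.1, ω.2.1)) := by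
  have h1 := covariance_comp_measurePreserving (Z := fun u : Fin n → I => (u i, u (ρ i)))
    ⟨by fun_prop, map_pair_apply (Ne.symm h)⟩ hf hf
  exact h1.trans (covariance_comp_measurePreserving measurePreserving_cube_pair hf hf).symm

theorem cov_pts_swap (hf : Measurable f) {i : Fin n} (h : ρ i ≠ i) (h2 : ρ (ρ i) = i) :
    cov[fun u : Fin n → I => f (pts ρ u i), fun u => f (pts ρ u (ρ i)); volume] =
      cubeCov (fun ω => f (ω.1, ω.2.1)) (fun ω => f (ω.2.1, ω.1)) := by
  have hm : Measurable fun z : I × I => f (z.2, z.1) := by fun_prop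
  have h1 := covariance_comp_measurePreserving (Z := fun u : Fin n → I => (u i, u (ρ i)))
    ⟨by fun_prop, map_pair_apply (Ne.symm h)⟩ hf hm
  simp only [pts, h2]
  exact h1.trans (covariance_comp_measurePreserving measurePreserving_cube_pair hf hm).symm

theorem cov_pts_next (hf : Measurable f) {i : Fin n} (h : ρ i ≠ i) (h2 : ρ (ρ i) ≠ i) :
    cov[fun u : Fin n → I => f (pts ρ u i), fun u => f (pts ρ u (ρ i)); volume] =
      cubeCov (fun ω => f (ω.1, ω.2.1)) (fun ω => f (ω.2.1, ω.2.2)) :=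
  covariance_comp_measurePreserving (Z := fun u : Fin n → I => (u i, u (ρ i), u (ρ (ρ i))))
    ⟨by fun_prop, map_triple_apply (Ne.symm h) (Ne.symm h2) fun he => h (ρ.injective he).symm⟩
    (X := fun ω : I × I × I => f (ω.1, ω.2.1)) (Y := fun ω => f (ω.2.1, ω.2.2))
    (by fun_prop) (by fun_prop)

/-- The neighbourhood of `i` has one, two or three elements according to whether its cycle has
length one, two or more; in a 2-cycle the successor and the predecessor coincide. -/
theorem sum_nbhd_integral_centred (hf : Measurable f) (i : Fin n) :
    ∑ j ∈ nbhd ρ i, ∫ u : Fin n → I, centred ρ f i u * centred ρ f j u =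
      if ρ i = i then cubeCov (fun ω => f (ω.1, ω.1)) (fun ω => f (ω.1, ω.1))
      else if ρ (ρ i) = i then
        cubeCov (fun ω => f (ω.1, ω.2.1)) (fun ω => f (ω.1, ω.2.1)) +
          cubeCov (fun ω => f (ω.1, ω.2.1)) (fun ω => f (ω.2.1, ω.1))
      else cubeCov (fun ω => f (ω.1, ω.2.1)) (fun ω => f (ω.1, ω.2.1)) +
          2 * cubeCov (fun ω => f (ω.1, ω.2.1)) (fun ω => f (ω.2.1, ω.2.2)) := by
  simp only [integral_centred_mul hf]
  split_ifs with h h2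
  · have : nbhd ρ i = {i} := by
      ext j
      simp only [nbhd, Finset.mem_filter, Finset.mem_univ, true_and, Finset.mem_singleton, Near, h]
      refine ⟨?_, fun hj => Or.inl hj⟩
      rintro (hj | hj | hj)
      · exact hj
      · exact hj
      · exact ρ.injective (hj.symm.trans h.symm)
    rw [this, Finset.sum_singleton, cov_pts_fixed hf h]
  · have : nbhd ρ i = {i, ρ i} := by
      ext j
      simp only [nbhd, Finset.mem_filter, Finset.mem_univ, true_and, Finset.mem_singleton,
        Finset.mem_insert, Near]
      refine ⟨?_, by tauto⟩
      rintro (hj | hj | hj)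
      · exact Or.inl hj
      · exact Or.inr hj
      · exact Or.inr (ρ.injective (hj.symm.trans h2.symm))
    rw [this, Finset.sum_pair (Ne.symm h), cov_pts_self hf h, cov_pts_swap hf h h2]
  · have h3 : ρ (ρ⁻¹ i) = i := ρ.apply_symm_apply i
    have : nbhd ρ i = {i, ρ i, ρ⁻¹ i} := by
      ext j
      simp only [nbhd, Finset.mem_filter, Finset.mem_univ, true_and, Finset.mem_singleton,
        Finset.mem_insert, Near]
      refine or_congr_right (or_congr_right ⟨fun hj => ?_, fun hj => ?_⟩)
      · exact ρ.injective (hj.symm.trans h3.symm)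
      · rw [hj, h3]
    have e1 : i ≠ ρ⁻¹ i := fun he => h (by rw [← he] at h3; exact h3)
    have e2 : ρ i ≠ ρ⁻¹ i := fun he => h2 (by rw [he, h3])
    rw [this, Finset.sum_insert (by
      rw [Finset.mem_insert, Finset.mem_singleton]; push Not; exact ⟨Ne.symm h, e1⟩), Finset.sum_pair e2, cov_pts_self hf h,
      cov_pts_next hf h h2]
    -- By symmetry the covariance with the predecessor is the successor covariance taken at `ρ⁻¹ i`,
    -- whence the factor two.
    have h4 := cov_pts_next (ρ := ρ) hf (i := ρ⁻¹ i) (by rwa [h3]) (by rwa [h3])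
    rw [h3, covariance_comm] at h4
    rw [h4]
    ring

/-- The right-hand side does not involve `ρ`: all permutations of the class give the same variance.
-/
theorem sum_sum_nbhd_integral_centred (hf : Measurable f) {t : n.Partition}
    (hρ : ρ ∈ cyclicClass t) :
    ∑ i, ∑ j ∈ nbhd ρ i, ∫ u : Fin n → I, centred ρ f i u * centred ρ f j u =
      numCycles t 1 * cubeCov (fun ω => f (ω.1, ω.1)) (fun ω => f (ω.1, ω.1)) +
      2 * numCycles t 2 * (cubeCov (fun ω => f (ω.1, ω.2.1)) (fun ω => f (ω.1, ω.2.1)) +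
          cubeCov (fun ω => f (ω.1, ω.2.1)) (fun ω => f (ω.2.1, ω.1))) +
      (n - numCycles t 1 - 2 * numCycles t 2) *
        (cubeCov (fun ω => f (ω.1, ω.2.1)) (fun ω => f (ω.1, ω.2.1)) +
          2 * cubeCov (fun ω => f (ω.1, ω.2.1)) (fun ω => f (ω.2.1, ω.2.2))) := by
  simp only [sum_nbhd_integral_centred hf]
  set A := cubeCov (fun ω => f (ω.1, ω.1)) (fun ω => f (ω.1, ω.1))
  set B := cubeCov (fun ω => f (ω.1, ω.2.1)) (fun ω => f (ω.1, ω.2.1)) +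
    cubeCov (fun ω => f (ω.1, ω.2.1)) (fun ω => f (ω.2.1, ω.1))
  set D := cubeCov (fun ω => f (ω.1, ω.2.1)) (fun ω => f (ω.1, ω.2.1)) +
    2 * cubeCov (fun ω => f (ω.1, ω.2.1)) (fun ω => f (ω.2.1, ω.2.2))
  have h1 : ∀ i, (if ρ i = i then A else if ρ (ρ i) = i then B else D) =
      (if ρ i = i then 1 else 0) * (A - D) +
        (if ρ i ≠ i ∧ ρ (ρ i) = i then 1 else 0) * (B - D) + D := fun i => by
    by_cases h : ρ i = i
    · simp [h]
    · by_cases h2 : ρ (ρ i) = i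
      · simp [h, h2]
      · simp [h, h2]
  simp only [h1]
  rw [Finset.sum_add_distrib, Finset.sum_add_distrib, ← Finset.sum_mul, ← Finset.sum_mul,
    Finset.sum_boole, Finset.sum_boole, card_fixedPoints_of_mem_cyclicClass hρ,
    card_twoCyclePoints_of_mem_cyclicClass hρ]
  simp
  ring

theorem cubeCov_sum_mul {ι : Type*} [Fintype ι] (θ η : ι → ℝ) {X Y : ι → I × I × I → ℝ}
    (hX : ∀ i, Measurable (X i)) (hY : ∀ i, Measurable (Y i)) (hXb : ∀ i ω, |X i ω| ≤ C)
    (hYb : ∀ i ω, |Y i ω| ≤ C) :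
    cubeCov (fun ω => ∑ i, θ i * X i ω) (fun ω => ∑ i, η i * Y i ω) =
      ∑ i, ∑ j, θ i * η j * cubeCov (X i) (Y j) := by
  have h1 (i) : MemLp (fun ω => θ i * X i ω) 2 (volume : Measure (I × I × I)) :=
    (MemLp.of_bound (hX i).aestronglyMeasurable C (ae_of_all _ (hXb i))).const_mul _
  have h2 (i) : MemLp (fun ω => η i * Y i ω) 2 (volume : Measure (I × I × I)) :=
    (MemLp.of_bound (hY i).aestronglyMeasurable C (ae_of_all _ (hYb i))).const_mul _
  unfold cubeCov
  rw [covariance_fun_sum_fun_sum h1 h2]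
  simp only [covariance_const_mul_left, covariance_const_mul_right]
  refine Finset.sum_congr rfl fun i _ => Finset.sum_congr rfl fun j _ => by ring

end LimitVariance

/-! ### First-order projections of pattern indicators and the limiting quadratic form. -/

section PatternProjection

theorem integral_perm_eq_sum {r : ℕ} {Ω : Type*} [MeasurableSpace Ω] {μ : Measure Ω}
    [IsProbabilityMeasure μ] {Z : Ω → Fin r → I × I} (hZ : Measurable Z)
    (θ : Equiv.Perm (Fin r) → ℝ) :
    ∫ ω, θ (permOfPoints (Z ω)) ∂μ = ∑ π, θ π * μ.real {ω | permOfPoints (Z ω) = π} := by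
  have hm : Measurable fun ω => permOfPoints (Z ω) := measurable_permOfPoints.comp hZ
  have := Measure.isProbabilityMeasure_map (μ := μ) hm.aemeasurable
  have h1 : ∫ ω, θ (permOfPoints (Z ω)) ∂μ = ∫ π, θ π ∂(μ.map fun ω => permOfPoints (Z ω)) :=
    (integral_map hm.aemeasurable (measurable_from_top (f := θ)).aestronglyMeasurable).symm
  rw [h1, integral_fintype (Integrable.of_finite)]
  refine Finset.sum_congr rfl fun π _ => ?_
  rw [map_measureReal_apply hm (MeasurableSpace.measurableSet_top), smul_eq_mul, mul_comm]
  rfl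

theorem measurePreserving_castSucc {s : ℕ} {E : Type*} [MeasurableSpace E] (μ : Measure E)
    [IsProbabilityMeasure μ] :
    MeasurePreserving (fun (y : Fin (s + 1) → E) (i : Fin s) => y i.castSucc)
      (Measure.pi fun _ => μ) (Measure.pi fun _ => μ) := by
  have hm : Measurable fun (y : Fin (s + 1) → E) (i : Fin s) => y i.castSucc := by fun_prop
  refine ⟨hm, ?_⟩
  symm
  refine Measure.pi_eq fun S hS => ?_
  rw [Measure.map_apply hm (.univ_pi hS)]
  have : (fun (y : Fin (s + 1) → E) (i : Fin s) => y i.castSucc) ⁻¹' Set.univ.pi S =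
      Set.univ.pi (Fin.snoc (α := fun _ => Set E) S Set.univ) := by
    ext y
    simp [Fin.forall_fin_succ']
  rw [this, Measure.pi_pi, Fin.prod_univ_castSucc]
  simp

variable {s : ℕ} {p : ℝ}

/-- The last of the `s + 1` random points is overwritten by `z`, so adding it changes nothing; `psi`
thus becomes a projection in the sense of `proj`. -/
theorem psi_eq_measureReal (hp : p ∈ Set.Icc (0 : ℝ) 1) (π : Equiv.Perm (Fin (s + 1)))
    (z : I × I) :
    psi p π z = (Measure.pi fun _ : Fin (s + 1) => pointLaw p).real
      {y | permOfPoints (Function.update y (Fin.last s) z) = π} := by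
  have := isProbabilityMeasure_pointLaw hp
  let e (Z : Fin s → I × I) (i : Fin (s + 1)) : I × I := if h : i.val < s then Z ⟨i.val, h⟩ else z
  have he : Measurable e := by
    refine measurable_pi_lambda _ fun i => ?_
    by_cases h : i.val < s
    · simpa [e, h] using measurable_pi_apply _
    · simp [e, h]
  have h1 : psi p π z = (Measure.pi fun _ : Fin s => pointLaw p).real
    {Z | permOfPoints (e Z) = π} := rfl
  have hS : MeasurableSet {Z | permOfPoints (e Z) = π} :=
    (measurable_permOfPoints.comp he) (MeasurableSpace.measurableSet_top (s := {π}))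
  rw [h1, ← (measurePreserving_castSucc (s := s) (pointLaw p)).measureReal_preimage
    hS.nullMeasurableSet]
  congr 1
  ext y
  have : e (fun i => y i.castSucc) = Function.update y (Fin.last s) z := by
    ext1 i
    refine Fin.lastCases ?_ (fun j => ?_) i
    · simp [e]
    · simp only [e, Fin.val_castSucc, j.isLt, dite_true]
      rw [Function.update_of_ne (Fin.castSucc_lt_last j).ne]
  simp only [Set.mem_preimage, Set.mem_ofPred_eq, this]

theorem proj_last_eq_sum_psi (hp : p ∈ Set.Icc (0 : ℝ) 1) (θ : Equiv.Perm (Fin (s + 1)) → ℝ)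
    (z : I × I) :
    proj p (fun y => θ (permOfPoints y)) (Fin.last s) z = ∑ π, θ π * psi p π z := by
  have := isProbabilityMeasure_pointLaw hp
  simp only [psi_eq_measureReal hp]
  exact integral_perm_eq_sum
    (by fun_prop : Measurable fun y : Fin (s + 1) → I × I => Function.update y (Fin.last s) z) θ

theorem integral_eq_sum_patternMean {r : ℕ} (hp : p ∈ Set.Icc (0 : ℝ) 1)
    (θ : Equiv.Perm (Fin r) → ℝ) :
    ∫ y, θ (permOfPoints y) ∂Measure.pi (fun _ : Fin r => pointLaw p) =
      ∑ π, θ π * patternMean p π := by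
  have := isProbabilityMeasure_pointLaw hp
  exact integral_perm_eq_sum measurable_id θ

theorem measurePreserving_comp_perm {r : ℕ} {E : Type*} [MeasurableSpace E] (μ : Measure E)
    [IsProbabilityMeasure μ] (e : Equiv.Perm (Fin r)) :
    MeasurePreserving (fun y : Fin r → E => y ∘ e) (Measure.pi fun _ => μ)
      (Measure.pi fun _ => μ) := by
  have hm : Measurable fun y : Fin r → E => y ∘ e :=
    measurable_pi_lambda _ fun i => measurable_pi_apply _
  refine ⟨hm, ?_⟩
  symm
  refine Measure.pi_eq fun S hS => ?_
  rw [Measure.map_apply hm (.univ_pi hS)]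
  have : (fun y : Fin r → E => y ∘ e) ⁻¹' Set.univ.pi S = Set.univ.pi (S ∘ e.symm) := by
    ext y
    simp only [Set.mem_preimage, Set.mem_univ_pi, Function.comp_apply]
    exact e.forall_congr fun i => by simp
  rw [this, Measure.pi_pi]
  exact Fintype.prod_equiv e.symm _ _ fun i => rfl

/-- The slots are exchangeable, because the points are i.i.d. and the pattern almost surely ignores
their labelling. All `s + 1` projections are therefore the same function. -/
theorem proj_eq_proj_last (hp : p ∈ Set.Icc (0 : ℝ) 1) (θ : Equiv.Perm (Fin (s + 1)) → ℝ)
    (a : Fin (s + 1)) (z : I × I) :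
    proj p (fun y => θ (permOfPoints y)) a z =
      proj p (fun y => θ (permOfPoints y)) (Fin.last s) z := by
  have := isProbabilityMeasure_pointLaw hp
  let e := Equiv.swap a (Fin.last s)
  have hθ : Measurable fun y : Fin (s + 1) → I × I => θ (permOfPoints y) :=
    (measurable_from_top (f := θ)).comp measurable_permOfPoints
  have hu : Measurable fun y : Fin (s + 1) → I × I => Function.update y a z := by fun_prop
  unfold proj
  have hmp := measurePreserving_comp_perm (pointLaw p) e
  have h1 : ∫ y, θ (permOfPoints (Function.update y a z)) ∂Measure.pi (fun _ => pointLaw p) =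
      ∫ y : Fin (s + 1) → I × I, θ (permOfPoints (Function.update (y ∘ e) a z))
        ∂Measure.pi (fun _ => pointLaw p) := by
    conv_lhs => rw [← hmp.map_eq]
    exact integral_map hmp.measurable.aemeasurable (hθ.comp hu).aestronglyMeasurable
  rw [h1]
  refine integral_congr_ae ?_
  filter_upwards [ae_injective_update_fst hp (Fin.last s) z] with y hy
  have h2 : Function.update (y ∘ e) a z = Function.update y (Fin.last s) z ∘ e := by
    ext1 i
    by_cases h : i = a
    · subst h; simp [e]
    · have : e i ≠ Fin.last s := fun he => h (by
        rw [← e.symm_apply_apply i, he]; simp [e])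
      simp [h, this]
  rw [h2, permOfPoints_comp_perm hy]

theorem measurable_psi (hp : p ∈ Set.Icc (0 : ℝ) 1) (π : Equiv.Perm (Fin (s + 1))) :
    Measurable (psi p π) := by
  classical
  have h : psi p π = proj p (fun y => (if permOfPoints y = π then 1 else 0 : ℝ)) (Fin.last s) := by
    ext z
    rw [proj_last_eq_sum_psi hp fun ρ => if ρ = π then 1 else 0]
    simp
  rw [h]
  exact measurable_proj hp ((measurable_from_top
    (f := fun ρ : Equiv.Perm (Fin (s + 1)) => (if ρ = π then 1 else 0 : ℝ))).comp
      measurable_permOfPoints) _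

theorem abs_psi_le (hp : p ∈ Set.Icc (0 : ℝ) 1) (π : Equiv.Perm (Fin (s + 1))) (z : I × I) :
    |psi p π z| ≤ 1 := by
  have := isProbabilityMeasure_pointLaw hp
  rw [psi_eq_measureReal hp, abs_of_nonneg measureReal_nonneg]
  exact measureReal_le_one

open scoped Matrix in
-- Bilinearity of the covariance, with two observations: the two mixed covariances in `limitCov`
-- become equal once summed against `θ` on both sides, and writing `1 - p` as `p₂ + (1 - p - p₂)`
-- groups the terms by cycle length, as in the finite variance.
theorem dotProduct_limitCov_mulVec (hp : p ∈ Set.Icc (0 : ℝ) 1) (p₂ : ℝ)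
    (θ : Equiv.Perm (Fin (s + 1)) → ℝ) {f : I × I → ℝ}
    (hf : ∀ z, f z = ((s ! : ℕ) : ℝ)⁻¹ * ∑ π, θ π * psi p π z) :
    θ ⬝ᵥ (limitCov (s + 1) p p₂ *ᵥ θ) =
      p * cubeCov (fun ω => f (ω.1, ω.1)) (fun ω => f (ω.1, ω.1)) +
      p₂ * (cubeCov (fun ω => f (ω.1, ω.2.1)) (fun ω => f (ω.1, ω.2.1)) +
          cubeCov (fun ω => f (ω.1, ω.2.1)) (fun ω => f (ω.2.1, ω.1))) +
      (1 - p - p₂) *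
        (cubeCov (fun ω => f (ω.1, ω.2.1)) (fun ω => f (ω.1, ω.2.1)) +
          2 * cubeCov (fun ω => f (ω.1, ω.2.1)) (fun ω => f (ω.2.1, ω.2.2))) := by
  have hexp (c d : I × I × I → I × I) (hc : Measurable c) (hd : Measurable d) :
      cubeCov (fun ω => f (c ω)) (fun ω => f (d ω)) = (((s ! : ℕ) : ℝ) ^ 2)⁻¹ *
        ∑ π, ∑ ρ, θ π * θ ρ * cubeCov (fun ω => psi p π (c ω)) (fun ω => psi p ρ (d ω)) := by
    have h1 := cubeCov_sum_mul (C := 1) θ θ (fun π => (measurable_psi hp π).comp hc)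
      (fun π => (measurable_psi hp π).comp hd) (fun π ω => abs_psi_le hp π (c ω))
      (fun π ω => abs_psi_le hp π (d ω))
    simp only [hf]
    unfold cubeCov at h1 ⊢
    rw [covariance_const_mul_left, covariance_const_mul_right]
    rw [← mul_assoc, ← sq, inv_pow]
    exact congrArg _ h1
  have hsymm : ∑ π, ∑ ρ, θ π * θ ρ * cubeCov (fun ω => psi p ρ (ω.1, ω.2.1))
        (fun ω => psi p π (ω.2.1, ω.2.2)) =
      ∑ π, ∑ ρ, θ π * θ ρ * cubeCov (fun ω => psi p π (ω.1, ω.2.1))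
        (fun ω => psi p ρ (ω.2.1, ω.2.2)) := by
    rw [Finset.sum_comm]
    refine Finset.sum_congr rfl fun π _ => Finset.sum_congr rfl fun ρ _ => by ring
  have hL : θ ⬝ᵥ (limitCov (s + 1) p p₂ *ᵥ θ) = (((s ! : ℕ) : ℝ) ^ 2)⁻¹ * ∑ π, ∑ ρ,
      (p * (θ π * θ ρ * cubeCov (fun ω => psi p π (ω.1, ω.1)) (fun ω => psi p ρ (ω.1, ω.1))) +
      (1 - p) * (θ π * θ ρ *
        cubeCov (fun ω => psi p π (ω.1, ω.2.1)) (fun ω => psi p ρ (ω.1, ω.2.1))) +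
      p₂ * (θ π * θ ρ *
        cubeCov (fun ω => psi p π (ω.1, ω.2.1)) (fun ω => psi p ρ (ω.2.1, ω.1))) +
      (1 - p - p₂) * (θ π * θ ρ *
        cubeCov (fun ω => psi p π (ω.1, ω.2.1)) (fun ω => psi p ρ (ω.2.1, ω.2.2))) +
      (1 - p - p₂) * (θ π * θ ρ *
        cubeCov (fun ω => psi p ρ (ω.1, ω.2.1)) (fun ω => psi p π (ω.2.1, ω.2.2)))) := by
    simp only [dotProduct, Matrix.mulVec, Finset.mul_sum]
    refine Finset.sum_congr rfl fun π _ => Finset.sum_congr rfl fun ρ _ => ?_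
    simp only [limitCov, Matrix.of_apply, Nat.add_sub_cancel, cubeCov]
    ring
  rw [hL]
  simp only [Finset.sum_add_distrib, ← Finset.mul_sum]
  rw [hsymm, hexp (fun ω => (ω.1, ω.1)) (fun ω => (ω.1, ω.1)) (by fun_prop) (by fun_prop),
    hexp (fun ω => (ω.1, ω.2.1)) (fun ω => (ω.1, ω.2.1)) (by fun_prop) (by fun_prop),
    hexp (fun ω => (ω.1, ω.2.1)) (fun ω => (ω.2.1, ω.1)) (by fun_prop) (by fun_prop),
    hexp (fun ω => (ω.1, ω.2.1)) (fun ω => (ω.2.1, ω.2.2)) (by fun_prop) (by fun_prop)]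
  ring

/-- Only the term with swapped arguments is not visibly symmetric; there one exchanges the two
uniform variables. -/
theorem isHermitian_limitCov (hp : p ∈ Set.Icc (0 : ℝ) 1) (p₂ : ℝ) :
    (limitCov (s + 1) p p₂).IsHermitian := by
  have hswap (π ρ : Equiv.Perm (Fin (s + 1))) :
      cov[fun ω : I × I × I => psi p π (ω.1, ω.2.1), fun ω => psi p ρ (ω.2.1, ω.1); volume] =
      cov[fun ω : I × I × I => psi p ρ (ω.1, ω.2.1), fun ω => psi p π (ω.2.1, ω.1); volume] := by
    have hm := measurable_psi (s := s) hp
    have h1 := covariance_comp_measurePreserving measurePreserving_cube_pair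
      (hm π) ((hm ρ).comp measurable_swap)
    have h2 := covariance_comp_measurePreserving measurePreserving_cube_pair
      (hm ρ) ((hm π).comp measurable_swap)
    have h3 := covariance_comp_measurePreserving
      (Measure.measurePreserving_swap (μ := (volume : Measure I)) (ν := (volume : Measure I)))
      ((hm π).comp measurable_swap) (hm ρ)
    refine h1.trans (Eq.trans ?_ h2.symm)
    rw [covariance_comm (psi p ρ)]
    exact h3
  refine Matrix.IsHermitian.ext fun π ρ => ?_
  simp only [limitCov, Matrix.of_apply, star_trivial]
  rw [hswap ρ π, covariance_comm (fun ω : I × I × I => psi p ρ (ω.1, ω.1)),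
    covariance_comm (fun ω : I × I × I => psi p ρ (ω.1, ω.2.1)) (fun ω => psi p π (ω.1, ω.2.1))]
  ring

end PatternProjection

/-! ### From a random conjugate of a fixed permutation to the uniform law on the class. -/

section ConjugationInvariance

variable {n : ℕ}

theorem measurable_standardize : Measurable (standardize : (Fin n → I) → Equiv.Perm (Fin n)) := by
  refine measurable_to_countable' fun π => ?_
  have : (standardize : (Fin n → I) → Equiv.Perm (Fin n)) ⁻¹' {π} =
      {y | Tuple.sort y = π⁻¹} := by
    ext y; simp [standardize, inv_eq_iff_eq_inv]
  rw [this]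
  exact measurableSet_sort_eq _

theorem uniformOn_cyclicClass_conj (t : n.Partition) (η g : Equiv.Perm (Fin n)) :
    (uniformOn (cyclicClass t)).real {η * g * η⁻¹} = (uniformOn (cyclicClass t)).real {g} := by
  have hm : MeasurableSet (cyclicClass t) := MeasurableSpace.measurableSet_top
  simp only [measureReal_def, uniformOn, cond_apply hm]
  by_cases h : g ∈ cyclicClass t
  · have h' := (conj_mem_cyclicClass_iff g η).2 h
    rw [Set.inter_eq_right.2 (Set.singleton_subset_iff.2 h),
      Set.inter_eq_right.2 (Set.singleton_subset_iff.2 h')]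
    simp
  · have h' := fun h' => h ((conj_mem_cyclicClass_iff g η).1 h')
    rw [Set.inter_singleton_eq_empty.2 h, Set.inter_singleton_eq_empty.2 h']

/-- For each `u`, conjugation by `standardize u` preserves the uniform law on the class. Averaging
over `u` writes the integral as a convex combination, over `g` in the class, of the integrals in the
geometric model. -/
theorem norm_integral_uniformOn_sub_le (t : n.Partition)
    [IsProbabilityMeasure (uniformOn (cyclicClass t))] (H : Equiv.Perm (Fin n) → ℂ) (z : ℂ) {ε : ℝ}
    (hε : ∀ g ∈ cyclicClass t,
      ‖(∫ u : Fin n → I, H (standardize u * g * (standardize u)⁻¹)) - z‖ ≤ ε) :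
    ‖(∫ g, H g ∂uniformOn (cyclicClass t)) - z‖ ≤ ε := by
  set w : Equiv.Perm (Fin n) → ℝ := fun g => (uniformOn (cyclicClass t)).real {g} with hw
  have hw0 (g) : 0 ≤ w g := measureReal_nonneg
  have hsupp (g) (hg : g ∉ cyclicClass t) : w g = 0 := by
    have hm : MeasurableSet (cyclicClass t) := MeasurableSpace.measurableSet_top
    simp only [hw, measureReal_def, uniformOn, cond_apply hm, Set.inter_singleton_eq_empty.2 hg]
    simp
  have hw1 : ∑ g, w g = 1 := by
    rw [hw, sum_measureReal_singleton, Finset.coe_univ, probReal_univ]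
  have h1 : ∫ g, H g ∂uniformOn (cyclicClass t) = ∑ g, (w g : ℂ) * H g := by
    rw [integral_fintype Integrable.of_finite]
    rfl
  have hconj (η : Equiv.Perm (Fin n)) :
      ∑ g, (w g : ℂ) * H g = ∑ g, (w g : ℂ) * H (η * g * η⁻¹) := by
    refine (Fintype.sum_equiv (MulAut.conj η).toEquiv _ _ fun g => ?_).symm
    simp only [MulEquiv.toEquiv_eq_coe, MulEquiv.coe_toEquiv, MulAut.conj_apply, hw,
      uniformOn_cyclicClass_conj]
  have hmeas (g) : Measurable fun u : Fin n → I => H (standardize u * g * (standardize u)⁻¹) :=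
    (measurable_from_top (f := fun η : Equiv.Perm (Fin n) => H (η * g * η⁻¹))).comp
      measurable_standardize
  have hint (g) : Integrable fun u : Fin n → I => H (standardize u * g * (standardize u)⁻¹) :=
    Integrable.of_bound (hmeas g).aestronglyMeasurable (∑ g, ‖H g‖) (ae_of_all _ fun u =>
      Finset.single_le_sum (f := fun g => ‖H g‖) (fun g _ => norm_nonneg _) (Finset.mem_univ _))
  have h2 : ∫ g, H g ∂uniformOn (cyclicClass t) =
      ∑ g, (w g : ℂ) * ∫ u : Fin n → I, H (standardize u * g * (standardize u)⁻¹) := by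
    have h3 : ∫ g, H g ∂uniformOn (cyclicClass t) =
        ∫ u : Fin n → I, ∑ g, (w g : ℂ) * H (standardize u * g * (standardize u)⁻¹) := by
      simp only [← hconj, h1]
      simp
    rw [h3, integral_finsetSum _ fun g _ => (hint g).const_mul _]
    simp only [integral_const_mul]
  have h4 : (∫ g, H g ∂uniformOn (cyclicClass t)) - z =
      ∑ g, (w g : ℂ) * ((∫ u : Fin n → I, H (standardize u * g * (standardize u)⁻¹)) - z) := by
    simp only [mul_sub, Finset.sum_sub_distrib, ← Finset.sum_mul]
    rw [h2, ← Complex.ofReal_sum, hw1]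
    simp
  rw [h4]
  refine (norm_sum_le _ _).trans ?_
  have h5 : ε = ∑ g, w g * ε := by rw [← Finset.sum_mul, hw1, one_mul]
  rw [h5]
  refine Finset.sum_le_sum fun g _ => ?_
  rw [norm_mul, Complex.norm_real, Real.norm_eq_abs, abs_of_nonneg (hw0 g)]
  by_cases hg : g ∈ cyclicClass t
  · exact mul_le_mul_of_nonneg_left (hε g hg) (hw0 g)
  · simp [hsupp g hg]

end ConjugationInvariance

/-! ### Comparison of the pattern statistic with its linear part. -/

section Reduction

variable {n s : ℕ}

/-- Non-injective maps from `s + 1` elements lose one degree of freedom; the constant is crude,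
chosen to make the induction close. -/
theorem pow_le_descFactorial_add (n s : ℕ) :
    (n : ℝ) ^ (s + 1) ≤ n.descFactorial (s + 1) + (s + 1) ^ 2 * (n : ℝ) ^ s := by
  induction s with
  | zero => simp
  | succ s ih =>
    have h1 : (n.descFactorial (s + 1) : ℝ) ≤ (n : ℝ) ^ (s + 1) := by
      exact_mod_cast Nat.descFactorial_le_pow n (s + 1)
    have h2 : ((n : ℝ) - (s + 1)) * n.descFactorial (s + 1) ≤ n.descFactorial (s + 2) := by
      rw [Nat.descFactorial_succ n (s + 1)]
      push_cast
      refine mul_le_mul_of_nonneg_right ?_ (by positivity)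
      have : n ≤ (n - (s + 1)) + (s + 1) := by omega
      have : (n : ℝ) ≤ ((n - (s + 1) : ℕ) : ℝ) + (s + 1) := by exact_mod_cast this
      linarith
    have h3 : (n : ℝ) ^ (s + 2) ≤ n * n.descFactorial (s + 1) + (s + 1) ^ 2 * (n : ℝ) ^ (s + 1) := by
      have := mul_le_mul_of_nonneg_left ih (Nat.cast_nonneg' n : (0 : ℝ) ≤ n)
      rw [pow_succ' _ (s + 1)]
      refine this.trans (le_of_eq ?_)
      rw [pow_succ' _ s]
      ring
    have h4 : ((s : ℝ) + 1) * n.descFactorial (s + 1) ≤ (s + 1) * (n : ℝ) ^ (s + 1) :=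
      mul_le_mul_of_nonneg_left h1 (by positivity)
    -- The slack in the induction: `(s + 2) ^ 2` exceeds `(s + 1) ^ 2 + (s + 1)` by `s + 2`.
    have h5 : (0 : ℝ) ≤ (s + 2) * (n : ℝ) ^ (s + 1) := by positivity
    push_cast
    nlinarith

theorem abs_sum_sub_sum_embedding_le {r : ℕ} {F : (Fin r → Fin n) → ℝ} {C : ℝ}
    (hF : ∀ k, |F k| ≤ C) :
    |∑ k, F k - ∑ k : Fin r ↪ Fin n, F k| ≤ C * ((n : ℝ) ^ r - n.descFactorial r) := by
  classical
  let S : Finset (Fin r → Fin n) := Finset.univ.map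
    ⟨fun k : Fin r ↪ Fin n => (k : Fin r → Fin n), DFunLike.coe_injective⟩
  have h1 : ∑ k : Fin r ↪ Fin n, F k = ∑ k ∈ S, F k := by simp [S]
  have h2 : ∑ k, F k - ∑ k ∈ S, F k = ∑ k ∈ Sᶜ, F k := by
    rw [← Finset.sum_add_sum_compl S]; ring
  have h3 : (Sᶜ.card : ℝ) = (n : ℝ) ^ r - n.descFactorial r := by
    have hS : S.card = n.descFactorial r := by simp [S, Fintype.card_embedding_eq]
    rw [Finset.card_compl, hS, Fintype.card_fun, Fintype.card_fin, Fintype.card_fin,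
      Nat.cast_sub (Nat.descFactorial_le_pow n r)]
    push_cast; ring
  rw [h1, h2, ← h3]
  refine (Finset.abs_sum_le_sum_abs _ _).trans ((Finset.sum_le_sum fun k _ => hF k).trans ?_)
  rw [Finset.sum_const, nsmul_eq_mul, mul_comm]

/-- A linear combination of the normalized pattern counts. -/
noncomputable def patternStat (p : ℝ) (θ : Equiv.Perm (Fin (s + 1)) → ℝ)
    (τ : Equiv.Perm (Fin n)) : ℝ :=
  ∑ π, θ π * (((patternCount π τ : ℝ) - n.choose (s + 1) * patternMean p π) / (n ^ s * √n))

/-- The function whose sum over the points is the first order part of `patternStat`. -/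
noncomputable def projStat (p : ℝ) (θ : Equiv.Perm (Fin (s + 1)) → ℝ) (z : I × I) : ℝ :=
  ((s ! : ℕ) : ℝ)⁻¹ * ∑ π, θ π * psi p π z

variable {p : ℝ} {θ : Equiv.Perm (Fin (s + 1)) → ℝ}

theorem measurable_projStat (hp : p ∈ Set.Icc (0 : ℝ) 1) : Measurable (projStat p θ) :=
  (Finset.measurable_sum _ fun π _ => (measurable_psi hp π).const_mul _).const_mul _

theorem abs_projStat_le (hp : p ∈ Set.Icc (0 : ℝ) 1) (z : I × I) :
    |projStat p θ z| ≤ ∑ π, |θ π| := by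
  rw [projStat, abs_mul]
  have h1 : |((s ! : ℕ) : ℝ)⁻¹| ≤ 1 := by
    rw [abs_of_nonneg (by positivity)]
    exact inv_le_one_of_one_le₀ (by exact_mod_cast Nat.succ_le_of_lt (Nat.factorial_pos s))
  refine (mul_le_of_le_one_left (abs_nonneg _) h1).trans
    ((Finset.abs_sum_le_sum_abs _ _).trans (Finset.sum_le_sum fun π _ => ?_))
  rw [abs_mul]
  exact mul_le_of_le_one_right (abs_nonneg _) (abs_psi_le hp π z)

/-- The three errors are the degenerate remainder, the non-injective tuples (counted twice, once in
the sum and once in the mean), and the gap between the proportion of fixed points and `p`. -/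
theorem abs_patternStat_sub_le (hn : n ≠ 0) (hp : p ∈ Set.Icc (0 : ℝ) 1)
    (ρ : Equiv.Perm (Fin n)) {u : Fin n → I} (hu : Function.Injective u) :
    |patternStat p θ (standardize u * ρ * (standardize u)⁻¹) -
      (√n)⁻¹ * ∑ i, centred ρ (projStat p θ) i u| ≤
      |∑ k : Fin (s + 1) → Fin n, remAt ρ (fun y => θ (permOfPoints y)) k
        (fun b => pts ρ u (k b))| / (n ^ s * √n) +
      2 * (∑ π, |θ π|) * (s + 1) ^ 2 * (√n)⁻¹ +
      (1 + 2 * (s + 1)) * (2 ^ (s + 1) * ((s + 1) * ∑ π, |θ π|)) * (√n * |fixFrac ρ - p|) := by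
  set C := ∑ π, |θ π| with hCdef
  set g : (Fin (s + 1) → I × I) → ℝ := fun y => θ (permOfPoints y) with hgdef
  have hg : Measurable g := (measurable_from_top (f := θ)).comp measurable_permOfPoints
  have hC (y) : |g y| ≤ C :=
    Finset.single_le_sum (f := fun π => |θ π|) (fun π _ => abs_nonneg _) (Finset.mem_univ _)
  have hC0 : 0 ≤ C := Finset.sum_nonneg fun π _ => abs_nonneg _
  have := isProbabilityMeasure_pointLaw hp
  have hn0 : (0 : ℝ) < n := by positivity
  set M := ∫ y, g y ∂Measure.pi (fun _ : Fin (s + 1) => pointLaw p) with hM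
  have hMC : |M| ≤ C := abs_integral_le hC
  set R := ∑ k : Fin (s + 1) → Fin n, remAt ρ g k (fun b => pts ρ u (k b)) with hR
  set A := ∑ k : Fin (s + 1) → Fin n, g (fun b => pts ρ u (k b)) with hA
  set E := ∑ k : Fin (s + 1) ↪ Fin n, g (fun b => pts ρ u (k b)) with hE
  set L := ∑ i, centred ρ (projStat p θ) i u with hL
  set d : ℝ := ((n.descFactorial (s + 1) : ℕ) : ℝ) with hd
  have hfac : (0 : ℝ) < (s + 1)! := by exact_mod_cast Nat.factorial_pos _
  have hchoose : ((s + 1)! : ℝ) * n.choose (s + 1) = d := by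
    rw [hd, Nat.descFactorial_eq_factorial_mul_choose]; push_cast; ring
  -- the statistic in terms of the sum over embeddings
  have h1 : patternStat p θ (standardize u * ρ * (standardize u)⁻¹) =
      (E - d * M) / ((s + 1)! * (n ^ s * √n)) := by
    have e1 := sum_injective_permOfPoints hu ρ θ
    have e2 := integral_eq_sum_patternMean hp θ
    rw [hE, hM, hgdef, e1, e2, ← hchoose, patternStat]
    simp only [mul_div_assoc', ← Finset.sum_div]
    rw [mul_assoc ((s + 1)! : ℝ) (n.choose (s + 1) : ℝ), ← mul_sub,
      mul_div_mul_left _ _ hfac.ne']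
    congr 1
    rw [Finset.mul_sum, ← Finset.sum_sub_distrib]
    exact Finset.sum_congr rfl fun π _ => by ring
  have h2 : |A - E| ≤ C * ((n : ℝ) ^ (s + 1) - d) :=
    abs_sum_sub_sum_embedding_le (F := fun k => g fun b => pts ρ u (k b)) fun k => hC _
  have h3 : (n : ℝ) ^ (s + 1) - d ≤ (s + 1) ^ 2 * (n : ℝ) ^ s := by
    linarith [pow_le_descFactorial_add n s]
  have h3' : 0 ≤ (n : ℝ) ^ (s + 1) - d := by
    have : d ≤ (n : ℝ) ^ (s + 1) := by
      rw [hd]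
      exact_mod_cast Nat.descFactorial_le_pow n (s + 1)
    linarith
  -- There are `s + 1` equal projections, each `s !` times `projStat`; the resulting `(s + 1)!`
  -- cancels the number of orderings of a set of positions.
  have hproj : ∑ a, ∑ i, (proj p g a (pts ρ u i) - ∫ z, proj p g a z ∂pairLaw ρ i) =
      (s + 1)! * L := by
    have e1 (a : Fin (s + 1)) (z : I × I) : proj p g a z = s ! * projStat p θ z := by
      rw [hgdef, proj_eq_proj_last hp, proj_last_eq_sum_psi hp, projStat, mul_inv_cancel_left₀]
      exact_mod_cast (Nat.factorial_pos s).ne'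
    simp only [e1, integral_const_mul, ← mul_sub]
    rw [Finset.sum_const, Finset.card_univ, Fintype.card_fin, nsmul_eq_mul, ← Finset.mul_sum,
      Nat.factorial_succ]
    push_cast
    rw [mul_assoc]
    rfl
  have h4 := abs_sum_sub_le hn ρ hp hg hC u
  rw [hproj] at h4
  push_cast at h4
  set K := (1 + 2 * ((s : ℝ) + 1)) * (2 ^ (s + 1) * ((s + 1) * C)) * |fixFrac ρ - p| with hK
  have hdiv : (n : ℝ) ^ (s + 1) / n = n ^ s := by rw [pow_succ]; field_simp
  rw [hdiv] at h4
  have hs0 : 0 < √(n : ℝ) := Real.sqrt_pos.2 hn0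
  have hss : √(n : ℝ) * √n = n := Real.mul_self_sqrt hn0.le
  set D := (n : ℝ) ^ s * √n with hD
  have hD0 : 0 < D := by positivity
  have h5 : patternStat p θ (standardize u * ρ * (standardize u)⁻¹) - (√n)⁻¹ * L =
      ((E - d * M) - (n : ℝ) ^ s * ((s + 1)! * L)) / ((s + 1)! * D) := by
    rw [h1, hD]
    field_simp
  have hfac1 : (1 : ℝ) ≤ (s + 1)! := by exact_mod_cast Nat.succ_le_of_lt (Nat.factorial_pos _)
  have h6 : |(E - d * M) - (n : ℝ) ^ s * ((s + 1)! * L)| ≤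
      |R| + 2 * C * ((s + 1) ^ 2 * (n : ℝ) ^ s) + (n : ℝ) ^ (s + 1) * K := by
    have e1 : (E - d * M) - (n : ℝ) ^ s * ((s + 1)! * L) =
        R + (-(A - E)) + ((n : ℝ) ^ (s + 1) - d) * M +
          (A - R - (n : ℝ) ^ (s + 1) * M - (n : ℝ) ^ s * ((s + 1)! * L)) := by ring
    have e2 : |((n : ℝ) ^ (s + 1) - d) * M| ≤ C * ((n : ℝ) ^ (s + 1) - d) := by
      rw [abs_mul, abs_of_nonneg h3', mul_comm]
      exact mul_le_mul_of_nonneg_right hMC h3'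
    have e3 : C * ((n : ℝ) ^ (s + 1) - d) ≤ C * ((s + 1) ^ 2 * (n : ℝ) ^ s) :=
      mul_le_mul_of_nonneg_left h3 hC0
    rw [e1]
    have t1 := abs_add_le (R + (-(A - E)) + ((n : ℝ) ^ (s + 1) - d) * M)
      (A - R - (n : ℝ) ^ (s + 1) * M - (n : ℝ) ^ s * ((s + 1)! * L))
    have t2 := abs_add_le (R + (-(A - E))) (((n : ℝ) ^ (s + 1) - d) * M)
    have t3 := abs_add_le R (-(A - E))
    rw [abs_neg] at t3
    linarith
  rw [h5, abs_div, abs_of_pos (mul_pos (by positivity) hD0 : (0 : ℝ) < (s + 1)! * D)]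
  have h7 : |(E - d * M) - (n : ℝ) ^ s * ((s + 1)! * L)| / ((s + 1)! * D) ≤
      (|R| + 2 * C * ((s + 1) ^ 2 * (n : ℝ) ^ s) + (n : ℝ) ^ (s + 1) * K) / D := by
    refine div_le_div₀ ((abs_nonneg _).trans h6) h6 hD0 ?_
    exact le_mul_of_one_le_left hD0.le hfac1
  refine h7.trans (le_of_eq ?_)
  rw [add_div, add_div]
  congr 1
  · congr 1
    rw [hD]
    field_simp
  · have e1 : (n : ℝ) ^ (s + 1) * K / D = √n * K := by
      rw [hD, pow_succ, div_eq_iff (by positivity)]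
      linear_combination (-(n : ℝ) ^ s * K) * hss
    rw [e1, hK]
    ring

/-- As `x ↦ exp (i x)` is 1-Lipschitz, the pathwise comparison only needs the first moment of the
remainder, obtained from its second moment. The pathwise bound holds for injective `u`, hence almost
surely. -/
theorem norm_integral_cexp_patternStat_sub_le (hn : n ≠ 0) (hp : p ∈ Set.Icc (0 : ℝ) 1)
    (ρ : Equiv.Perm (Fin n)) {C : ℝ} (hC : C = ∑ π, |θ π|) :
    ‖(∫ u : Fin n → I, Complex.exp
        ((patternStat p θ (standardize u * ρ * (standardize u)⁻¹) : ℝ) * Complex.I)) -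
      Complex.exp (-(((n : ℝ)⁻¹ * ∑ i, ∑ j ∈ nbhd ρ i, ∫ u : Fin n → I,
        centred ρ (projStat p θ) i u * centred ρ (projStat p θ) j u) / 2 : ℝ))‖ ≤
      (√((2 * (s + 1)) ^ 4 * 9 * (2 * (s + 2) * C) ^ 2) + 2 * C * (s + 1) ^ 2 +
        (24 * √27 * C ^ 2 + 216 * C ^ 3)) * (√n)⁻¹ +
      (1 + 2 * (s + 1)) * (2 ^ (s + 1) * ((s + 1) * C)) * (√n * |fixFrac ρ - p|) := by
  have hn0 : (0 : ℝ) < n := by positivity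
  have hs0 : 0 < √(n : ℝ) := Real.sqrt_pos.2 hn0
  have hfm : Measurable (projStat p θ) := measurable_projStat hp
  have hfC (z) : |projStat p θ z| ≤ C := hC ▸ abs_projStat_le hp z
  have hmain := norm_integral_cexp_centred_sub_le (ρ := ρ) hn hfm hfC
  set g : (Fin (s + 1) → I × I) → ℝ := fun y => θ (permOfPoints y) with hgdef
  have hg : Measurable g := (measurable_from_top (f := θ)).comp measurable_permOfPoints
  have hgC (y) : |g y| ≤ C := hC ▸
    Finset.single_le_sum (f := fun π => |θ π|) (fun π _ => abs_nonneg _) (Finset.mem_univ _)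
  let T (u : Fin n → I) : ℝ := patternStat p θ (standardize u * ρ * (standardize u)⁻¹)
  let S (u : Fin n → I) : ℝ := (√n)⁻¹ * ∑ i, centred ρ (projStat p θ) i u
  let R (u : Fin n → I) : ℝ :=
    ∑ k : Fin (s + 1) → Fin n, remAt ρ g k (fun b => pts ρ u (k b))
  have hTm : Measurable T :=
    (measurable_from_top (f := fun η : Equiv.Perm (Fin n) => patternStat p θ (η * ρ * η⁻¹))).comp
      measurable_standardize
  have hSm : Measurable S :=
    (Finset.measurable_sum _ fun i _ => measurable_centred hfm i).const_mul _
  have hRm : Measurable R := Finset.measurable_sum _ fun k _ => (measurable_remAt hg k).comp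
    (measurable_pi_lambda _ fun b => measurable_pts ρ (k b))
  have hRb (u) : |R u| ≤ ∑ _k : Fin (s + 1) → Fin n, 2 * ((s + 1 : ℕ) + 1) * C :=
    (Finset.abs_sum_le_sum_abs _ _).trans (Finset.sum_le_sum fun k _ => abs_remAt_le hgC k _)
  have hRi : ∫ u, |R u| ≤
      √((2 * (s + 1)) ^ 4 * 9 * (2 * (s + 2) * C) ^ 2) * (n : ℝ) ^ s := by
    have h1 := integral_abs_le_sqrt hRm hRb
      (integral_sq_sum_remAt_le (n := n) (ρ := ρ) hg hgC (Nat.succ_pos s))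
    refine h1.trans (le_of_eq ?_)
    have h2 : 2 * (s + 1) - 2 = s * 2 := by omega
    rw [h2, pow_mul, Real.sqrt_mul (by positivity), Real.sqrt_sq (by positivity)]
    push_cast
    ring_nf
  set B1 := 2 * C * (s + 1) ^ 2 * (√n)⁻¹ +
    (1 + 2 * (s + 1)) * (2 ^ (s + 1) * ((s + 1) * C)) * (√n * |fixFrac ρ - p|) with hB1
  have hTS : ∀ᵐ u ∂(volume : Measure (Fin n → I)), ‖Complex.exp ((T u : ℝ) * Complex.I) -
      Complex.exp ((S u : ℝ) * Complex.I)‖ ≤ |R u| / (n ^ s * √n) + B1 := by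
    filter_upwards [ae_injective_uniform] with u hu
    have h1 := abs_patternStat_sub_le (θ := θ) hn hp ρ hu
    have h2 : ‖Complex.exp ((T u : ℝ) * Complex.I) - Complex.exp ((S u : ℝ) * Complex.I)‖ ≤
        |T u - S u| := by
      have h3 : Complex.exp ((T u : ℝ) * Complex.I) - Complex.exp ((S u : ℝ) * Complex.I) =
          Complex.exp ((S u : ℝ) * Complex.I) *
            (Complex.exp (Complex.I * (T u - S u : ℝ)) - 1) := by
        rw [mul_sub, ← Complex.exp_add]
        push_cast
        ring_nf
      rw [h3, norm_mul, Complex.norm_exp_ofReal_mul_I, one_mul]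
      exact Real.norm_exp_I_mul_ofReal_sub_one_le
    refine h2.trans (h1.trans (le_of_eq ?_))
    rw [hB1, ← hC, add_assoc]
  have hiR : Integrable (fun u => |R u| / (n ^ s * √n) + B1) :=
    ((integrable_of_abs_le hRm hRb).abs.div_const _).add (integrable_const _)
  have hie (F : (Fin n → I) → ℝ) (hF : Measurable F) :
      Integrable fun u => Complex.exp ((F u : ℝ) * Complex.I) :=
    Integrable.of_bound (by fun_prop : Measurable _).aestronglyMeasurable 1
      (ae_of_all _ fun u => (Complex.norm_exp_ofReal_mul_I _).le)
  have hdiff : ‖(∫ u, Complex.exp ((T u : ℝ) * Complex.I)) -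
      ∫ u, Complex.exp ((S u : ℝ) * Complex.I)‖ ≤
      √((2 * (s + 1)) ^ 4 * 9 * (2 * (s + 2) * C) ^ 2) * (√n)⁻¹ + B1 := by
    rw [← integral_sub (hie T hTm) (hie S hSm)]
    refine (norm_integral_le_of_norm_le hiR hTS).trans ?_
    rw [integral_add ((integrable_of_abs_le hRm hRb).abs.div_const _) (integrable_const _),
      integral_div]
    simp only [integral_const, probReal_univ, one_smul]
    gcongr
    rw [div_le_iff₀ (by positivity)]
    refine hRi.trans (le_of_eq ?_)
    field_simp
  refine (norm_sub_le_norm_sub_add_norm_sub _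
    (∫ u, Complex.exp ((S u : ℝ) * Complex.I)) _).trans ?_
  refine (add_le_add hdiff hmain).trans (le_of_eq ?_)
  rw [hB1]
  ring

end Reduction

/-! ### Limits of the error terms and of the variance. -/

section Limit

/-- The double sum is the second moment of the centred sum, since covariances outside the
neighbourhoods vanish. -/
theorem sum_sum_nbhd_integral_nonneg {n : ℕ} (ρ : Equiv.Perm (Fin n)) {f : I × I → ℝ} {C : ℝ}
    (hf : Measurable f) (hC : ∀ z, |f z| ≤ C) :
    0 ≤ ∑ i, ∑ j ∈ nbhd ρ i, ∫ u : Fin n → I, centred ρ f i u * centred ρ f j u := by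
  have hcc (i j : Fin n) : Integrable fun u : Fin n → I => centred ρ f i u * centred ρ f j u :=
    integrable_of_abs_le ((measurable_centred hf i).mul (measurable_centred hf j))
      (C := (2 * C) * (2 * C)) fun u => by
        rw [abs_mul]
        exact mul_le_mul (abs_centred_le hC i u) (abs_centred_le hC j u) (abs_nonneg _)
          ((abs_nonneg _).trans (abs_centred_le (ρ := ρ) hC i u))
  have h := integral_sq_sum_eq (μ := (volume : Measure (Fin n → I)))
    (fun i => measurable_centred hf i) (abs_centred_le hC) (integral_centred hf hC)
    (indepFun_centred_sum (ρ := ρ) hf)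
  simp only [Finset.mul_sum] at h
  rw [integral_finsetSum _ fun i _ => integrable_finsetSum _ fun j _ => hcc i j] at h
  simp only [integral_finsetSum _ fun j _ => hcc _ j] at h
  rw [← h]
  exact integral_nonneg fun u => sq_nonneg _

variable {t : (n : ℕ) → n.Partition} {p₁ p₂ : ℝ} {s : ℕ}

theorem tendsto_numCycles_one_div
    (ht₁ : (fun n : ℕ => (numCycles (t n) 1 : ℝ) - n * p₁) =o[atTop] (fun n : ℕ => √(n : ℝ))) :
    Tendsto (fun n : ℕ => √(n : ℝ) * |(numCycles (t n) 1 : ℝ) / n - p₁|) atTop (nhds 0) := by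
  have h := ht₁.tendsto_div_nhds_zero.abs
  rw [abs_zero] at h
  refine h.congr' ?_
  filter_upwards [eventually_ge_atTop 1] with n hn
  have hn0 : (0 : ℝ) < n := by exact_mod_cast hn
  have hs0 : 0 < √(n : ℝ) := Real.sqrt_pos.2 hn0
  rw [← abs_of_pos hs0, ← abs_mul, abs_of_pos hs0]
  congr 1
  have hss : √(n : ℝ) ^ 2 = n := Real.sq_sqrt hn0.le
  field_simp
  rw [hss]
  ring

open scoped Matrix in
theorem tendsto_variance (hp₁ : p₁ ∈ Set.Icc (0 : ℝ) 1)
    (ht₁ : (fun n : ℕ => (numCycles (t n) 1 : ℝ) - n * p₁) =o[atTop] (fun n : ℕ => √(n : ℝ)))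
    (ht₂ : (fun n : ℕ => 2 * (numCycles (t n) 2 : ℝ) - n * p₂) =o[atTop] (fun n : ℕ => (n : ℝ)))
    (ρ : (n : ℕ) → Equiv.Perm (Fin n)) (hρ : ∀ n, ρ n ∈ cyclicClass (t n))
    (θ : Equiv.Perm (Fin (s + 1)) → ℝ) :
    Tendsto (fun n : ℕ => (n : ℝ)⁻¹ * ∑ i, ∑ j ∈ nbhd (ρ n) i, ∫ u : Fin n → I,
        centred (ρ n) (projStat p₁ θ) i u * centred (ρ n) (projStat p₁ θ) j u) atTop
      (nhds (θ ⬝ᵥ (limitCov (s + 1) p₁ p₂ *ᵥ θ))) := by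
  have h1 : Tendsto (fun n : ℕ => (numCycles (t n) 1 : ℝ) / n) atTop (nhds p₁) := by
    have hsq : (fun n : ℕ => √(n : ℝ)) =O[atTop] fun n : ℕ => (n : ℝ) := by
      refine IsBigO.of_bound 1 ?_
      filter_upwards [eventually_ge_atTop 1] with n hn
      have hn1 : (1 : ℝ) ≤ n := by exact_mod_cast hn
      rw [Real.norm_of_nonneg (Real.sqrt_nonneg _), Real.norm_of_nonneg (by positivity), one_mul]
      exact Real.sqrt_le_iff.2 ⟨by positivity, by nlinarith⟩
    have h := (ht₁.trans_isBigO hsq).tendsto_div_nhds_zero.add_const p₁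
    rw [zero_add] at h
    refine h.congr' ?_
    filter_upwards [eventually_ge_atTop 1] with n hn
    have hn0 : (0 : ℝ) < n := by exact_mod_cast hn
    field_simp
    ring
  have h2 : Tendsto (fun n : ℕ => 2 * (numCycles (t n) 2 : ℝ) / n) atTop (nhds p₂) := by
    have h := ht₂.tendsto_div_nhds_zero.add_const p₂
    rw [zero_add] at h
    refine h.congr' ?_
    filter_upwards [eventually_ge_atTop 1] with n hn
    have hn0 : (0 : ℝ) < n := by exact_mod_cast hn
    field_simp
    ring
  rw [dotProduct_limitCov_mulVec hp₁ p₂ θ (f := projStat p₁ θ) fun z => rfl]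
  refine (((h1.mul_const _).add (h2.mul_const _)).add
    ((((tendsto_const_nhds (x := (1 : ℝ))).sub h1).sub h2).mul_const _)).congr' ?_
  filter_upwards [eventually_ge_atTop 1] with n hn
  have hn0 : (0 : ℝ) < n := by exact_mod_cast hn
  rw [sum_sum_nbhd_integral_centred (measurable_projStat hp₁) (hρ n)]
  field_simp

end Limit

end PermPattern

/-! ### Assembly: convergence of characteristic functions for every `θ`. -/

theorem mainTheorem8
    (t : (n : ℕ) → n.Partition) (p₁ p₂ : ℝ)
    (hp₁ : p₁ ∈ Set.Icc (0 : ℝ) 1) (hp₂ : p₂ ∈ Set.Icc (0 : ℝ) 1)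
    (ht₁ : (fun n : ℕ => (PermPattern.numCycles (t n) 1 : ℝ) - n * p₁)
      =o[atTop] (fun n : ℕ => Real.sqrt n))
    (ht₂ : (fun n : ℕ => 2 * (PermPattern.numCycles (t n) 2 : ℝ) - n * p₂)
      =o[atTop] (fun n : ℕ => (n : ℝ)))
    {Ω : ℕ → Type*} [mΩ : ∀ n, MeasurableSpace (Ω n)]
    (P : (n : ℕ) → Measure (Ω n)) [hP : ∀ n, IsProbabilityMeasure (P n)]
    (τ : (n : ℕ) → Ω n → Equiv.Perm (Fin n))
    (hτ : ∀ n, HasLaw (τ n) (uniformOn (PermPattern.cyclicClass (t n))) (P n))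
    (r : ℕ) (hr : 1 ≤ r) :
    (PermPattern.limitCov r p₁ p₂).PosSemidef ∧
    TendstoInDistribution
      (fun (n : ℕ) (ω : Ω n) =>
        (WithLp.toLp 2 fun π : Equiv.Perm (Fin r) =>
          ((PermPattern.patternCount π (τ n ω) : ℝ)
              - (n.choose r : ℝ) * PermPattern.patternMean p₁ π)
            / (n : ℝ) ^ ((r : ℝ) - 1 / 2) : EuclideanSpace ℝ (Equiv.Perm (Fin r))))
      atTop
      (id : EuclideanSpace ℝ (Equiv.Perm (Fin r)) → EuclideanSpace ℝ (Equiv.Perm (Fin r)))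
      P
      (multivariateGaussian 0 (PermPattern.limitCov r p₁ p₂)) := by
  obtain ⟨s, rfl⟩ : ∃ s, r = s + 1 := ⟨r - 1, by omega⟩
  have hU (n) : IsProbabilityMeasure (uniformOn (PermPattern.cyclicClass (t n))) := by
    rw [← (hτ n).map_eq]
    exact Measure.isProbabilityMeasure_map (hτ n).aemeasurable
  -- Conditioning on the empty set gives the zero measure, which is not a probability, so every
  -- class has a representative. It serves only to name the variance sequence.
  have hne (n) : ∃ ρ, ρ ∈ PermPattern.cyclicClass (t n) := by
    by_contra h
    have h0 : PermPattern.cyclicClass (t n) = ∅ := Set.eq_empty_iff_forall_notMem.2 fun ρ hρ => h ⟨ρ, hρ⟩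
    have := (hU n).measure_univ
    rw [h0] at this
    simp [uniformOn] at this
  choose ρ hρ using hne
  have hvar (θ : Equiv.Perm (Fin (s + 1)) → ℝ) := PermPattern.tendsto_variance (s := s) hp₁ ht₁ ht₂ ρ hρ θ
  have hpsd : (PermPattern.limitCov (s + 1) p₁ p₂).PosSemidef := by
    refine Matrix.PosSemidef.of_dotProduct_mulVec_nonneg (PermPattern.isHermitian_limitCov hp₁ p₂) fun θ => ?_
    rw [star_trivial]
    -- The quadratic form at `θ` is a limit of nonnegative normalized variances.
    refine ge_of_tendsto' (hvar θ) fun n => mul_nonneg (by positivity) ?_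
    exact PermPattern.sum_sum_nbhd_integral_nonneg _ (PermPattern.measurable_projStat hp₁) (PermPattern.abs_projStat_le hp₁)
  refine ⟨hpsd, ?_⟩
  let Ψ (n : ℕ) (g : Equiv.Perm (Fin n)) : EuclideanSpace ℝ (Equiv.Perm (Fin (s + 1))) :=
    WithLp.toLp 2 fun π => ((PermPattern.patternCount π g : ℝ) - (n.choose (s + 1) : ℝ) * PermPattern.patternMean p₁ π) /
      (n : ℝ) ^ (((s + 1 : ℕ) : ℝ) - 1 / 2)
  have hΨ (n) : Measurable (Ψ n) := measurable_from_top
  refine ⟨fun n => (hΨ n).comp_aemeasurable (hτ n).aemeasurable, aemeasurable_id, ?_⟩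
  refine ProbabilityMeasure.tendsto_iff_tendsto_charFun.2 fun θ => ?_
  change Tendsto (fun n => charFun ((P n).map fun ω => Ψ n (τ n ω)) θ) atTop
    (nhds (charFun ((multivariateGaussian 0 (PermPattern.limitCov (s + 1) p₁ p₂)).map id) θ))
  rw [Measure.map_id, charFun_multivariateGaussian hpsd]
  have hchar (n : ℕ) (hn : n ≠ 0) : charFun ((P n).map fun ω => Ψ n (τ n ω)) θ =
      ∫ g, Complex.exp ((PermPattern.patternStat p₁ θ.ofLp g : ℝ) * Complex.I)
        ∂uniformOn (PermPattern.cyclicClass (t n)) := by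
    have hn0 : (0 : ℝ) < n := by positivity
    have h1 : (P n).map (fun ω => Ψ n (τ n ω)) =
        (uniformOn (PermPattern.cyclicClass (t n))).map (Ψ n) := by
      rw [← (hτ n).map_eq, AEMeasurable.map_map_of_aemeasurable (hΨ n).aemeasurable
        (hτ n).aemeasurable]
      rfl
    rw [h1, charFun_apply, integral_map (hΨ n).aemeasurable (by fun_prop)]
    have h2 : (n : ℝ) ^ (((s + 1 : ℕ) : ℝ) - 1 / 2) = (n : ℝ) ^ s * √n := by
      rw [Real.sqrt_eq_rpow, ← Real.rpow_natCast, ← Real.rpow_add hn0]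
      congr 1
      push_cast
      ring
    refine integral_congr_ae (ae_of_all _ fun g => ?_)
    have h3 : inner ℝ (Ψ n g) θ = PermPattern.patternStat p₁ θ.ofLp g := by
      simp only [PiLp.inner_apply, Ψ, PermPattern.patternStat, h2]
      rfl
    beta_reduce
    rw [h3]
  set C := ∑ π, |θ.ofLp π| with hC
  set q : ℕ → ℝ := fun n => (n : ℝ)⁻¹ * ∑ i, ∑ j ∈ PermPattern.nbhd (ρ n) i, ∫ u : Fin n → I,
    PermPattern.centred (ρ n) (PermPattern.projStat p₁ θ.ofLp) i u * PermPattern.centred (ρ n) (PermPattern.projStat p₁ θ.ofLp) j u with hq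
  set K1 := √((2 * ((s : ℝ) + 1)) ^ 4 * 9 * (2 * (s + 2) * C) ^ 2) + 2 * C * (s + 1) ^ 2 +
    (24 * √27 * C ^ 2 + 216 * C ^ 3)
  set K2 := (1 + 2 * ((s : ℝ) + 1)) * (2 ^ (s + 1) * ((s + 1) * C))
  have hbound : ∀ᶠ n : ℕ in atTop, ‖charFun ((P n).map fun ω => Ψ n (τ n ω)) θ -
      Complex.exp (-(q n / 2 : ℝ))‖ ≤
      K1 * (√n)⁻¹ + K2 * (√n * |(PermPattern.numCycles (t n) 1 : ℝ) / n - p₁|) := by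
    filter_upwards [eventually_ge_atTop 1] with n hn
    have hn' : n ≠ 0 := by omega
    rw [hchar n hn']
    refine PermPattern.norm_integral_uniformOn_sub_le (t n) _ _ fun g hg => ?_
    have h1 := PermPattern.norm_integral_cexp_patternStat_sub_le hn' hp₁ g hC
    -- The variance depends only on the cycle type, so that of an arbitrary `g` in the class may be
    -- replaced by that of the representative `ρ n`.
    rw [PermPattern.sum_sum_nbhd_integral_centred (PermPattern.measurable_projStat hp₁) hg,
      ← PermPattern.sum_sum_nbhd_integral_centred (PermPattern.measurable_projStat hp₁) (hρ n), PermPattern.fixFrac,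
      PermPattern.card_fixedPoints_of_mem_cyclicClass hg] at h1
    exact h1
  have hsqrt : Tendsto (fun n : ℕ => (√(n : ℝ))⁻¹) atTop (nhds 0) :=
    tendsto_inv_atTop_zero.comp (Real.tendsto_sqrt_atTop.comp tendsto_natCast_atTop_atTop)
  have hzero : Tendsto (fun n : ℕ => K1 * (√(n : ℝ))⁻¹ +
      K2 * (√n * |(PermPattern.numCycles (t n) 1 : ℝ) / n - p₁|)) atTop (nhds 0) := by
    simpa using (hsqrt.const_mul K1).add ((PermPattern.tendsto_numCycles_one_div ht₁).const_mul K2)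
  have hexp : Tendsto (fun n => Complex.exp (-(q n / 2 : ℝ))) atTop
      (nhds (Complex.exp ((inner ℝ θ 0 : ℝ) * Complex.I -
        ((θ.ofLp ⬝ᵥ (PermPattern.limitCov (s + 1) p₁ p₂).mulVec θ.ofLp : ℝ) : ℂ) / 2))) := by
    rw [inner_zero_right, Complex.ofReal_zero, zero_mul, zero_sub]
    have h1 := (Complex.continuous_ofReal.tendsto _).comp ((hvar θ.ofLp).div_const 2)
    have h2 := (Complex.continuous_exp.tendsto _).comp h1.neg
    rw [Complex.ofReal_div] at h2
    exact h2
  have hdiff := squeeze_zero_norm' hbound hzero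
  have := hdiff.add hexp
  simp only [sub_add_cancel, zero_add] at this
  exact this
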